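/- **Setting.** Let $(\Sigma,\mu)$ be a measure space. A family $\mathscr B$ of measurable sets ("balls"), together with a map $B\mapsto B^*$ of $\mathscr B$ into itself and a constant $\mathfrak C_0\ge 1$, is a *ball-basis* if: (B1) $0<\mu(B)<\infty$ for all $B\in\mathscr B$; (B2) any two points of $\Sigma$ lie in a common ball; (B3) for every $\varepsilon>0$ and every measurable set $E$ there is a finite (possibly empty) or infinite sequence of balls $B_k$ with $\mu(E\,\Delta\,\bigcup_k B_k)<\varepsilon$; (B4) for every $B \in \mathscr B$, every ball $B'$ with $B'\cap B\ne\emptyset$ and $\mu(B')\le 2\mu(B)$ is contained in $B^*$, and $\mu(B^*)\le\mathfrak C_0\,\mu(B)$. Let $m\ge 1$ and $r\in[1,\infty)$. Write $\langle f\rangle_{B,r}=\big(\frac1{\mu(B)}\int_B|f|^r\,d\mu\big)^{1/r}$, $\lfloor f\rfloor_{B,r}=\sup_{B'\in\mathscr B,\,B'\supset B}\langle f\rangle_{B',r}$, $b_B=\frac1{\mu(B)}\int_B b\,d\mu$, and $\vec f\,\mathbf 1_E=(f_1\mathbf 1_E,\dots,f_m\mathbf 1_E)$ for $\vec f = (f_1,\dots,f_m)$.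 Let $\mathbb B$ be a real Banach space. An operator $T$ sending each $\vec f\in L^r(\Sigma,\mu)^m$ to a real-valued measurable function is a *$\mathbb B$-valued multilinear bounded oscillation operator* with respect to $\mathscr B$ and $r$, with constants $\mathfrak C_1(T),\mathfrak C_2(T)\in(0,\infty)$, if either $T(\vec f)(x)=\|\mathcal T(\vec f)(x)\|_{\mathbb B}$ for all $x \in \Sigma$ with a $\mathbb B$-valued $m$-linear operator $\mathcal T$, or (the case $\mathbb B=\mathbb R$) $\mathcal T=T$ is real-valued and $m$-linear or $m$-sublinear, and for every $\vec f\in L^r(\Sigma,\mu)^m$: * (T1) for every $B_0\in\mathscr B$ with $B_0^*\subsetneq\Sigma$ there is $B\in\mathscr B$ with $B\supsetneq B_0$ and $$\sup_{x\in B_0}\|\mathcal T(\vec f\,\mathbf 1_{B^*})(x)-\mathcal T(\vec f\,\mathbf 1_{B_0^*})(x)\|_{\mathbb B}\le\mathfrak C_1(T)\prod_{i=1}^m\langle f_i\rangle_{B^*,r};$$ * (T2) for every $B\in\mathscr B$, $$\sup_{x,x'\in B}\big\|(\mathcal T(\vec f)-\mathcal T(\vec f\,\mathbf 1_{B^*}))(x)-(\mathcal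 T(\vec f)-\mathcal T(\vec f\,\mathbf 1_{B^*}))(x')\big\|_{\mathbb B}\le\mathfrak C_2(T)\prod_{i=1}^m\lfloor f_i\rfloor_{B,r}.$$ ($m$-linearity and $m$-sublinearity are understood pointwise at every $x \in \Sigma$.) For measurable $\mathbf b=(b_1,\dots,b_m)$ and $\alpha\in\{0,1\}^m$, with $\tau=\{i:\alpha_i\ne0\}$, the commutator is $$[T,\mathbf b]_\alpha(\vec f)(x)=T\big((b_1(x)-b_1)^{\alpha_1}f_1,\dots,(b_m(x)-b_m)^{\alpha_m}f_m\big)(x).$$ A family $\mathcal S\subset\mathscr B$ is *$\eta$-sparse* if there are pairwise disjoint measurable sets $E_B\subset B$ ($B\in\mathcal S$) with $\mu(E_B)\ge\eta\,\mu(B)$. For such $\mathcal S$ and disjoint $\tau_1,\tau_2\subset\{1,\dots,m\}$ set $$\mathcal A_{\mathcal S,r}(\vec f)(x)=\sum_{B\in\mathcal S}\prod_{i=1}^m\langle f_i\rangle_{B,r}\,\mathbf 1_B(x),$$ $$\mathcal A^{\mathbf b,\tau_1,\tau_2}_{\mathcal S,r}(\vec f)(x)=\sum_{B\in\mathcal S}\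 \prod_{i\in\tau_1}|b_i(x)-b_{i,B}|\,\langle f_i\rangle_{B,r}\prod_{j\in\tau_2}\langle(b_j-b_{j,B})f_j\rangle_{B,r}\prod_{k\notin\tau_1\cup\tau_2}\langle f_k\rangle_{B,r}\ \mathbf 1_B(x).$$ **Theorem 1.1.** Let $m\ge1$, $r\in[1,\infty)$ and $\mathfrak C_0\ge1$. There is a constant $K$ depending only on $m$, $r$ and $\mathfrak C_0$ such that the following holds. Let $(\Sigma,\mu)$ be a measure space with a ball-basis $\mathscr B$ with constant $\mathfrak C_0$, and let $T$ be a $\mathbb B$-valued multilinear bounded oscillation operator with respect to $\mathscr B$ and $r$ that is bounded from $L^r(\Sigma,\mu)\times\cdots\times L^r(\Sigma,\mu)$ to $L^{r/m,\infty}(\Sigma,\mu)$; put $$\mathfrak C(T)=\mathfrak C_1(T)+\mathfrak C_2(T)+\|T\|_{L^r\times\cdots\times L^r\to L^{r/m,\infty}}.$$ Let $\mathbf b=(b_1,\dots,b_m)$ be measurable functions and $\alpha\in\{0,1\}^m$, where $b_i$ is integrable on every ball for $i\in\tau$. Let $B\in\mathscr B$ and $f_1,\dots,f_m\in L^r(\Sigma,\mu)$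 satisfy $\|f_i\|_{L^r(B,\mu)}^r\ge\frac12\|f_i\|_{L^r(\Sigma,\mu)}^r$ for all $i$, and $b_if_i\in L^r(\Sigma,\mu)$ for $i\in\tau$ (so that $[T,\mathbf b]_\alpha(\vec f)$ is defined). Then there are two $\frac1{2\mathfrak C_0^3}$-sparse families $\mathcal S_1,\mathcal S_2\subset\mathscr B$ such that for a.e. $x\in B$, $$|T(\vec f)(x)|\le K\,\mathfrak C(T)\,\big[\mathcal A_{\mathcal S_1,r}(\vec f)(x)+\mathcal A_{\mathcal S_2,r}(\vec f)(x)\big],$$ $$|[T,\mathbf b]_\alpha(\vec f)(x)|\le K\,\mathfrak C(T)\sum_{\tau_1\uplus\tau_2=\tau}\big[\mathcal A^{\mathbf b,\tau_1,\tau_2}_{\mathcal S_1,r}(\vec f)(x)+\mathcal A^{\mathbf b,\tau_1,\tau_2}_{\mathcal S_2,r}(\vec f)(x)\big].$$ -/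

import Mathlib

open MeasureTheory Set
open scoped ENNReal NNReal

namespace SparseBO

noncomputable section

universe u v

/-- A ball-basis of the measure space `(X, μ)`: a family `𝓑` of measurable sets with a choice
`B ↦ star B` of the enlarged ball `B^*` and the constant `C₀ ≥ 1`. In `density` the approximating
sequence of balls may be finite (also empty) or infinite. -/
structure IsBallBasis {X : Type u} [MeasurableSpace X] (μ : Measure X) (𝓑 : Set (Set X))
    (star : Set X → Set X) (C₀ : ℝ≥0) : Prop where
  one_le : 1 ≤ C₀
  measurableSet : ∀ B ∈ 𝓑, MeasurableSet B
  measure_pos : ∀ B ∈ 𝓑, 0 < μ B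
  measure_lt_top : ∀ B ∈ 𝓑, μ B < ∞
  exists_mem : ∀ x y : X, ∃ B ∈ 𝓑, x ∈ B ∧ y ∈ B
  density : ∀ ε : ℝ≥0∞, 0 < ε → ∀ E : Set X, MeasurableSet E →
    ∃ 𝓒 : Set (Set X), 𝓒 ⊆ 𝓑 ∧ 𝓒.Countable ∧ μ (symmDiff E (⋃₀ 𝓒)) < ε
  star_mem : ∀ B ∈ 𝓑, star B ∈ 𝓑
  subset_star : ∀ B ∈ 𝓑, ∀ B' ∈ 𝓑, (B' ∩ B).Nonempty → μ B' ≤ 2 * μ B → B' ⊆ star B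
  measure_star_le : ∀ B ∈ 𝓑, μ (star B) ≤ C₀ * μ B

/-- The `L^r` average `⟨f⟩_{B,r} = (⨍_B |f|^r dμ)^{1/r}`. -/
def avg {X : Type u} [MeasurableSpace X] (μ : Measure X) (r : ℝ) (B : Set X) (f : X → ℝ) :
    ℝ≥0∞ :=
  (⨍⁻ x in B, ‖f x‖ₑ ^ r ∂μ) ^ (1 / r)

/-- `⌊f⌋_{B,r}`: the supremum of `⟨f⟩_{B',r}` over all balls `B' ⊇ B`. -/
def supAvg {X : Type u} [MeasurableSpace X] (μ : Measure X) (𝓑 : Set (Set X)) (r : ℝ)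
    (B : Set X) (f : X → ℝ) : ℝ≥0∞ :=
  ⨆ B' ∈ 𝓑, ⨆ _ : B ⊆ B', avg μ r B' f

/-- The tuple `f 1_E = (f₁ 1_E, …, f_m 1_E)`. -/
def cut {X : Type u} {m : ℕ} (E : Set X) (f : Fin m → X → ℝ) : Fin m → X → ℝ :=
  fun i => E.indicator (f i)

/-- The tuples `f = (f₁, …, f_m)` with every `f_i` in `L^r(X, μ)`. -/
def LrTuple {X : Type u} [MeasurableSpace X] (μ : Measure X) (r : ℝ) (m : ℕ) :
    Set (Fin m → X → ℝ) :=
  {f | ∀ i, MemLp (f i) (ENNReal.ofReal r) μ}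

/-- `𝒯`, with values in `E`, is `m`-linear on `L^r × ⋯ × L^r`. -/
structure IsMLinear {X : Type u} [MeasurableSpace X] (μ : Measure X) (r : ℝ) {m : ℕ}
    {E : Type v} [NormedAddCommGroup E] [NormedSpace ℝ E]
    (𝒯 : (Fin m → X → ℝ) → X → E) : Prop where
  map_smul : ∀ f ∈ LrTuple μ r m, ∀ (i : Fin m) (c : ℝ) (x : X),
    𝒯 (Function.update f i (c • f i)) x = c • 𝒯 f x
  map_add : ∀ f ∈ LrTuple μ r m, ∀ (i : Fin m) (g : X → ℝ), MemLp g (ENNReal.ofReal r) μ →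
    ∀ x : X, 𝒯 (Function.update f i (f i + g)) x = 𝒯 f x + 𝒯 (Function.update f i g) x

/-- The real-valued operator `T` is `m`-sublinear on `L^r × ⋯ × L^r`. -/
structure IsMSublinear {X : Type u} [MeasurableSpace X] (μ : Measure X) (r : ℝ) {m : ℕ}
    (T : (Fin m → X → ℝ) → X → ℝ) : Prop where
  map_smul : ∀ f ∈ LrTuple μ r m, ∀ (i : Fin m) (c : ℝ) (x : X),
    |T (Function.update f i (c • f i)) x| = |c| * |T f x|
  map_add : ∀ f ∈ LrTuple μ r m, ∀ (i : Fin m) (g : X → ℝ), MemLp g (ENNReal.ofReal r) μ →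
    ∀ x : X, |T (Function.update f i (f i + g)) x| ≤ |T f x| + |T (Function.update f i g) x|

/-- The two oscillation conditions on `𝒯`, with constants `C₁` (size) and `C₂` (regularity). -/
structure OscBounds {X : Type u} [MeasurableSpace X] (μ : Measure X) (𝓑 : Set (Set X))
    (star : Set X → Set X) (r : ℝ) {m : ℕ} {E : Type v} [NormedAddCommGroup E]
    (𝒯 : (Fin m → X → ℝ) → X → E) (C₁ C₂ : ℝ≥0) : Prop where
  size : ∀ f ∈ LrTuple μ r m, ∀ B₀ ∈ 𝓑, star B₀ ≠ univ → ∃ B ∈ 𝓑, B₀ ⊂ B ∧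
    ∀ x ∈ B₀, ‖𝒯 (cut (star B) f) x - 𝒯 (cut (star B₀) f) x‖ₑ
      ≤ C₁ * ∏ i, avg μ r (star B) (f i)
  regularity : ∀ f ∈ LrTuple μ r m, ∀ B ∈ 𝓑, ∀ x ∈ B, ∀ x' ∈ B,
    ‖(𝒯 f x - 𝒯 (cut (star B) f) x) - (𝒯 f x' - 𝒯 (cut (star B) f) x')‖ₑ
      ≤ C₂ * ∏ i, supAvg μ 𝓑 r B (f i)

/-- `T` is an `E`-valued multilinear bounded oscillation operator with respect to `𝓑` and `r`,
with constants `C₁`, `C₂`. Only the values of `T` on tuples of `L^r` functions matter, and they are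
measurable functions. The second alternative is the real-valued case, in which `𝒯 = T` and
sublinear operators are admitted too; it does not involve `E`. -/
def IsBoundedOscillation {X : Type u} [MeasurableSpace X] (μ : Measure X) (𝓑 : Set (Set X))
    (star : Set X → Set X) (r : ℝ) {m : ℕ} (E : Type v) [NormedAddCommGroup E] [NormedSpace ℝ E]
    (T : (Fin m → X → ℝ) → X → ℝ) (C₁ C₂ : ℝ≥0) : Prop :=
  0 < C₁ ∧ 0 < C₂ ∧ (∀ f ∈ LrTuple μ r m, AEMeasurable (T f) μ) ∧
  ((∃ 𝒯 : (Fin m → X → ℝ) → X → E, IsMLinear μ r 𝒯 ∧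
      (∀ f ∈ LrTuple μ r m, ∀ x, T f x = ‖𝒯 f x‖) ∧ OscBounds μ 𝓑 star r 𝒯 C₁ C₂) ∨
    ((IsMLinear μ r T ∨ IsMSublinear μ r T) ∧ OscBounds μ 𝓑 star r T C₁ C₂))

/-- The quasi-norm of weak `L^p`: `sup_{t > 0} t μ{|g| > t}^{1/p}`. -/
def weakNorm {X : Type u} [MeasurableSpace X] (μ : Measure X) (p : ℝ) (g : X → ℝ) : ℝ≥0∞ :=
  ⨆ t : ℝ≥0, t * μ {x | (t : ℝ≥0∞) < ‖g x‖ₑ} ^ (1 / p)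

/-- The operator norm of `T : L^r × ⋯ × L^r → L^{r/m,∞}`, the least `N` such that
`‖T f‖_{L^{r/m,∞}} ≤ N ∏ ‖f_i‖_{L^r}`. `T` is bounded when it is finite. -/
def opNorm {X : Type u} [MeasurableSpace X] (μ : Measure X) (r : ℝ) {m : ℕ}
    (T : (Fin m → X → ℝ) → X → ℝ) : ℝ≥0∞ :=
  sInf {N : ℝ≥0∞ | ∀ f ∈ LrTuple μ r m,
    weakNorm μ (r / m) (T f) ≤ N * ∏ i, eLpNorm (f i) (ENNReal.ofReal r) μ}

/-- `𝒮 ⊆ 𝓑` is `η`-sparse. -/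
def IsSparse {X : Type u} [MeasurableSpace X] (μ : Measure X) (𝓑 : Set (Set X)) (η : ℝ≥0∞)
    (𝒮 : Set (Set X)) : Prop :=
  𝒮 ⊆ 𝓑 ∧ ∃ E : Set X → Set X,
    (∀ B ∈ 𝒮, MeasurableSet (E B) ∧ E B ⊆ B ∧ η * μ B ≤ μ (E B)) ∧ 𝒮.PairwiseDisjoint E

/-- The multilinear sparse operator `𝒜_{𝒮,r}`. -/
def sparseOp {X : Type u} [MeasurableSpace X] (μ : Measure X) (r : ℝ) {m : ℕ}
    (𝒮 : Set (Set X)) (f : Fin m → X → ℝ) (x : X) : ℝ≥0∞ :=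
  ∑' B : 𝒮, (B : Set X).indicator (fun _ => ∏ i, avg μ r B (f i)) x

/-- The coefficient `λ_{B,r}^{b,τ₁,τ₂}(f)(x)`, where `b_{i,B} = ⨍_B b_i dμ`. -/
def coeff {X : Type u} [MeasurableSpace X] (μ : Measure X) (r : ℝ) {m : ℕ}
    (b : Fin m → X → ℝ) (τ₁ τ₂ : Finset (Fin m)) (B : Set X) (f : Fin m → X → ℝ) (x : X) :
    ℝ≥0∞ :=
  (∏ i ∈ τ₁, ‖b i x - ⨍ z in B, b i z ∂μ‖ₑ * avg μ r B (f i)) *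
    (∏ j ∈ τ₂, avg μ r B (fun y => (b j y - ⨍ z in B, b j z ∂μ) * f j y)) *
    ∏ k ∈ (τ₁ ∪ τ₂)ᶜ, avg μ r B (f k)

/-- The sparse operator `𝒜_{𝒮,r}^{b,τ₁,τ₂}`. -/
def sparseComm {X : Type u} [MeasurableSpace X] (μ : Measure X) (r : ℝ) {m : ℕ}
    (𝒮 : Set (Set X)) (b : Fin m → X → ℝ) (τ₁ τ₂ : Finset (Fin m)) (f : Fin m → X → ℝ) (x : X) :
    ℝ≥0∞ :=
  ∑' B : 𝒮, (B : Set X).indicator (coeff μ r b τ₁ τ₂ B f) x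

/-- The `k`-th order commutator `[T, b]_{k e_i}` in the `i`-th entry:
`[T, b]_{k e_i}(f)(x) = T(f₁, …, (b_i(x) - b_i)^k f_i, …, f_m)(x)`. -/
def commEntry {X : Type u} {m : ℕ} (b : Fin m → X → ℝ) (T : (Fin m → X → ℝ) → X → ℝ)
    (i : Fin m) (k : ℕ) : (Fin m → X → ℝ) → X → ℝ :=
  fun f x => T (Function.update f i (fun y => (b i x - b i y) ^ k * f i y)) x

/-- `[T, b]_α = [⋯[[T, b]_{α₁ e₁}, b]_{α₂ e₂} ⋯, b]_{α_m e_m}`. -/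
def commutator {X : Type u} {m : ℕ} (b : Fin m → X → ℝ) (α : Fin m → ℕ)
    (T : (Fin m → X → ℝ) → X → ℝ) : (Fin m → X → ℝ) → X → ℝ :=
  (List.finRange m).foldl (fun S i => commEntry b S i (α i)) T

theorem foldl_commEntry {X : Type u} {m : ℕ} (b : Fin m → X → ℝ) (α : Fin m → ℕ)
    (l : List (Fin m)) (hl : l.Nodup) (T : (Fin m → X → ℝ) → X → ℝ) (f : Fin m → X → ℝ) (x : X) :
    l.foldl (fun S i => commEntry b S i (α i)) T f x =
      T (fun i => if i ∈ l then fun y => (b i x - b i y) ^ α i * f i y else f i) x := by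
  induction l generalizing T with
  | nil => simp
  | cons a l ih =>
    obtain ⟨ha, hl'⟩ := List.nodup_cons.1 hl
    rw [List.foldl_cons, ih hl']
    unfold commEntry
    congr 1
    funext i
    by_cases hi : i = a
    · subst hi
      simp [ha]
    · simp [hi]

/-- The commutator in closed form. -/
theorem commutator_apply {X : Type u} {m : ℕ} (b : Fin m → X → ℝ) (α : Fin m → ℕ)
    (T : (Fin m → X → ℝ) → X → ℝ) (f : Fin m → X → ℝ) (x : X) :
    commutator b α T f x = T (fun i y => (b i x - b i y) ^ α i * f i y) x := by
  unfold commutator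
  rw [foldl_commEntry b α _ (List.nodup_finRange m)]
  simp

end

end SparseBO

/-! The proof is a stopping-ball argument that works by scales of measure, since ball-bases carry no
dyadic structure. Write `S N` for the triple enlargement of a ball `N`. Outside a set `F N` of
measure at most `δ μ N`, the localized operator and the maximal functions of the localized entries
are controlled by averages over `S N` (`IsOscillationOperator.exists_isExceptional`; this uses the
weak type bounds). Almost every point of `F N` lies in a ball half filled by `F N`
(`IsBallBasis.ae_exists_ball`), and one takes such a ball `B` of nearly maximal measure as stopping
ball. Every much larger ball around `B` then contains good points. Comparing with the values at a
good point through (T1) and (T2) shows that replacing the localization of `N` by that of `B` costs a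
constant times one product of averages over `S N` (`IsExceptional.sub_le`). Telescoping along the
chain of stopping balls of a point dominates the operator by a sum over triple enlargements.

Sparseness is the delicate point, since stopping balls of different points overlap. Balls are
selected scale by scale, each time a maximal disjoint subfamily, and every point of the enlargement
of a selected ball is reassigned to a selected ball whose enlargement contains it. Hence a later
ball meeting `N` descends from one of the neighbours of `N`, selected balls of comparable scale.
Their total measure is `O(μ N)`, while descendants fill only an `O(δ)` part of their ancestor, so at
least half of `N` stays uncovered (`IsStopping.measure_le_two_mul_sdiff`). The enlargements
therefore have finite total measure, and by Borel–Cantelli the chain of almost every point ends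
(`IsStopping.ae_exists_notMem`).

For commutators, `(b_i(x) - b_i) f_i` is split around the mean of `b_i` on the ball of averaging.
The exceptional sets see only `f_i` and `(b_i - b_{i,S}) f_i`; the scalars `b_i(x) - b_{i,S}` enter
afterwards by multilinear expansion. So the exceptional sets do not depend on `x`, and one sparse
family serves both estimates. The construction starts from a ball `A ⊇ B` so large that it carries
half of the norm of all these functions, uniformly in the means (`exists_top_ball`). -/

namespace SparseBO

noncomputable section

universe u v

/-! ### Covering, density and exhaustion in a ball-basis. -/

section BallBasis

variable {X : Type u} [MeasurableSpace X] {μ : Measure X} {𝓑 : Set (Set X)}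
  {star : Set X → Set X} {C₀ : ℝ≥0}

namespace IsBallBasis

theorem nonempty (h : IsBallBasis μ 𝓑 star C₀) {B : Set X} (hB : B ∈ 𝓑) : B.Nonempty := by
  rw [nonempty_iff_ne_empty]
  rintro rfl
  simpa using h.measure_pos _ hB

theorem subset_star_self (h : IsBallBasis μ 𝓑 star C₀) {B : Set X} (hB : B ∈ 𝓑) : B ⊆ star B := by
  refine h.subset_star B hB B hB (by simpa using h.nonempty hB) ?_
  rw [two_mul]
  exact le_self_add

theorem one_le_ennreal (h : IsBallBasis μ 𝓑 star C₀) : (1 : ℝ≥0∞) ≤ C₀ := by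
  exact_mod_cast h.one_le

/-- Vitali covering: a family of balls of bounded measure has a disjoint subfamily whose
enlargements cover it. -/
theorem exists_disjoint_subfamily (h : IsBallBasis μ 𝓑 star C₀) {𝒢 : Set (Set X)} (h𝒢 : 𝒢 ⊆ 𝓑)
    {R : ℝ≥0∞} (hR : R ≠ ∞) (hle : ∀ B ∈ 𝒢, μ B ≤ R) :
    ∃ 𝒟 ⊆ 𝒢, 𝒟.PairwiseDisjoint id ∧ ∀ B ∈ 𝒢, ∃ D ∈ 𝒟, B ⊆ star D := by
  obtain ⟨𝒟, h𝒟, hd, hc⟩ := Vitali.exists_disjoint_subfamily_covering_enlargement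
    (fun B : Set X => B) 𝒢 (fun B => (μ B).toReal) 2 one_lt_two (fun _ _ => ENNReal.toReal_nonneg)
    R.toReal (fun B hB => ENNReal.toReal_mono hR (hle B hB)) (fun B hB => h.nonempty (h𝒢 hB))
  refine ⟨𝒟, h𝒟, hd, fun B hB => ?_⟩
  obtain ⟨D, hD, hne, hm⟩ := hc B hB
  refine ⟨D, hD, h.subset_star D (h𝒢 (h𝒟 hD)) B (h𝒢 hB) hne ?_⟩
  have h1 : μ B ≠ ∞ := (h.measure_lt_top B (h𝒢 hB)).ne
  have h2 : μ D ≠ ∞ := (h.measure_lt_top D (h𝒢 (h𝒟 hD))).ne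
  rw [← ENNReal.toReal_le_toReal h1 (by finiteness), ENNReal.toReal_mul]
  simpa using hm

theorem tsum_measure_le (h : IsBallBasis μ 𝓑 star C₀) (ν : Measure X) {𝒟 : Set (Set X)}
    (h𝒟 : 𝒟 ⊆ 𝓑) (hd : 𝒟.PairwiseDisjoint id) : ∑' D : 𝒟, ν D ≤ ν (⋃₀ 𝒟) := by
  rw [sUnion_eq_iUnion]
  refine tsum_meas_le_meas_iUnion_of_disjoint ν (fun D => h.measurableSet _ (h𝒟 D.2)) ?_
  intro D D' hne
  exact hd D.2 D'.2 (fun h => hne (Subtype.ext h))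

theorem countable_of_disjoint (h : IsBallBasis μ 𝓑 star C₀) {𝒟 : Set (Set X)}
    (h𝒟 : 𝒟 ⊆ 𝓑) (hd : 𝒟.PairwiseDisjoint id) (ν : Measure X) (hν : ν (⋃₀ 𝒟) ≠ ∞)
    (hpos : ∀ D ∈ 𝒟, ν D ≠ 0) : 𝒟.Countable := by
  have h1 : ∑' D : 𝒟, ν D ≠ ∞ := ne_top_of_le_ne_top hν (h.tsum_measure_le ν h𝒟 hd)
  have h2 := Summable.countable_support_ennreal h1
  have h3 : Function.support (fun D : 𝒟 => ν D) = univ := by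
    ext D
    simpa using hpos D D.2
  rw [h3, countable_univ_iff] at h2
  exact h2

/-- The Vitali argument with a free comparison measure `ν`. The density theorem uses for `ν` the
restriction of `μ` to an error set, the maximal theorem the density `|g|^r`. -/
theorem measure_le_of_covering (h : IsBallBasis μ 𝓑 star C₀) {𝒢 : Set (Set X)} (h𝒢 : 𝒢 ⊆ 𝓑)
    (ν : Measure X) (hν : ν univ ≠ ∞) {a : ℝ≥0∞} (ha : a ≠ ∞) (hle : ∀ B ∈ 𝒢, μ B ≤ a * ν B)
    {S : Set X} (hS : S ⊆ ⋃₀ 𝒢) : μ S ≤ C₀ * (a * ν univ) := by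
  obtain ⟨𝒟, h𝒟, hd, hc⟩ := h.exists_disjoint_subfamily h𝒢 (R := a * ν univ) (by finiteness)
    (fun B hB => (hle B hB).trans (by gcongr; exact subset_univ _))
  have hcount : 𝒟.Countable := by
    refine h.countable_of_disjoint (h𝒟.trans h𝒢) hd ν
      (ne_top_of_le_ne_top hν (measure_mono (subset_univ _))) fun D hD h0 => ?_
    have := hle D (h𝒟 hD)
    rw [h0, mul_zero] at this
    exact absurd this (not_le.2 (h.measure_pos D (h𝒢 (h𝒟 hD))))
  have hcov : S ⊆ ⋃ D ∈ 𝒟, star D := by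
    intro x hx
    obtain ⟨B, hB, hxB⟩ := hS hx
    obtain ⟨D, hD, hBD⟩ := hc B hB
    exact mem_biUnion hD (hBD hxB)
  calc μ S ≤ ∑' D : 𝒟, μ (star D) :=
        (measure_mono hcov).trans (measure_biUnion_le μ hcount star)
    _ ≤ ∑' D : 𝒟, C₀ * (a * ν D) := by
        refine ENNReal.tsum_le_tsum fun D => (h.measure_star_le D (h𝒢 (h𝒟 D.2))).trans ?_
        gcongr
        exact hle D (h𝒟 D.2)
    _ = C₀ * (a * ∑' D : 𝒟, ν D) := by rw [ENNReal.tsum_mul_left, ENNReal.tsum_mul_left]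
    _ ≤ C₀ * (a * ν univ) := by
        gcongr
        exact (h.tsum_measure_le ν (h𝒟.trans h𝒢) hd).trans (measure_mono (subset_univ _))

/-- Almost every point of a set of finite measure lies in a ball of which the set fills one half. -/
theorem ae_exists_ball (h : IsBallBasis μ 𝓑 star C₀) {F : Set X} (hF : MeasurableSet F)
    (hFtop : μ F ≠ ∞) : ∀ᵐ x ∂μ, x ∈ F → ∃ B ∈ 𝓑, x ∈ B ∧ μ B ≤ 2 * μ (B ∩ F) := by
  set F' : Set X := {x | x ∈ F ∧ ∀ B ∈ 𝓑, x ∈ B → 2 * μ (B ∩ F) < μ B} with hF'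
  have hset : {x | ¬ (x ∈ F → ∃ B ∈ 𝓑, x ∈ B ∧ μ B ≤ 2 * μ (B ∩ F))} = F' := by
    ext x
    simp [hF']
  rw [ae_iff, hset]
  set H : Set X := F ∩ toMeasurable μ F' with hH
  have hHm : MeasurableSet H := hF.inter (measurableSet_toMeasurable _ _)
  have hFH : F' ⊆ H := fun x hx => ⟨hx.1, subset_toMeasurable _ _ hx⟩
  -- Approximate `H ⊇ F'` by a union of balls up to `ε`. An approximating ball that meets `F'` has
  -- at least half of its measure outside `H`, so these balls are controlled by the error set; the
  -- part of `F'` missed by the union is itself error.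
  have key : ∀ ε : ℝ≥0∞, 0 < ε → ε ≠ ∞ → μ F' ≤ (1 + C₀ * 2) * ε := by
    intro ε hε hεtop
    obtain ⟨𝒞, h𝒞, hcount, hlt⟩ := h.density ε hε H hHm
    set ν := μ.restrict (⋃₀ 𝒞 \ H) with hν
    have hνε : ν univ ≤ ε := by
      rw [hν, Measure.restrict_apply_univ]
      exact (measure_mono (fun x hx => Or.inr hx)).trans hlt.le
    set 𝒢 : Set (Set X) := {B | B ∈ 𝒞 ∧ (B ∩ F').Nonempty} with h𝒢
    have hball : ∀ B ∈ 𝒢, μ B ≤ 2 * ν B := by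
      rintro B ⟨hB, x, hxB, hxF⟩
      have hBm := h.measurableSet B (h𝒞 hB)
      have h1 : ν B = μ (B \ H) := by
        rw [hν, Measure.restrict_apply hBm]
        congr 1
        ext y
        simp only [mem_inter_iff, mem_sdiff, mem_sUnion]
        exact ⟨fun hy => ⟨hy.1, hy.2.2⟩, fun hy => ⟨hy.1, ⟨B, hB, hy.1⟩, hy.2⟩⟩
      have h2 : μ B ≤ μ (B ∩ F) + ν B := by
        rw [h1, ← measure_inter_add_sdiff B hHm]
        gcongr
        exact inter_subset_left
      have h3 := hxF.2 B (h𝒞 hB) hxB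
      have htop := (h.measure_lt_top B (h𝒞 hB)).ne
      have h4 : μ B + μ B ≤ μ B + 2 * ν B := by
        calc μ B + μ B = 2 * μ B := (two_mul _).symm
          _ ≤ 2 * (μ (B ∩ F) + ν B) := by gcongr
          _ = 2 * μ (B ∩ F) + 2 * ν B := mul_add _ _ _
          _ ≤ μ B + 2 * ν B := by gcongr
      exact (ENNReal.add_le_add_iff_left htop).1 h4
    have hcov := h.measure_le_of_covering (S := F' ∩ ⋃₀ 𝒞) (𝒢 := 𝒢) (fun B hB => h𝒞 hB.1) ν
      (ne_top_of_le_ne_top hεtop hνε) ENNReal.ofNat_ne_top hball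
      (by
        rintro x ⟨hx, B, hB, hxB⟩
        exact ⟨B, ⟨hB, x, hxB, hx⟩, hxB⟩)
    calc μ F' ≤ μ (symmDiff H (⋃₀ 𝒞) ∪ F' ∩ ⋃₀ 𝒞) := by
          refine measure_mono fun x hx => ?_
          by_cases hx' : x ∈ ⋃₀ 𝒞
          · exact Or.inr ⟨hx, hx'⟩
          · exact Or.inl (Or.inl ⟨hFH hx, hx'⟩)
      _ ≤ ε + C₀ * (2 * ε) := by
          refine (measure_union_le _ _).trans (add_le_add hlt.le (hcov.trans ?_))
          gcongr
      _ = (1 + C₀ * 2) * ε := by ring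
  by_contra hne
  have hpos : 0 < μ F' := pos_iff_ne_zero.2 hne
  have htop : μ F' ≠ ∞ := ne_top_of_le_ne_top hFtop (measure_mono fun x hx => hx.1)
  have hc0 : (1 + (C₀ : ℝ≥0∞) * 2) ≠ 0 := by positivity
  have hct : (1 + (C₀ : ℝ≥0∞) * 2) ≠ ∞ := by finiteness
  have := key (μ F' / 2 / (1 + C₀ * 2)) (ENNReal.div_pos (ENNReal.half_pos hne).ne' hct)
    (ENNReal.div_ne_top (ENNReal.div_ne_top htop two_ne_zero) hc0)
  rw [ENNReal.mul_div_cancel hc0 hct] at this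
  exact absurd this (not_le.2 (ENNReal.half_lt_self hne htop))

/-- The enlargements of a suitable sequence of balls exhaust the space. -/
theorem exists_exhaustion (h : IsBallBasis μ 𝓑 star C₀) (x₀ : X) :
    ∃ G : ℕ → Set X, (∀ n, G n ∈ 𝓑) ∧
      ∀ B ∈ 𝓑, x₀ ∈ B → ∀ᶠ n in Filter.atTop, B ⊆ star (G n) := by
  set S : Set ℝ≥0∞ := {t | ∃ B ∈ 𝓑, x₀ ∈ B ∧ μ B = t} with hS
  have hne : S.Nonempty := by
    obtain ⟨B, hB, hx, -⟩ := h.exists_mem x₀ x₀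
    exact ⟨μ B, B, hB, hx, rfl⟩
  obtain ⟨t, -, ht, htS⟩ := exists_seq_tendsto_sSup hne (OrderTop.bddAbove S)
  choose G hG hxG hGt using htS
  refine ⟨G, hG, fun B hB hx => ?_⟩
  have hle : μ B ≤ sSup S := le_sSup ⟨B, hB, hx, rfl⟩
  -- The supremum may be infinite; the strict inequality with the factor 2 covers both cases and is
  -- inherited by `G n` for large `n`.
  have hlt : μ B < 2 * sSup S := by
    refine lt_of_lt_of_le ?_ (mul_le_mul_right hle 2)
    have := ENNReal.lt_add_right (h.measure_lt_top B hB).ne (h.measure_pos B hB).ne'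
    rwa [← two_mul] at this
  have ht2 := ENNReal.Tendsto.const_mul (a := 2) ht (Or.inr ENNReal.ofNat_ne_top)
  filter_upwards [ht2.eventually_const_lt hlt] with n hn
  refine h.subset_star (G n) (hG n) B hB ⟨x₀, hx, hxG n⟩ ?_
  rw [hGt n]
  exact hn.le

/-- The balls of comparable measure touching a given ball lie in one ball of comparable measure. -/
theorem exists_container (h : IsBallBasis μ 𝓑 star C₀) {N : Set X} (hN : N ∈ 𝓑) {L : ℝ≥0∞}
    (hL : 1 ≤ L) (hLtop : L ≠ ∞) :
    ∃ M ∈ 𝓑, μ M ≤ C₀ ^ 2 * (L * μ N) ∧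
      ∀ B ∈ 𝓑, (B ∩ N).Nonempty → μ B ≤ L * μ N → B ⊆ M := by
  set S : Set ℝ≥0∞ := {t | ∃ B ∈ 𝓑, (B ∩ N).Nonempty ∧ μ B ≤ L * μ N ∧ μ B = t} with hS
  have hNS : μ N ∈ S := ⟨N, hN, by simpa using h.nonempty hN, le_mul_of_one_le_left' hL, rfl⟩
  have hNle : μ N ≤ sSup S := le_sSup hNS
  have hLN : L * μ N ≠ ∞ := ENNReal.mul_ne_top hLtop (h.measure_lt_top N hN).ne
  have hSle : sSup S ≤ L * μ N := sSup_le (by rintro _ ⟨B, -, -, hle, rfl⟩; exact hle)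
  have hpos : sSup S ≠ 0 := ((h.measure_pos N hN).trans_le hNle).ne'
  -- With `B₁` of nearly maximal measure, `N` lies in the enlargement of `B₁`; every competitor
  -- touches that enlargement and is absorbed by the next one.
  obtain ⟨_, ⟨B₁, hB₁, hne₁, hle₁, rfl⟩, hlt⟩ := lt_sSup_iff.1
    (ENNReal.half_lt_self hpos (ne_top_of_le_ne_top hLN hSle))
  have hR : sSup S ≤ 2 * μ B₁ := by
    rw [mul_comm]
    exact (ENNReal.div_le_iff two_ne_zero ENNReal.ofNat_ne_top).1 hlt.le
  have hs₁ := h.star_mem B₁ hB₁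
  have hN₁ : N ⊆ star B₁ := h.subset_star B₁ hB₁ N hN (by rwa [inter_comm]) (hNle.trans hR)
  refine ⟨star (star B₁), h.star_mem _ hs₁, ?_, fun B hB hne hle => ?_⟩
  · calc μ (star (star B₁)) ≤ C₀ * (C₀ * μ B₁) :=
          (h.measure_star_le _ hs₁).trans (by gcongr; exact h.measure_star_le _ hB₁)
      _ = C₀ ^ 2 * μ B₁ := by ring
      _ ≤ _ := by gcongr
  · refine h.subset_star _ hs₁ B hB (hne.mono (inter_subset_inter_right _ hN₁)) ?_
    refine ((le_sSup (show μ B ∈ S from ⟨B, hB, hne, hle, rfl⟩)).trans hR).trans ?_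
    gcongr
    exact h.subset_star_self hB₁

end IsBallBasis

end BallBasis

/-! ### Dyadic scales of measure relative to the top ball. -/

section Scale

variable {X : Type u} [MeasurableSpace X] {μ : Measure X} {A B B' : Set X}

/-- The dyadic scale of `μ B` relative to `μ A`. -/
def scale (μ : Measure X) (A B : Set X) : ℕ := sInf {s | μ A < 2 ^ (s + 1) * μ B}

theorem lt_two_pow_scale_mul (hA : μ A ≠ ∞) (hB : μ B ≠ 0) :
    μ A < 2 ^ (scale μ A B + 1) * μ B := by
  have hne : {s : ℕ | μ A < 2 ^ (s + 1) * μ B}.Nonempty := by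
    obtain ⟨n, hn⟩ := ENNReal.exists_nat_mul_gt hB hA
    refine ⟨n, hn.trans_le ?_⟩
    gcongr
    have : n ≤ 2 ^ (n + 1) := (Nat.lt_two_pow_self).le.trans (Nat.pow_le_pow_right two_pos n.le_succ)
    exact_mod_cast this
  exact Nat.sInf_mem hne

theorem two_pow_scale_mul_le (h : μ B ≤ μ A) : 2 ^ scale μ A B * μ B ≤ μ A := by
  rcases Nat.eq_zero_or_pos (scale μ A B) with h0 | hpos
  · simpa [h0] using h
  · obtain ⟨k, hk⟩ := Nat.exists_eq_succ_of_ne_zero hpos.ne'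
    have hlt : k < scale μ A B := by omega
    have := Nat.notMem_of_lt_sInf (s := {s | μ A < 2 ^ (s + 1) * μ B}) hlt
    rw [hk]
    simpa using this

theorem le_scale {s : ℕ} (hA : μ A ≠ ∞) (hB : μ B ≠ 0) (h : 2 ^ s * μ B ≤ μ A) :
    s ≤ scale μ A B := by
  by_contra! hlt
  have h1 := lt_two_pow_scale_mul hA hB
  have h2 : (2 : ℝ≥0∞) ^ (scale μ A B + 1) ≤ 2 ^ s := pow_le_pow_right₀ one_le_two hlt
  exact absurd (h1.trans_le ((mul_le_mul_left h2 _).trans h)) (lt_irrefl _)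

theorem scale_le {s : ℕ} (h : μ A < 2 ^ (s + 1) * μ B) : scale μ A B ≤ s := Nat.sInf_le h

theorem measure_le_two_mul_of_scale_le (hA : μ A ≠ ∞) (hB : μ B ≠ 0) (hB' : μ B' ≤ μ A)
    (h : scale μ A B ≤ scale μ A B') : μ B' ≤ 2 * μ B := by
  have h1 := (two_pow_scale_mul_le hB').trans (lt_two_pow_scale_mul hA hB).le
  rw [pow_succ, mul_assoc] at h1
  have h2 : (2 : ℝ≥0∞) ^ scale μ A B' * μ B' ≤ 2 ^ scale μ A B' * (2 * μ B) := by
    refine h1.trans ?_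
    gcongr
    exact one_le_two
  exact (ENNReal.mul_le_mul_iff_right (by positivity) (by finiteness)).1 h2

end Scale

/-! ### Selection of stopping balls, their sparseness, and termination almost everywhere. -/

section Stopping

variable {X : Type u} [MeasurableSpace X] {μ : Measure X} {𝓑 : Set (Set X)}
  {star : Set X → Set X} {C₀ : ℝ≥0}

/-- A stopping rule: the stopping ball `β N x` of a point `x` of the exceptional set `G N` of the
ball `N` is half filled by the small set `F N`. -/
structure IsStoppingRule (μ : Measure X) (𝓑 : Set (Set X)) (star : Set X → Set X) (δ : ℝ≥0∞)
    (G F : Set X → Set X) (β : Set X → X → Set X) : Prop where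
  subset_star : ∀ N ∈ 𝓑, G N ⊆ star N
  mem : ∀ N ∈ 𝓑, ∀ x ∈ G N, β N x ∈ 𝓑
  self_mem : ∀ N ∈ 𝓑, ∀ x ∈ G N, x ∈ β N x
  le_inter : ∀ N ∈ 𝓑, ∀ x ∈ G N, μ (β N x) ≤ 2 * μ (β N x ∩ F N)
  measure_le : ∀ N ∈ 𝓑, μ (F N) ≤ δ * μ N

/-- The generations `𝒩 s` of stopping balls, selected scale by scale, and the assignment `a s` of
a stopping ball to every point after the scale `s` has been treated. -/
structure IsStopping (μ : Measure X) (star : Set X → Set X) (A : Set X)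
    (G : Set X → Set X) (β : Set X → X → Set X) (a : ℕ → X → Set X) (𝒩 : ℕ → Set (Set X)) :
    Prop where
  assign_zero : ∀ x, a 0 x = A
  level_zero : 𝒩 0 = {A}
  scale_eq : ∀ s, ∀ N ∈ 𝒩 (s + 1), scale μ A N = s + 1
  exists_eq : ∀ s, ∀ N ∈ 𝒩 (s + 1), ∃ x, x ∈ G (a s x) ∧ β (a s x) x = N
  disjoint : ∀ s, (𝒩 s).PairwiseDisjoint id
  maximal : ∀ s x, x ∈ G (a s x) → scale μ A (β (a s x) x) = s + 1 → (β (a s x) x).Nonempty →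
    ∃ N ∈ 𝒩 (s + 1), (β (a s x) x ∩ N).Nonempty
  assign_mem : ∀ s x, (∃ N ∈ 𝒩 (s + 1), x ∈ star N) →
    a (s + 1) x ∈ 𝒩 (s + 1) ∧ x ∈ star (a (s + 1) x)
  assign_eq : ∀ s x, (¬ ∃ N ∈ 𝒩 (s + 1), x ∈ star N) → a (s + 1) x = a s x

-- The Vitali lemma with constant size function, of which only maximality remains.
omit [MeasurableSpace X] in
theorem exists_maximal_disjoint (𝒢 : Set (Set X)) :
    ∃ 𝒟 ⊆ 𝒢, 𝒟.PairwiseDisjoint id ∧ ∀ B ∈ 𝒢, B.Nonempty → ∃ D ∈ 𝒟, (B ∩ D).Nonempty := by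
  obtain ⟨𝒟, h𝒟, hd, hc⟩ := Vitali.exists_disjoint_subfamily_covering_enlargement
    (fun B : Set X => B) {B | B ∈ 𝒢 ∧ B.Nonempty} (fun _ => 0) 2 one_lt_two (fun _ _ => le_rfl)
    0 (fun _ _ => le_rfl) (fun B hB => hB.2)
  exact ⟨𝒟, fun D hD => (h𝒟 hD).1, hd, fun B hB hne =>
    (hc B ⟨hB, hne⟩).imp fun D hD => ⟨hD.1, hD.2.1⟩⟩

theorem exists_isStopping (μ : Measure X) (star : Set X → Set X) (A : Set X)
    (G : Set X → Set X) (β : Set X → X → Set X) : ∃ a 𝒩, IsStopping μ star A G β a 𝒩 := by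
  classical
  choose sel hsub hdis hmax using exists_maximal_disjoint (X := X)
  let cand : ℕ → (X → Set X) → Set (Set X) := fun s a =>
    {B | (∃ x, x ∈ G (a x) ∧ β (a x) x = B) ∧ scale μ A B = s}
  -- Reassignment happens on the enlargement of a selected ball: a discarded candidate of the same
  -- scale meets a selected one, so it lies in that enlargement.
  let next : ℕ → (X → Set X) → X → Set X := fun s a x =>
    if hx : ∃ N ∈ sel (cand s a), x ∈ star N then hx.choose else a x
  let a : ℕ → X → Set X := fun s => Nat.rec (fun _ => A) (fun s a => next (s + 1) a) s
  let 𝒩 : ℕ → Set (Set X) := fun s => Nat.casesOn s {A} (fun s => sel (cand (s + 1) (a s)))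
  refine ⟨a, 𝒩, fun x => rfl, rfl, fun s N hN => (hsub _ hN).2, fun s N hN => (hsub _ hN).1, ?_,
    fun s x hx hs hne => hmax _ _ ⟨⟨x, hx, rfl⟩, hs⟩ hne, fun s x hx => ?_, fun s x hx => ?_⟩
  · rintro (_ | s)
    · exact pairwiseDisjoint_singleton _ _
    · exact hdis _
  · have hax : a (s + 1) x = hx.choose := dif_pos hx
    rw [hax]
    exact hx.choose_spec
  · exact dif_neg hx

section Nodes

variable {A : Set X} {G F : Set X → Set X} {β : Set X → X → Set X} {a : ℕ → X → Set X}
  {𝒩 : ℕ → Set (Set X)} {δ : ℝ≥0∞} {J : ℕ}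

theorem IsStoppingRule.measure_stop_le (hr : IsStoppingRule μ 𝓑 star δ G F β) {P : Set X}
    (hP : P ∈ 𝓑) {x : X} (hx : x ∈ G P) : μ (β P x) ≤ 2 * δ * μ P := by
  refine (hr.le_inter P hP x hx).trans ?_
  rw [mul_assoc]
  gcongr
  exact (measure_mono inter_subset_right).trans (hr.measure_le P hP)

theorem IsStoppingRule.two_mul_measure_stop_le (hr : IsStoppingRule μ 𝓑 star δ G F β)
    (hδ : C₀ ^ 3 * (4 * δ) ≤ 1) {P : Set X}
    (hP : P ∈ 𝓑) {x : X} (hx : x ∈ G P) : 2 * (C₀ ^ 3 * μ (β P x)) ≤ μ P := by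
  calc 2 * (C₀ ^ 3 * μ (β P x)) ≤ 2 * (C₀ ^ 3 * (2 * δ * μ P)) := by
        gcongr
        exact hr.measure_stop_le hP hx
    _ = (C₀ ^ 3 * (4 * δ)) * μ P := by ring
    _ ≤ 1 * μ P := by gcongr
    _ = μ P := one_mul _

theorem IsBallBasis.measure_star_star_le (h : IsBallBasis μ 𝓑 star C₀) {N : Set X} (hN : N ∈ 𝓑) :
    μ (star (star N)) ≤ C₀ ^ 2 * μ N := by
  calc μ (star (star N)) ≤ C₀ * (C₀ * μ N) :=
        (h.measure_star_le _ (h.star_mem _ hN)).trans (by gcongr; exact h.measure_star_le _ hN)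
    _ = C₀ ^ 2 * μ N := by ring

theorem IsBallBasis.measure_star_star_star_le (h : IsBallBasis μ 𝓑 star C₀) {N : Set X}
    (hN : N ∈ 𝓑) : μ (star (star (star N))) ≤ C₀ ^ 3 * μ N := by
  calc μ (star (star (star N))) ≤ C₀ ^ 2 * (C₀ * μ N) :=
        (h.measure_star_star_le (h.star_mem _ hN)).trans (by gcongr; exact h.measure_star_le _ hN)
    _ = C₀ ^ 3 * μ N := by ring

/-- The stopping ball touches the enlargement of `P` and is so small that three enlargements still
do not exceed `μ P`. This nests the double enlargements along chains, and the localization to a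
triple enlargement inside that of the parent. -/
theorem IsStoppingRule.star_star_star_stop_subset (h : IsBallBasis μ 𝓑 star C₀)
    (hr : IsStoppingRule μ 𝓑 star δ G F β) (hδ : C₀ ^ 3 * (4 * δ) ≤ 1) {P : Set X}
    (hP : P ∈ 𝓑) {x : X} (hx : x ∈ G P) : star (star (star (β P x))) ⊆ star (star P) := by
  have hN := hr.mem P hP x hx
  have h1 := h.star_mem _ hN
  have h2 := h.star_mem _ h1
  have hsub := (h.subset_star_self hN).trans ((h.subset_star_self h1).trans (h.subset_star_self h2))
  refine h.subset_star _ (h.star_mem _ hP) _ (h.star_mem _ h2)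
    ⟨x, hsub (hr.self_mem P hP x hx), hr.subset_star P hP hx⟩ ?_
  calc μ (star (star (star (β P x)))) ≤ C₀ ^ 3 * μ (β P x) := h.measure_star_star_star_le hN
    _ ≤ 2 * (C₀ ^ 3 * μ (β P x)) := le_mul_of_one_le_left' one_le_two
    _ ≤ μ P := hr.two_mul_measure_stop_le hδ hP hx
    _ ≤ μ (star P) := measure_mono (h.subset_star_self hP)
    _ ≤ 2 * μ (star P) := le_mul_of_one_le_left' one_le_two

theorem IsStoppingRule.star_star_stop_subset (h : IsBallBasis μ 𝓑 star C₀)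
    (hr : IsStoppingRule μ 𝓑 star δ G F β) (hδ : C₀ ^ 3 * (4 * δ) ≤ 1) {P : Set X}
    (hP : P ∈ 𝓑) {x : X} (hx : x ∈ G P) : star (star (β P x)) ⊆ star (star P) :=
  (h.subset_star_self (h.star_mem _ (h.star_mem _ (hr.mem P hP x hx)))).trans
    (hr.star_star_star_stop_subset h hδ hP hx)

namespace IsStopping

theorem mem_basis (hs : IsStopping μ star A G β a 𝒩) (hr : IsStoppingRule μ 𝓑 star δ G F β)
    (hA : A ∈ 𝓑) (s : ℕ) : (∀ N ∈ 𝒩 s, N ∈ 𝓑) ∧ ∀ x, a s x ∈ 𝓑 := by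
  induction s with
  | zero => simp [hs.level_zero, hs.assign_zero, hA]
  | succ s ih =>
    have h1 : ∀ N ∈ 𝒩 (s + 1), N ∈ 𝓑 := by
      intro N hN
      obtain ⟨x, hx, rfl⟩ := hs.exists_eq s N hN
      exact hr.mem _ (ih.2 x) x hx
    refine ⟨h1, fun x => ?_⟩
    by_cases hx : ∃ N ∈ 𝒩 (s + 1), x ∈ star N
    · exact h1 _ (hs.assign_mem s x hx).1
    · rw [hs.assign_eq s x hx]
      exact ih.2 x

theorem scale_level (hs : IsStopping μ star A G β a 𝒩) (h : IsBallBasis μ 𝓑 star C₀) (hA : A ∈ 𝓑)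
    {s : ℕ} {N : Set X} (hN : N ∈ 𝒩 s) : scale μ A N = s := by
  rcases s with _ | s
  · rw [hs.level_zero] at hN
    obtain rfl : N = A := hN
    refine Nat.le_zero.1 (scale_le ?_)
    have := ENNReal.lt_add_right (h.measure_lt_top N hA).ne (h.measure_pos N hA).ne'
    simpa [two_mul] using this
  · exact hs.scale_eq s N hN

theorem assign_mem_level (hs : IsStopping μ star A G β a 𝒩) (s : ℕ) (x : X) :
    ∃ t ≤ s, a s x ∈ 𝒩 t := by
  induction s with
  | zero => exact ⟨0, le_rfl, by simp [hs.level_zero, hs.assign_zero]⟩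
  | succ s ih =>
    by_cases hx : ∃ N ∈ 𝒩 (s + 1), x ∈ star N
    · exact ⟨s + 1, le_rfl, (hs.assign_mem s x hx).1⟩
    · rw [hs.assign_eq s x hx]
      obtain ⟨t, ht, h⟩ := ih
      exact ⟨t, by omega, h⟩

theorem scale_assign_le (hs : IsStopping μ star A G β a 𝒩) (h : IsBallBasis μ 𝓑 star C₀)
    (hA : A ∈ 𝓑) (s : ℕ) (x : X) : scale μ A (a s x) ≤ s := by
  obtain ⟨t, ht, hx⟩ := hs.assign_mem_level s x
  rwa [hs.scale_level h hA hx]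

theorem mem_star_assign (hs : IsStopping μ star A G β a 𝒩) (s : ℕ) (x : X) :
    x ∈ star (a s x) ∨ a s x = A := by
  induction s with
  | zero => exact Or.inr (hs.assign_zero x)
  | succ s ih =>
    by_cases hx : ∃ N ∈ 𝒩 (s + 1), x ∈ star N
    · exact Or.inl (hs.assign_mem s x hx).2
    · rwa [hs.assign_eq s x hx]

theorem le_scale_assign (hs : IsStopping μ star A G β a 𝒩) {t s : ℕ} (hts : t ≤ s) {x : X} {N : Set X} (hN : N ∈ 𝒩 t) (hx : x ∈ star N) :
    t ≤ scale μ A (a s x) := by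
  induction s with
  | zero => omega
  | succ s ih =>
    by_cases hx' : ∃ N ∈ 𝒩 (s + 1), x ∈ star N
    · rwa [hs.scale_eq s _ (hs.assign_mem s x hx').1]
    · rw [hs.assign_eq s x hx']
      refine ih (Nat.le_of_lt_succ (lt_of_le_of_ne hts ?_))
      rintro rfl
      exact hx' ⟨N, hN, hx⟩

/-- A reassignment after stage `t` would have raised the scale above `t`. -/
theorem assign_eq_of_scale_le (hs : IsStopping μ star A G β a 𝒩) {t s : ℕ} (hts : t ≤ s) {x : X}
    (hx : scale μ A (a s x) ≤ t) : a t x = a s x := by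
  induction s with
  | zero => rw [Nat.le_zero.1 hts]
  | succ s ih =>
    rcases hts.eq_or_lt with rfl | hlt
    · rfl
    have hx' : ¬ ∃ N ∈ 𝒩 (s + 1), x ∈ star N := by
      intro hx'
      rw [hs.scale_eq s _ (hs.assign_mem s x hx').1] at hx
      omega
    rw [hs.assign_eq s x hx'] at hx ⊢
    exact ih (Nat.le_of_lt_succ hlt) hx

end IsStopping

/-- `N` is a stopping ball selected for a point assigned to `P`. -/
def IsChild (G : Set X → Set X) (β : Set X → X → Set X) (a : ℕ → X → Set X)
    (𝒩 : ℕ → Set (Set X)) (P N : Set X) : Prop :=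
  ∃ s x, N ∈ 𝒩 (s + 1) ∧ a s x = P ∧ x ∈ G P ∧ β P x = N

/-- The union of the first `k` generations of descendants of `P`. -/
def descendants (G : Set X → Set X) (β : Set X → X → Set X) (a : ℕ → X → Set X)
    (𝒩 : ℕ → Set (Set X)) : ℕ → Set X → Set X
  | 0, _ => ∅
  | k + 1, P => ⋃ N ∈ {N | IsChild G β a 𝒩 P N}, N ∪ descendants G β a 𝒩 k N

omit [MeasurableSpace X] in
theorem descendants_mono (k : ℕ) (P : Set X) :
    descendants G β a 𝒩 k P ⊆ descendants G β a 𝒩 (k + 1) P := by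
  induction k generalizing P with
  | zero => exact empty_subset _
  | succ k ih => exact iUnion₂_mono fun N _ => union_subset_union_right _ (ih N)

omit [MeasurableSpace X] in
theorem subset_descendants {P N : Set X} (h : Relation.TransGen (IsChild G β a 𝒩) P N) :
    N ⊆ ⋃ k, descendants G β a 𝒩 k P := by
  have : ∃ k, N ⊆ descendants G β a 𝒩 k P := by
    induction h using Relation.TransGen.head_induction_on with
    | single h =>
      exact ⟨1, subset_union_left.trans
        (subset_biUnion_of_mem (u := fun N => N ∪ descendants G β a 𝒩 0 N) h)⟩
    | head h _ ih =>
      obtain ⟨k, hk⟩ := ih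
      exact ⟨k + 1, hk.trans (subset_union_right.trans
        (subset_biUnion_of_mem (u := fun N => N ∪ descendants G β a 𝒩 k N) h))⟩
  obtain ⟨k, hk⟩ := this
  exact hk.trans (subset_iUnion (fun k => descendants G β a 𝒩 k P) k)

namespace IsStopping

variable (hs : IsStopping μ star A G β a 𝒩) (hr : IsStoppingRule μ 𝓑 star δ G F β)
  (h : IsBallBasis μ 𝓑 star C₀) (hA : A ∈ 𝓑) (hδ : C₀ ^ 3 * (4 * δ) ≤ 1)

include hs hr h hA hδ

theorem measure_level_le {s : ℕ} {N : Set X} (hN : N ∈ 𝒩 s) : μ N ≤ μ A := by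
  induction s using Nat.strong_induction_on generalizing N with
  | _ s ih =>
    rcases s with _ | s
    · rw [hs.level_zero] at hN
      rw [show N = A from hN]
    · obtain ⟨x, hx, rfl⟩ := hs.exists_eq s N hN
      obtain ⟨t, ht, hxt⟩ := hs.assign_mem_level s x
      refine le_trans ?_ (ih t (by omega) hxt)
      refine le_trans ?_ (hr.two_mul_measure_stop_le hδ
        ((hs.mem_basis hr hA s).2 x) hx)
      rw [← mul_assoc]
      exact le_mul_of_one_le_left' (one_le_mul one_le_two (one_le_pow₀ h.one_le_ennreal))

theorem measure_le_two_mul {s t : ℕ} (hst : s ≤ t) {N B : Set X} (hN : N ∈ 𝒩 s) (hB : B ∈ 𝒩 t) :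
    μ B ≤ 2 * μ N := by
  refine measure_le_two_mul_of_scale_le (h.measure_lt_top A hA).ne
    (h.measure_pos N ((hs.mem_basis hr hA s).1 N hN)).ne'
    (hs.measure_level_le hr h hA hδ hB) ?_
  rwa [hs.scale_level h hA hN, hs.scale_level h hA hB]

theorem subset_star_of_le {s t : ℕ} (hst : s ≤ t) {N B : Set X} (hN : N ∈ 𝒩 s) (hB : B ∈ 𝒩 t)
    (hne : (B ∩ N).Nonempty) : B ⊆ star N :=
  h.subset_star N ((hs.mem_basis hr hA s).1 N hN) B ((hs.mem_basis hr hA t).1 B hB) hne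
    (hs.measure_le_two_mul hr h hA hδ hst hN hB)

omit hδ in
theorem child_mem {P N : Set X} (hc : IsChild G β a 𝒩 P N) :
    P ∈ 𝓑 ∧ N ∈ 𝓑 ∧ N ∈ 𝒩 (scale μ A N) ∧ P ∈ 𝒩 (scale μ A P) ∧ scale μ A P < scale μ A N := by
  obtain ⟨s, x, hN, rfl, hx, rfl⟩ := hc
  obtain ⟨t, ht, hP⟩ := hs.assign_mem_level s x
  have h1 := hs.scale_level h hA hN
  have h2 := hs.scale_level h hA hP
  refine ⟨(hs.mem_basis hr hA s).2 x, (hs.mem_basis hr hA _).1 _ hN, ?_, ?_, ?_⟩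
  · rwa [h1]
  · rwa [h2]
  · omega

/-- Balls of one scale are disjoint by selection. If a later child met an earlier one, it would lie
in the enlargement of the earlier child, so its stopping point would already have been reassigned
away from `P`. -/
theorem child_disjoint (P : Set X) : {N | IsChild G β a 𝒩 P N}.PairwiseDisjoint id := by
  have key : ∀ N₁ N₂ s₁ s₂ x₁ x₂, N₁ ∈ 𝒩 (s₁ + 1) → a s₁ x₁ = P → N₂ ∈ 𝒩 (s₂ + 1) →
      a s₂ x₂ = P → x₂ ∈ G P → β P x₂ = N₂ → s₁ < s₂ → Disjoint N₁ N₂ := by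
    intro N₁ N₂ s₁ s₂ x₁ x₂ h₁ ha₁ h₂ ha₂ hx₂ hN₂ hlt
    by_contra hnd
    rw [not_disjoint_iff_nonempty_inter, inter_comm] at hnd
    have hsub := hs.subset_star_of_le hr h hA hδ (by omega) h₁ h₂ hnd
    have hP : P ∈ 𝓑 := by
      rw [← ha₁]
      exact (hs.mem_basis hr hA s₁).2 x₁
    have hx : x₂ ∈ N₂ := by
      rw [← hN₂]
      exact hr.self_mem P hP x₂ hx₂
    have h3 := hs.le_scale_assign (by omega : s₁ + 1 ≤ s₂) h₁ (hsub hx)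
    have h4 := hs.scale_assign_le h hA s₁ x₁
    rw [ha₁] at h4
    rw [ha₂] at h3
    omega
  rintro N₁ ⟨s₁, x₁, h₁, ha₁, hx₁, hN₁⟩ N₂ ⟨s₂, x₂, h₂, ha₂, hx₂, hN₂⟩ hne
  rcases lt_trichotomy s₁ s₂ with hlt | rfl | hlt
  · exact key N₁ N₂ s₁ s₂ x₁ x₂ h₁ ha₁ h₂ ha₂ hx₂ hN₂ hlt
  · exact hs.disjoint _ h₁ h₂ hne
  · exact (key N₂ N₁ s₂ s₁ x₂ x₁ h₂ ha₂ h₁ ha₁ hx₁ hN₁ hlt).symm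

/-- The children are disjoint and each is half filled by `F P`, so their measures add up to at most
`2 μ (F P)`. -/
theorem child_countable (hδt : δ ≠ ∞) (P : Set X) :
    {N | IsChild G β a 𝒩 P N}.Countable ∧
      ∑' N : {N | IsChild G β a 𝒩 P N}, μ N ≤ 2 * δ * μ P := by
  rcases eq_empty_or_nonempty {N | IsChild G β a 𝒩 P N} with he | ⟨N₀, hN₀⟩
  · rw [he]
    simp
  have hP : P ∈ 𝓑 := (hs.child_mem hr h hA hN₀).1
  set ν := μ.restrict (F P) with hν
  have hνP : ν univ ≤ δ * μ P := by
    rw [hν, Measure.restrict_apply_univ]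
    exact hr.measure_le P hP
  have hsub : {N | IsChild G β a 𝒩 P N} ⊆ 𝓑 := fun N hN => (hs.child_mem hr h hA hN).2.1
  have hle : ∀ N ∈ {N | IsChild G β a 𝒩 P N}, μ N ≤ 2 * ν N := by
    rintro N hN
    have hNm := h.measurableSet N (hsub hN)
    obtain ⟨s, x, -, -, hx, rfl⟩ := hN
    rw [hν, Measure.restrict_apply hNm]
    exact hr.le_inter P hP x hx
  have hd := hs.child_disjoint hr h hA hδ P
  have hsum := h.tsum_measure_le ν hsub hd
  have huniv : ν (⋃₀ {N | IsChild G β a 𝒩 P N}) ≤ δ * μ P :=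
    (measure_mono (subset_univ _)).trans hνP
  constructor
  · refine h.countable_of_disjoint hsub hd ν (ne_top_of_le_ne_top
      (ENNReal.mul_ne_top hδt (h.measure_lt_top P hP).ne) huniv) fun N hN h0 => ?_
    have := hle N hN
    rw [h0, mul_zero] at this
    exact absurd this (not_le.2 (h.measure_pos N (hsub hN)))
  · calc ∑' N : {N | IsChild G β a 𝒩 P N}, μ N
        ≤ ∑' N : {N | IsChild G β a 𝒩 P N}, 2 * ν N := ENNReal.tsum_le_tsum fun N => hle N N.2
      _ = 2 * ∑' N : {N | IsChild G β a 𝒩 P N}, ν N := ENNReal.tsum_mul_left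
      _ ≤ 2 * (δ * μ P) := by
          gcongr
          exact hsum.trans huniv
      _ = 2 * δ * μ P := by ring

theorem measure_descendants_le (hδt : δ ≠ ∞) (P : Set X) :
    μ (⋃ k, descendants G β a 𝒩 k P) ≤ 4 * δ * μ P := by
  have h4δ : 4 * δ ≤ 1 := le_trans (le_mul_of_one_le_left' (one_le_pow₀ h.one_le_ennreal)) hδ
  have hk : ∀ k P, μ (descendants G β a 𝒩 k P) ≤ 4 * δ * μ P := by
    intro k
    induction k with
    | zero => intro P; simp [descendants]
    | succ k ih =>
      intro P
      obtain ⟨hc, hsum⟩ := hs.child_countable hr h hA hδ hδt P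
      calc μ (descendants G β a 𝒩 (k + 1) P)
          ≤ ∑' N : {N | IsChild G β a 𝒩 P N}, μ (N ∪ descendants G β a 𝒩 k N) :=
            measure_biUnion_le μ hc _
        _ ≤ ∑' N : {N | IsChild G β a 𝒩 P N}, 2 * μ N := by
            refine ENNReal.tsum_le_tsum fun N => (measure_union_le _ _).trans ?_
            rw [two_mul]
            refine add_le_add le_rfl ((ih N).trans ?_)
            -- As `4δ ≤ 1`, a child together with all its descendants costs at most twice the child,
            -- which closes the induction.
            calc 4 * δ * μ N ≤ 1 * μ N := by gcongr
              _ = μ N := one_mul _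
        _ = 2 * ∑' N : {N | IsChild G β a 𝒩 P N}, μ N := ENNReal.tsum_mul_left
        _ ≤ 2 * (2 * δ * μ P) := by gcongr
        _ = 4 * δ * μ P := by ring
  rw [(monotone_nat_of_le_succ fun k => descendants_mono k P).measure_iUnion]
  exact iSup_le fun k => hk k P

end IsStopping

/-- The balls of `𝒩` of scale comparable to that of `N ∈ 𝒩 n` whose double enlargements touch
`N`. -/
def neighbours (star : Set X → Set X) (𝒩 : ℕ → Set (Set X)) (J n : ℕ) (N : Set X) :
    Set (Set X) :=
  ⋃ k ∈ Finset.range J, {Q | Q ∈ 𝒩 (n + k) ∧ (star (star Q) ∩ N).Nonempty}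

omit [MeasurableSpace X] in
theorem mem_neighbours {Q N : Set X} {n q : ℕ} (hQ : Q ∈ 𝒩 q) (h1 : n ≤ q) (h2 : q < n + J)
    (hne : (star (star Q) ∩ N).Nonempty) : Q ∈ neighbours star 𝒩 J n N := by
  refine mem_biUnion (x := q - n) (Finset.mem_coe.2 (Finset.mem_range.2 (by omega))) ?_
  refine ⟨?_, hne⟩
  rwa [Nat.add_sub_cancel' h1]

namespace IsStopping

variable (hs : IsStopping μ star A G β a 𝒩) (hr : IsStoppingRule μ 𝓑 star δ G F β)
  (h : IsBallBasis μ 𝓑 star C₀) (hA : A ∈ 𝓑) (hδ : C₀ ^ 3 * (4 * δ) ≤ 1)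

include hs hr h hA hδ

theorem exists_child {s : ℕ} {N : Set X} (hN : N ∈ 𝒩 (s + 1)) :
    ∃ x P, P ∈ 𝒩 (scale μ A P) ∧ scale μ A P ≤ s ∧ a s x = P ∧ x ∈ G P ∧ x ∈ star P ∧ x ∈ N ∧
      β P x = N ∧ IsChild G β a 𝒩 P N ∧ star (star N) ⊆ star (star P) := by
  obtain ⟨x, hx, hxN⟩ := hs.exists_eq s N hN
  have hP := (hs.mem_basis hr hA s).2 x
  have hc : IsChild G β a 𝒩 (a s x) N := ⟨s, x, hN, rfl, hx, hxN⟩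
  refine ⟨x, a s x, (hs.child_mem hr h hA hc).2.2.2.1, hs.scale_assign_le h hA s x, rfl, hx,
    hr.subset_star _ hP hx, ?_, hxN, hc, ?_⟩
  · rw [← hxN]
    exact hr.self_mem _ hP x hx
  · rw [← hxN]
    exact hr.star_star_stop_subset h hδ hP hx

omit hr h hA hδ in
/-- A ball selected for a point that was assigned to an older ball than `N` after `N` had been
selected does not touch `N`. -/
theorem notMem_star_of_assign {n s : ℕ} {N : Set X} (hN : N ∈ 𝒩 n) {x : X} (hns : n ≤ s)
    (hx : scale μ A (a s x) < n) : x ∉ star N := fun hxN =>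
  absurd (hs.le_scale_assign hns hN hxN) (not_le.2 hx)

/-- Climb from `B` through its parents: double enlargements increase, so they keep touching `N`. The
climb stops at scale `n`, or just before it would jump over `n`; in both cases it has reached a
neighbour. -/
theorem exists_neighbour (hJ : 4 * (C₀ : ℝ≥0∞) ^ 2 ≤ 2 ^ J) {n : ℕ} {N : Set X} (hN : N ∈ 𝒩 n)
    {t : ℕ} {B : Set X} (hB : B ∈ 𝒩 t) (hnt : n < t) (hne : (star (star B) ∩ N).Nonempty) :
    ∃ Q ∈ neighbours star 𝒩 J n N, Relation.ReflTransGen (IsChild G β a 𝒩) Q B := by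
  have hJ0 : 0 < J := by
    rcases Nat.eq_zero_or_pos J with rfl | hJ0
    · have h1 : (4 : ℝ≥0∞) * 1 ≤ 4 * (C₀ : ℝ≥0∞) ^ 2 := by
        gcongr
        exact one_le_pow₀ h.one_le_ennreal
      have h2 := h1.trans hJ
      norm_num at h2
    · exact hJ0
  induction t using Nat.strong_induction_on generalizing B with
  | _ t ih =>
    obtain ⟨s, rfl⟩ : ∃ s, t = s + 1 := ⟨t - 1, by omega⟩
    obtain ⟨x, P, hP, hPs, hax, hxG, hxP, hxB, hβ, hc, hsub⟩ := hs.exists_child hr h hA hδ hB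
    have hneP : (star (star P) ∩ N).Nonempty := hne.mono (inter_subset_inter_left _ hsub)
    rcases lt_trichotomy n (scale μ A P) with hlt | heq | hgt
    · obtain ⟨Q, hQ, hQP⟩ := ih _ (by omega) hP hlt hneP
      exact ⟨Q, hQ, hQP.tail hc⟩
    · exact ⟨P, mem_neighbours hP heq.le (by omega) hneP, Relation.ReflTransGen.single hc⟩
    -- The parent is older than `N`, so the stopping point avoids the enlargement of `N`. Hence the
    -- double enlargement of `B` is too large to be absorbed by `N`, and `B` has scale below `n +
    -- J`.
    · have hxN := hs.notMem_star_of_assign hN (x := x) (s := s) (by omega)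
        (by rwa [hax])
      have hB𝓑 := (hs.mem_basis hr hA _).1 B hB
      have hN𝓑 := (hs.mem_basis hr hA _).1 N hN
      have hss := h.star_mem _ (h.star_mem _ hB𝓑)
      have hBss := (h.subset_star_self hB𝓑).trans (h.subset_star_self (h.star_mem _ hB𝓑))
      have hlarge : 2 * μ N < C₀ ^ 2 * μ B := by
        by_contra! hle
        exact hxN (h.subset_star N hN𝓑 _ hss hne ((h.measure_star_star_le hB𝓑).trans hle)
          (hBss hxB))
      refine ⟨B, mem_neighbours hB hnt.le ?_ hne, Relation.ReflTransGen.refl⟩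
      have h1 := two_pow_scale_mul_le (hs.measure_level_le hr h hA hδ hB)
      have h2 := lt_two_pow_scale_mul (h.measure_lt_top A hA).ne (h.measure_pos N hN𝓑).ne'
      rw [hs.scale_level h hA hB] at h1
      rw [hs.scale_level h hA hN] at h2
      have h3 : (2 : ℝ≥0∞) ^ (s + 1) * μ B < 2 ^ (n + J) * μ B := by
        calc (2 : ℝ≥0∞) ^ (s + 1) * μ B < 2 ^ (n + 1) * μ N := h1.trans_lt h2
          _ = 2 ^ n * (2 * μ N) := by ring
          _ ≤ 2 ^ n * (C₀ ^ 2 * μ B) := by gcongr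
          _ ≤ 2 ^ n * (4 * C₀ ^ 2 * μ B) := by
              gcongr
              exact le_mul_of_one_le_left' (by norm_num)
          _ ≤ 2 ^ n * (2 ^ J * μ B) := by gcongr
          _ = 2 ^ (n + J) * μ B := by ring
      have h4 := lt_of_mul_lt_mul_right h3 zero_le
      by_contra! hle
      exact absurd h4 (not_lt.2 (pow_le_pow_right₀ one_le_two hle))

/-- When `B` itself meets `N`, the descent is proper. This is essential: only proper descendants
have small measure, whereas a neighbour may cover `N`. -/
theorem exists_neighbour_of_inter (hJ : 4 * (C₀ : ℝ≥0∞) ^ 2 ≤ 2 ^ J) {n : ℕ} {N : Set X}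
    (hN : N ∈ 𝒩 n) {t : ℕ} {B : Set X} (hB : B ∈ 𝒩 t) (hnt : n < t) (hne : (B ∩ N).Nonempty) :
    ∃ Q ∈ neighbours star 𝒩 J n N, Relation.TransGen (IsChild G β a 𝒩) Q B := by
  obtain ⟨s, rfl⟩ : ∃ s, t = s + 1 := ⟨t - 1, by omega⟩
  obtain ⟨x, P, hP, hPs, hax, hxG, hxP, hxB, hβ, hc, hsub⟩ := hs.exists_child hr h hA hδ hB
  have hB𝓑 := (hs.mem_basis hr hA _).1 B hB
  have hBss := (h.subset_star_self hB𝓑).trans (h.subset_star_self (h.star_mem _ hB𝓑))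
  have hneP : (star (star P) ∩ N).Nonempty :=
    hne.mono (inter_subset_inter_left _ (hBss.trans hsub))
  have hJ0 : 0 < J := by
    rcases Nat.eq_zero_or_pos J with rfl | hJ0
    · have h1 : (4 : ℝ≥0∞) * 1 ≤ 4 * (C₀ : ℝ≥0∞) ^ 2 := by
        gcongr
        exact one_le_pow₀ h.one_le_ennreal
      have h2 := h1.trans hJ
      norm_num at h2
    · exact hJ0
  rcases lt_trichotomy n (scale μ A P) with hlt | heq | hgt
  · obtain ⟨Q, hQ, hQP⟩ := hs.exists_neighbour hr h hA hδ hJ hN hP hlt hneP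
    exact ⟨Q, hQ, Relation.TransGen.tail' hQP hc⟩
  · exact ⟨P, mem_neighbours hP heq.le (by omega) hneP, Relation.TransGen.single hc⟩
  -- With a parent older than `N`, the stopping point would lie outside the enlargement of `N`,
  -- although `B` is contained in it.
  · exact absurd (hs.subset_star_of_le hr h hA hδ hnt.le hN hB hne hxB)
      (hs.notMem_star_of_assign hN (x := x) (s := s) (by omega) (by rwa [hax]))

/-- At each of the `J` scales the neighbours are disjoint, and all of them lie in one ball of
measure comparable to `μ N`. -/
theorem tsum_neighbours_le {n : ℕ} {N : Set X} (hN : N ∈ 𝒩 n) :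
    ∑' Q : neighbours star 𝒩 J n N, μ Q ≤ J * (2 * C₀ ^ 4 * μ N) := by
  have hN𝓑 := (hs.mem_basis hr hA _).1 N hN
  have hC2 : (1 : ℝ≥0∞) ≤ C₀ ^ 2 := one_le_pow₀ h.one_le_ennreal
  obtain ⟨M, hM, hMle, hsub⟩ := h.exists_container hN𝓑 (L := 2 * C₀ ^ 2)
    (one_le_mul one_le_two hC2) (by finiteness)
  calc ∑' Q : neighbours star 𝒩 J n N, μ Q
      ≤ ∑ k ∈ Finset.range J,
          ∑' Q : {Q | Q ∈ 𝒩 (n + k) ∧ (star (star Q) ∩ N).Nonempty}, μ Q :=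
        ENNReal.tsum_biUnion_le (fun Q : Set X => μ Q) _ _
    _ ≤ ∑ k ∈ Finset.range J, 2 * C₀ ^ 4 * μ N := by
        refine Finset.sum_le_sum fun k _ => ?_
        have h𝓑 : {Q | Q ∈ 𝒩 (n + k) ∧ (star (star Q) ∩ N).Nonempty} ⊆ 𝓑 := fun Q hQ =>
          (hs.mem_basis hr hA _).1 Q hQ.1
        refine (h.tsum_measure_le μ h𝓑 ((hs.disjoint (n + k)).subset fun Q hQ => hQ.1)).trans ?_
        calc μ (⋃₀ {Q | Q ∈ 𝒩 (n + k) ∧ (star (star Q) ∩ N).Nonempty}) ≤ μ M := by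
              refine measure_mono (sUnion_subset fun Q hQ => ?_)
              have hQ𝓑 := h𝓑 hQ
              refine ((h.subset_star_self hQ𝓑).trans
                (h.subset_star_self (h.star_mem _ hQ𝓑))).trans
                (hsub _ (h.star_mem _ (h.star_mem _ hQ𝓑)) hQ.2 ?_)
              calc μ (star (star Q)) ≤ C₀ ^ 2 * μ Q := h.measure_star_star_le hQ𝓑
                _ ≤ C₀ ^ 2 * (2 * μ N) := by
                    refine mul_le_mul_right ?_ _
                    exact hs.measure_le_two_mul hr h hA hδ (Nat.le_add_right n k) hN hQ.1
                _ = 2 * C₀ ^ 2 * μ N := by ring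
          _ ≤ C₀ ^ 2 * (2 * C₀ ^ 2 * μ N) := hMle
          _ = 2 * C₀ ^ 4 * μ N := by ring
    _ = J * (2 * C₀ ^ 4 * μ N) := by simp

theorem star_star_subset {t : ℕ} {B : Set X} (hB : B ∈ 𝒩 t) : star (star B) ⊆ star (star A) := by
  induction t using Nat.strong_induction_on generalizing B with
  | _ t ih =>
    rcases t with _ | s
    · rw [hs.level_zero] at hB
      rw [show B = A from hB]
    · obtain ⟨x, P, hP, hPs, hax, hxG, hxP, hxB, hβ, hc, hsub⟩ := hs.exists_child hr h hA hδ hB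
      exact hsub.trans (ih _ (by omega) hP)

theorem subset_star_star {t : ℕ} {B : Set X} (hB : B ∈ 𝒩 t) : B ⊆ star (star A) := by
  have hB𝓑 := (hs.mem_basis hr hA _).1 B hB
  exact ((h.subset_star_self hB𝓑).trans (h.subset_star_self (h.star_mem _ hB𝓑))).trans
    (hs.star_star_subset hr h hA hδ hB)

theorem level_countable (t : ℕ) : (𝒩 t).Countable := by
  have h𝓑 : 𝒩 t ⊆ 𝓑 := (hs.mem_basis hr hA t).1
  refine h.countable_of_disjoint h𝓑 (hs.disjoint t) μ ?_ fun D hD => (h.measure_pos D (h𝓑 hD)).ne'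
  exact ne_top_of_le_ne_top
    (h.measure_lt_top _ (h.star_mem _ (h.star_mem _ hA))).ne
    (measure_mono (sUnion_subset fun B hB => hs.subset_star_star hr h hA hδ hB))

/-- The part of `N` that is not covered by balls of later generations makes up one half. -/
theorem measure_le_two_mul_sdiff (hJ : 4 * (C₀ : ℝ≥0∞) ^ 2 ≤ 2 ^ J)
    (hδJ : 16 * J * C₀ ^ 4 * δ ≤ 1) (hδt : δ ≠ ∞) {n : ℕ} {N : Set X} (hN : N ∈ 𝒩 n) :
    μ N ≤ 2 * μ (N \ ⋃ t ∈ Ioi n, ⋃₀ 𝒩 t) := by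
  have hN𝓑 := (hs.mem_basis hr hA _).1 N hN
  have hNt := (h.measure_lt_top N hN𝓑).ne
  set V : Set X := ⋃ t ∈ Ioi n, ⋃₀ 𝒩 t with hV
  have hcount : (neighbours star 𝒩 J n N).Countable :=
    (Finset.range J).countable_toSet.biUnion fun k _ =>
      (hs.level_countable hr h hA hδ (n + k)).mono fun Q hQ => hQ.1
  have hsub : V ∩ N ⊆ ⋃ Q ∈ neighbours star 𝒩 J n N, ⋃ k, descendants G β a 𝒩 k Q := by
    rintro x ⟨hxV, hxN⟩
    simp only [hV, mem_iUnion, mem_sUnion] at hxV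
    obtain ⟨t, ht, B, hB, hxB⟩ := hxV
    obtain ⟨Q, hQ, hQB⟩ := hs.exists_neighbour_of_inter hr h hA hδ hJ hN hB ht ⟨x, hxB, hxN⟩
    exact mem_biUnion hQ (subset_descendants hQB hxB)
  have hle : 2 * μ (N ∩ V) ≤ μ N := by
    rw [inter_comm]
    calc 2 * μ (V ∩ N)
        ≤ 2 * ∑' Q : neighbours star 𝒩 J n N, μ (⋃ k, descendants G β a 𝒩 k Q) := by
          gcongr
          exact (measure_mono hsub).trans (measure_biUnion_le μ hcount _)
      _ ≤ 2 * ∑' Q : neighbours star 𝒩 J n N, 4 * δ * μ Q := by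
          refine mul_le_mul_right (ENNReal.tsum_le_tsum fun Q => ?_) _
          exact hs.measure_descendants_le hr h hA hδ hδt Q
      _ = 8 * δ * ∑' Q : neighbours star 𝒩 J n N, μ Q := by
          rw [ENNReal.tsum_mul_left]
          ring
      _ ≤ 8 * δ * (J * (2 * C₀ ^ 4 * μ N)) := by
          gcongr
          exact hs.tsum_neighbours_le hr h hA hδ hN
      _ = (16 * J * C₀ ^ 4 * δ) * μ N := by ring
      _ ≤ 1 * μ N := by gcongr
      _ = μ N := one_mul _
  have hsplit : μ N ≤ μ (N ∩ V) + μ (N \ V) := by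
    conv_lhs => rw [← inter_union_sdiff N V]
    exact measure_union_le _ _
  have h4 : μ N + μ N ≤ μ N + 2 * μ (N \ V) := by
    calc μ N + μ N = 2 * μ N := (two_mul _).symm
      _ ≤ 2 * (μ (N ∩ V) + μ (N \ V)) := by gcongr
      _ = 2 * μ (N ∩ V) + 2 * μ (N \ V) := mul_add _ _ _
      _ ≤ μ N + 2 * μ (N \ V) := by gcongr
  exact (ENNReal.add_le_add_iff_left hNt).1 h4

theorem measurableSet_sdiff {N : Set X} (hN : N ∈ 𝓑) (n : ℕ) :
    MeasurableSet (N \ ⋃ t ∈ Ioi n, ⋃₀ 𝒩 t) := by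
  refine (h.measurableSet N hN).diff (MeasurableSet.biUnion (to_countable _) fun t _ => ?_)
  exact MeasurableSet.sUnion (hs.level_countable hr h hA hδ t) fun B hB =>
    h.measurableSet B ((hs.mem_basis hr hA t).1 B hB)

omit hr h hA hδ in
theorem disjoint_sdiff {N N' : Set X} (hN : N ∈ 𝒩 (scale μ A N)) (hN' : N' ∈ 𝒩 (scale μ A N'))
    (hne : N ≠ N') : Disjoint (N \ ⋃ t ∈ Ioi (scale μ A N), ⋃₀ 𝒩 t)
      (N' \ ⋃ t ∈ Ioi (scale μ A N'), ⋃₀ 𝒩 t) := by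
  rw [disjoint_left]
  rintro x ⟨hxN, hx⟩ ⟨hxN', hx'⟩
  rcases lt_trichotomy (scale μ A N) (scale μ A N') with hlt | heq | hlt
  · exact hx (mem_biUnion (mem_Ioi.2 hlt) ⟨N', hN', hxN'⟩)
  · rw [← heq] at hN'
    exact disjoint_left.1 (hs.disjoint _ hN hN' hne) hxN hxN'
  · exact hx' (mem_biUnion (mem_Ioi.2 hlt) ⟨N, hN, hxN⟩)

theorem ae_exists_notMem (hJ : 4 * (C₀ : ℝ≥0∞) ^ 2 ≤ 2 ^ J)
    (hδJ : 16 * J * C₀ ^ 4 * δ ≤ 1) (hδt : δ ≠ ∞) :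
    ∀ᵐ x ∂μ, ∃ t, ∃ N ∈ 𝒩 t, (x ∈ star N ∨ N = A) ∧ x ∉ G N := by
  set 𝒯 : Set (Set X) := ⋃ t, 𝒩 t with h𝒯
  have h𝓑 : ∀ N ∈ 𝒯, N ∈ 𝓑 := by
    intro N hN
    obtain ⟨t, ht⟩ := mem_iUnion.1 hN
    exact (hs.mem_basis hr hA t).1 N ht
  have hmem : ∀ N ∈ 𝒯, N ∈ 𝒩 (scale μ A N) := by
    intro N hN
    obtain ⟨t, ht⟩ := mem_iUnion.1 hN
    rwa [hs.scale_level h hA ht]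
  -- The uncovered halves are disjoint subsets of the double enlargement of `A`, a set of finite
  -- measure.
  have hsum : ∑' N : 𝒯, μ (star N) ≠ ∞ := by
    have hle : ∑' N : 𝒯, μ (star N) ≤ C₀ * (2 * μ (star (star A))) := by
      calc ∑' N : 𝒯, μ (star N)
          ≤ ∑' N : 𝒯, C₀ * (2 * μ ((N : Set X) \ ⋃ t ∈ Ioi (scale μ A N), ⋃₀ 𝒩 t)) := by
            refine ENNReal.tsum_le_tsum fun N => (h.measure_star_le N (h𝓑 N N.2)).trans ?_
            exact mul_le_mul_right
              (hs.measure_le_two_mul_sdiff hr h hA hδ hJ hδJ hδt (hmem N N.2)) _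
        _ = C₀ * (2 * ∑' N : 𝒯, μ ((N : Set X) \ ⋃ t ∈ Ioi (scale μ A N), ⋃₀ 𝒩 t)) := by
            rw [ENNReal.tsum_mul_left, ENNReal.tsum_mul_left]
        _ ≤ C₀ * (2 * μ (star (star A))) := by
            gcongr
            refine (tsum_meas_le_meas_iUnion_of_disjoint μ (fun N => ?_) ?_).trans
              (measure_mono (iUnion_subset fun N => sdiff_subset.trans
                (hs.subset_star_star hr h hA hδ (hmem N N.2))))
            · exact hs.measurableSet_sdiff hr h hA hδ (h𝓑 N N.2) _
            · intro N N' hne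
              exact hs.disjoint_sdiff (hmem N N.2) (hmem N' N'.2) fun he => hne (Subtype.ext he)
    refine ne_top_of_le_ne_top ?_ hle
    have := (h.measure_lt_top _ (h.star_mem _ (h.star_mem _ hA))).ne
    finiteness
  have : Countable 𝒯 :=
    (countable_iUnion fun t => hs.level_countable hr h hA hδ t).to_subtype
  -- Borel–Cantelli: almost every point lies in finitely many enlargements, so its assignment
  -- stabilizes. If its final ball `P` still had `x` as exceptional point, the stopping ball of `x`
  -- would have been a candidate at its own scale.
  filter_upwards [ae_finite_setOfPred_mem hsum] with x hfin
  obtain ⟨s₀, hs₀⟩ : ∃ s₀, ∀ t > s₀, ∀ N ∈ 𝒩 t, x ∉ star N := by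
    obtain ⟨s₀, hs₀⟩ := (hfin.image fun N : 𝒯 => scale μ A N).bddAbove
    refine ⟨s₀, fun t ht N hN hx => ?_⟩
    have hN' : N ∈ 𝒯 := mem_iUnion.2 ⟨t, hN⟩
    have := hs₀ ⟨⟨N, hN'⟩, hx, rfl⟩
    simp only [hs.scale_level h hA hN] at this
    omega
  have hconst : ∀ s ≥ s₀, a s x = a s₀ x := by
    intro s hss
    induction s, hss using Nat.le_induction with
    | base => rfl
    | succ s hs' ih =>
      rw [hs.assign_eq s x, ih]
      rintro ⟨N, hN, hx⟩
      exact hs₀ (s + 1) (by omega) N hN hx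
  obtain ⟨t₀, ht₀, hlev⟩ := hs.assign_mem_level s₀ x
  refine ⟨t₀, a s₀ x, hlev, hs.mem_star_assign s₀ x, fun hxG => ?_⟩
  set P := a s₀ x with hPdef
  have hP : P ∈ 𝓑 := (hs.mem_basis hr hA s₀).2 x
  have hβ := hr.mem P hP x hxG
  have hxβ := hr.self_mem P hP x hxG
  have hlt : scale μ A P < scale μ A (β P x) := by
    refine le_scale (h.measure_lt_top A hA).ne (h.measure_pos _ hβ).ne' ?_
    have h1 : 2 * μ (β P x) ≤ μ P := by
      refine le_trans ?_ (hr.two_mul_measure_stop_le hδ hP hxG)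
      gcongr
      exact le_mul_of_one_le_left' (one_le_pow₀ h.one_le_ennreal)
    calc (2 : ℝ≥0∞) ^ (scale μ A P + 1) * μ (β P x)
        = 2 ^ scale μ A P * (2 * μ (β P x)) := by ring
      _ ≤ 2 ^ scale μ A P * μ P := by gcongr
      _ ≤ μ A := two_pow_scale_mul_le (hs.measure_level_le hr h hA hδ hlev)
  obtain ⟨k, hk⟩ : ∃ k, scale μ A (β P x) = k + 1 := ⟨scale μ A (β P x) - 1, by omega⟩
  -- At stage `k` the point was already, or still, assigned to `P`: later stages agree with stage
  -- `s₀`, and an earlier change is excluded by the scale of `P`.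
  have hak : a k x = P := by
    rcases le_total k s₀ with hks | hks
    · exact hs.assign_eq_of_scale_le hks (by rw [← hPdef]; omega)
    · exact hconst k hks
  obtain ⟨N, hN, hne⟩ := hs.maximal k x (by rwa [hak]) (by rwa [hak]) (by rw [hak]; exact ⟨x, hxβ⟩)
  rw [hak] at hne
  have hxN : x ∈ star N := by
    have hN𝓑 := (hs.mem_basis hr hA _).1 N hN
    refine h.subset_star N hN𝓑 _ hβ hne (measure_le_two_mul_of_scale_le
      (h.measure_lt_top A hA).ne (h.measure_pos N hN𝓑).ne' ?_ ?_) hxβ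
    · refine le_trans ?_ (hs.measure_level_le hr h hA hδ hlev)
      refine le_trans ?_ (hr.two_mul_measure_stop_le hδ hP hxG)
      rw [← mul_assoc]
      exact le_mul_of_one_le_left' (one_le_mul one_le_two (one_le_pow₀ h.one_le_ennreal))
    · rw [hs.scale_level h hA hN, hk]
  by_cases hks : k + 1 ≤ s₀
  · have := hs.le_scale_assign hks hN hxN
    rw [← hPdef] at this
    omega
  · exact hs₀ (k + 1) (by omega) N hN hxN

end IsStopping

/-- The stopping balls of a stopping rule form a sparse family, in which every ball but `A` has a
parent of smaller scale. -/
theorem exists_sparse_stopping (h : IsBallBasis μ 𝓑 star C₀) (hA : A ∈ 𝓑)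
    (hr : IsStoppingRule μ 𝓑 star δ G F β) (hJ : 4 * (C₀ : ℝ≥0∞) ^ 2 ≤ 2 ^ J)
    (hδ : C₀ ^ 3 * (4 * δ) ≤ 1) (hδJ : 16 * J * C₀ ^ 4 * δ ≤ 1) (hδt : δ ≠ ∞) :
    ∃ 𝒯 ⊆ 𝓑, A ∈ 𝒯 ∧
      (∀ N ∈ 𝒯, N ≠ A → ∃ P ∈ 𝒯, scale μ A P < scale μ A N ∧ ∃ x ∈ G P, N = β P x) ∧
      (∃ E : Set X → Set X, (∀ N ∈ 𝒯, MeasurableSet (E N) ∧ E N ⊆ N ∧ μ N ≤ 2 * μ (E N)) ∧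
        𝒯.PairwiseDisjoint E) ∧
      𝒯.Countable ∧
      ∀ᵐ x ∂μ, ∃ N ∈ 𝒯, (x ∈ star N ∨ N = A) ∧ x ∉ G N := by
  obtain ⟨a, 𝒩, hs⟩ := exists_isStopping μ star A G β
  have hmem : ∀ N ∈ ⋃ t, 𝒩 t, N ∈ 𝒩 (scale μ A N) := by
    intro N hN
    obtain ⟨t, ht⟩ := mem_iUnion.1 hN
    rwa [hs.scale_level h hA ht]
  have h𝓑 : ⋃ t, 𝒩 t ⊆ 𝓑 := fun N hN => (hs.mem_basis hr hA _).1 N (hmem N hN)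
  refine ⟨⋃ t, 𝒩 t, h𝓑, mem_iUnion.2 ⟨0, by simp [hs.level_zero]⟩, fun N hN hne => ?_,
    ⟨fun N => N \ ⋃ t ∈ Ioi (scale μ A N), ⋃₀ 𝒩 t, fun N hN => ⟨?_, sdiff_subset, ?_⟩,
      fun N hN N' hN' hne => hs.disjoint_sdiff (hmem N hN) (hmem N' hN') hne⟩,
    countable_iUnion fun t => hs.level_countable hr h hA hδ t, ?_⟩
  · have hN' := hmem N hN
    rcases hsc : scale μ A N with _ | s
    · rw [hsc, hs.level_zero] at hN'
      exact absurd hN' hne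
    · rw [hsc] at hN'
      obtain ⟨x, P, hP, hPs, -, hxG, -, -, hβ, -, -⟩ := hs.exists_child hr h hA hδ hN'
      exact ⟨P, mem_iUnion.2 ⟨_, hP⟩, by omega, x, hxG, hβ.symm⟩
  · exact hs.measurableSet_sdiff hr h hA hδ (h𝓑 hN) _
  · exact hs.measure_le_two_mul_sdiff hr h hA hδ hJ hδJ hδt (hmem N hN)
  · filter_upwards [hs.ae_exists_notMem hr h hA hδ hJ hδJ hδt] with x ⟨t, N, hN, hx⟩
    exact ⟨N, mem_iUnion.2 ⟨t, hN⟩, hx⟩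

end Nodes

end Stopping

/-! ### Averages, the maximal theorem and nearly maximal stopping balls. -/

section Averages

variable {X : Type u} [MeasurableSpace X] {μ : Measure X} {𝓑 : Set (Set X)}
  {star : Set X → Set X} {C₀ : ℝ≥0} {r : ℝ}

theorem eLpNorm_restrict_eq (hr : 1 ≤ r) (B : Set X) (f : X → ℝ) :
    eLpNorm f (ENNReal.ofReal r) (μ.restrict B) = (∫⁻ x in B, ‖f x‖ₑ ^ r ∂μ) ^ (1 / r) := by
  have h0 : ENNReal.ofReal r ≠ 0 := by
    rw [Ne, ENNReal.ofReal_eq_zero]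
    linarith
  rw [eLpNorm_eq_lintegral_rpow_enorm_toReal h0 ENNReal.ofReal_ne_top,
    ENNReal.toReal_ofReal (by linarith)]

theorem avg_eq (hr : 1 ≤ r) (B : Set X) (f : X → ℝ) :
    avg μ r B f = (μ B)⁻¹ ^ (1 / r) * eLpNorm f (ENNReal.ofReal r) (μ.restrict B) := by
  rw [avg, setLAverage_eq, eLpNorm_restrict_eq hr, ENNReal.div_eq_inv_mul,
    ENNReal.mul_rpow_of_nonneg _ _ (by positivity)]

theorem eLpNorm_restrict_eq_avg (hr : 1 ≤ r) {B : Set X} (h0 : μ B ≠ 0) (ht : μ B ≠ ∞)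
    (f : X → ℝ) :
    eLpNorm f (ENNReal.ofReal r) (μ.restrict B) = μ B ^ (1 / r) * avg μ r B f := by
  rw [avg_eq hr, ← mul_assoc, ← ENNReal.mul_rpow_of_nonneg _ _ (by positivity),
    ENNReal.mul_inv_cancel h0 ht, ENNReal.one_rpow, one_mul]

theorem avg_ne_top (hr : 1 ≤ r) {B : Set X} (h0 : μ B ≠ 0) {f : X → ℝ}
    (hf : MemLp f (ENNReal.ofReal r) μ) : avg μ r B f ≠ ∞ := by
  rw [avg_eq hr]
  refine ENNReal.mul_ne_top (ENNReal.rpow_ne_top_of_nonneg (by positivity)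
    (ENNReal.inv_ne_top.2 h0)) (hf.restrict B).2.ne

theorem avg_smul (hr : 1 ≤ r) (B : Set X) (c : ℝ) (f : X → ℝ) :
    avg μ r B (c • f) = ‖c‖ₑ * avg μ r B f := by
  rw [avg_eq hr, avg_eq hr, eLpNorm_const_smul]
  ring

theorem avg_add_le (hr : 1 ≤ r) (B : Set X) {f g : X → ℝ} (hf : AEStronglyMeasurable f μ)
    (hg : AEStronglyMeasurable g μ) : avg μ r B (f + g) ≤ avg μ r B f + avg μ r B g := by
  rw [avg_eq hr, avg_eq hr, avg_eq hr, ← mul_add]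
  gcongr
  exact eLpNorm_add_le hf.restrict hg.restrict (by simpa using ENNReal.ofReal_le_ofReal hr)

theorem eLpNorm_rpow (hr : 1 ≤ r) (f : X → ℝ) :
    eLpNorm f (ENNReal.ofReal r) μ ^ r = ∫⁻ x, ‖f x‖ₑ ^ r ∂μ := by
  rw [← Measure.restrict_univ (μ := μ), eLpNorm_restrict_eq hr, ← ENNReal.rpow_mul,
    one_div_mul_cancel (by linarith), ENNReal.rpow_one, Measure.restrict_univ]

/-- The weak type bound for the maximal function of the ball-basis. -/
theorem IsBallBasis.measure_lt_avg_le (h : IsBallBasis μ 𝓑 star C₀) (hr : 1 ≤ r) {g : X → ℝ}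
    (hg : eLpNorm g (ENNReal.ofReal r) μ ≠ ∞) {t κ : ℝ≥0∞}
    (hle : eLpNorm g (ENNReal.ofReal r) μ ^ r ≤ κ * t ^ r) :
    μ {x | ∃ B ∈ 𝓑, x ∈ B ∧ t < avg μ r B g} ≤ C₀ * κ := by
  have hr0 : 0 < r := by linarith
  rcases eq_or_ne t 0 with rfl | ht0
  · rw [ENNReal.zero_rpow_of_pos hr0, mul_zero, nonpos_iff_eq_zero,
      ENNReal.rpow_eq_zero_iff_of_pos hr0] at hle
    have : {x | ∃ B ∈ 𝓑, x ∈ B ∧ 0 < avg μ r B g} = ∅ := by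
      rw [eq_empty_iff_forall_notMem]
      rintro x ⟨B, -, -, hlt⟩
      rw [avg_eq hr, nonpos_iff_eq_zero.1
        ((eLpNorm_mono_measure g Measure.restrict_le_self).trans hle.le), mul_zero] at hlt
      exact lt_irrefl _ hlt
    rw [this]
    simp
  rcases eq_or_ne t ∞ with rfl | htt
  · simp
  have htr0 : t ^ r ≠ 0 := by
    rw [Ne, ENNReal.rpow_eq_zero_iff_of_pos hr0]
    exact ht0
  have htrt : t ^ r ≠ ∞ := ENNReal.rpow_ne_top_of_nonneg hr0.le htt
  -- A ball on which the average exceeds `t` satisfies `μ B ≤ t^{-r} ν B`, which is the hypothesis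
  -- of the covering bound.
  set ν := μ.withDensity fun x => ‖g x‖ₑ ^ r with hν
  have hνuniv : ν univ = eLpNorm g (ENNReal.ofReal r) μ ^ r := by
    rw [hν, withDensity_apply _ MeasurableSet.univ, Measure.restrict_univ, eLpNorm_rpow hr]
  have hcov := h.measure_le_of_covering (𝒢 := {B | B ∈ 𝓑 ∧ t < avg μ r B g})
    (S := {x | ∃ B ∈ 𝓑, x ∈ B ∧ t < avg μ r B g}) (a := (t ^ r)⁻¹) (fun B hB => hB.1) ν
    (by rw [hνuniv]; exact ENNReal.rpow_ne_top_of_nonneg hr0.le hg) (ENNReal.inv_ne_top.2 htr0)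
    (by
      rintro B ⟨hB, hlt⟩
      have h0 := (h.measure_pos B hB).ne'
      have htop := (h.measure_lt_top B hB).ne
      rw [avg, setLAverage_eq, one_div, ENNReal.lt_rpow_inv_iff hr0] at hlt
      have h1 := ENNReal.mul_le_of_le_div hlt.le
      rw [hν, withDensity_apply _ (h.measurableSet B hB), ← ENNReal.div_eq_inv_mul,
        ENNReal.le_div_iff_mul_le (Or.inl htr0) (Or.inl htrt), mul_comm]
      exact h1)
    (by
      rintro x ⟨B, hB, hxB, hlt⟩
      exact ⟨B, ⟨hB, hlt⟩, hxB⟩)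
  refine hcov.trans ?_
  gcongr
  rw [← ENNReal.div_eq_inv_mul, hνuniv]
  exact ENNReal.div_le_of_le_mul hle

/-- A ball containing `x` that is half filled by `F` and has nearly maximal measure. -/
theorem exists_maximal_ball (h : IsBallBasis μ 𝓑 star C₀) {F : Set X} (hF : μ F ≠ ∞) {x : X}
    (hx : ∃ B ∈ 𝓑, x ∈ B ∧ μ B ≤ 2 * μ (B ∩ F)) :
    ∃ B ∈ 𝓑, x ∈ B ∧ μ B ≤ 2 * μ (B ∩ F) ∧
      ∀ G ∈ 𝓑, B ⊆ G → 2 * μ B < μ G → 2 * μ (G ∩ F) < μ G := by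
  set S : Set ℝ≥0∞ := {t | ∃ B ∈ 𝓑, x ∈ B ∧ μ B ≤ 2 * μ (B ∩ F) ∧ μ B = t} with hS
  obtain ⟨B₀, hB₀, hxB₀, hle₀⟩ := hx
  have hpos : sSup S ≠ 0 :=
    ((h.measure_pos B₀ hB₀).trans_le
      (le_sSup (show μ B₀ ∈ S from ⟨B₀, hB₀, hxB₀, hle₀, rfl⟩))).ne'
  have htop : sSup S ≠ ∞ := by
    refine ne_top_of_le_ne_top (b := 2 * μ F) (by finiteness) (sSup_le ?_)
    rintro _ ⟨B, -, -, hle, rfl⟩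
    refine hle.trans ?_
    gcongr
    exact inter_subset_right
  -- The supremum is finite because half filled balls have measure at most `2 μ F`; any ball above
  -- half of it is nearly maximal.
  obtain ⟨_, ⟨B, hB, hxB, hle, rfl⟩, hlt⟩ := lt_sSup_iff.1 (ENNReal.half_lt_self hpos htop)
  refine ⟨B, hB, hxB, hle, fun G hG hBG hGB => ?_⟩
  by_contra! hcon
  have h1 : μ G ≤ sSup S := le_sSup (show μ G ∈ S from ⟨G, hG, hBG hxB, hcon, rfl⟩)
  have h2 : sSup S ≤ 2 * μ B := by
    rw [mul_comm]
    exact (ENNReal.div_le_iff two_ne_zero ENNReal.ofNat_ne_top).1 hlt.le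
  exact absurd (hGB.trans_le (h1.trans h2)) (lt_irrefl _)

end Averages

/-! ### Oscillation operators and expansion over linear combinations of tuples. -/

section Operator

variable {X : Type u} [MeasurableSpace X] {μ : Measure X} {𝓑 : Set (Set X)}
  {star : Set X → Set X} {C₀ : ℝ≥0} {r : ℝ} {m : ℕ} {E : Type v} [NormedAddCommGroup E]

/-- The properties of a bounded oscillation operator on which the sparse domination rests, with one
constant `κ` for the oscillation and the weak type bounds. -/
structure IsOscillationOperator (μ : Measure X) (𝓑 : Set (Set X)) (star : Set X → Set X) (r : ℝ)
    (𝒯 : (Fin m → X → ℝ) → X → E) (κ : ℝ≥0∞) : Prop where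
  smul_le : ∀ f ∈ LrTuple μ r m, ∀ (i : Fin m) (c : ℝ) (x : X),
    ‖𝒯 (Function.update f i (c • f i)) x‖ₑ ≤ ‖c‖ₑ * ‖𝒯 f x‖ₑ
  add_le : ∀ f ∈ LrTuple μ r m, ∀ (i : Fin m) (g : X → ℝ), MemLp g (ENNReal.ofReal r) μ →
    ∀ x : X, ‖𝒯 (Function.update f i (f i + g)) x‖ₑ ≤
      ‖𝒯 f x‖ₑ + ‖𝒯 (Function.update f i g) x‖ₑ
  size : ∀ f ∈ LrTuple μ r m, ∀ B₀ ∈ 𝓑, star B₀ ≠ univ → ∃ B ∈ 𝓑, B₀ ⊂ B ∧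
    ∀ x ∈ B₀, ‖𝒯 (cut (star B) f) x - 𝒯 (cut (star B₀) f) x‖ₑ
      ≤ κ * ∏ i, avg μ r (star B) (f i)
  regularity : ∀ f ∈ LrTuple μ r m, ∀ B ∈ 𝓑, ∀ x ∈ B, ∀ x' ∈ B,
    ‖(𝒯 f x - 𝒯 (cut (star B) f) x) - (𝒯 f x' - 𝒯 (cut (star B) f) x')‖ₑ
      ≤ κ * ∏ i, supAvg μ 𝓑 r B (f i)
  weak : ∀ f ∈ LrTuple μ r m, ∀ t : ℝ≥0, t * μ {x | (t : ℝ≥0∞) < ‖𝒯 f x‖ₑ} ^ (m / r) ≤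
    κ * ∏ i, eLpNorm (f i) (ENNReal.ofReal r) μ

/-- The tuple with entries `v i` where `σ i` holds, and `w i` elsewhere. -/
def mix (v w : Fin m → X → ℝ) (σ : Fin m → Bool) : Fin m → X → ℝ :=
  fun i => bif σ i then v i else w i

/-- The tuple of the linear combinations `p i • v i + q i • w i`. -/
def combine (p q : Fin m → ℝ) (v w : Fin m → X → ℝ) : Fin m → X → ℝ :=
  fun i => p i • v i + q i • w i

omit [MeasurableSpace X] in
theorem cut_mix (Z : Set X) (v w : Fin m → X → ℝ) (σ : Fin m → Bool) :
    cut Z (mix v w σ) = mix (cut Z v) (cut Z w) σ := by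
  funext i
  simp only [cut, mix]
  cases σ i <;> rfl

omit [MeasurableSpace X] in
theorem cut_combine (Z : Set X) (p q : Fin m → ℝ) (v w : Fin m → X → ℝ) :
    cut Z (combine p q v w) = combine p q (cut Z v) (cut Z w) := by
  funext i
  ext y
  by_cases hy : y ∈ Z <;> simp [cut, combine, hy]

omit [MeasurableSpace X] in
theorem cut_cut {Z S : Set X} (hZ : S ⊆ Z) (f : Fin m → X → ℝ) : cut S (cut Z f) = cut S f := by
  funext i
  simp only [cut]
  rw [indicator_indicator, inter_eq_left.2 hZ]

omit [MeasurableSpace X] in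
theorem cut_univ (f : Fin m → X → ℝ) : cut univ f = f := by
  funext i
  simp only [cut, indicator_univ]

theorem cut_mem {f : Fin m → X → ℝ} (hf : f ∈ LrTuple μ r m) {Z : Set X} (hZ : MeasurableSet Z) :
    cut Z f ∈ LrTuple μ r m := fun i => (hf i).indicator hZ

theorem mix_mem {v w : Fin m → X → ℝ} (hv : v ∈ LrTuple μ r m) (hw : w ∈ LrTuple μ r m)
    (σ : Fin m → Bool) : mix v w σ ∈ LrTuple μ r m := by
  intro i
  simp only [mix]
  cases σ i
  · exact hw i
  · exact hv i

theorem combine_mem {v w : Fin m → X → ℝ} (hv : v ∈ LrTuple μ r m) (hw : w ∈ LrTuple μ r m)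
    (p q : Fin m → ℝ) : combine p q v w ∈ LrTuple μ r m := fun i =>
  ((hv i).const_smul (p i)).add ((hw i).const_smul (q i))

theorem update_mem {f : Fin m → X → ℝ} (hf : f ∈ LrTuple μ r m) (i : Fin m) {g : X → ℝ}
    (hg : MemLp g (ENNReal.ofReal r) μ) : Function.update f i g ∈ LrTuple μ r m := by
  intro j
  by_cases hj : j = i
  · subst hj
    simpa using hg
  · simpa [hj] using hf j

theorem avg_combine_le (hr : 1 ≤ r) (B : Set X) {v w : Fin m → X → ℝ} (hv : v ∈ LrTuple μ r m)
    (hw : w ∈ LrTuple μ r m) (p q : Fin m → ℝ) (i : Fin m) :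
    avg μ r B (combine p q v w i) ≤ ‖p i‖ₑ * avg μ r B (v i) + ‖q i‖ₑ * avg μ r B (w i) := by
  rw [← avg_smul hr, ← avg_smul hr]
  exact avg_add_le hr B ((hv i).1.const_smul _) ((hw i).1.const_smul _)

variable {𝒯 : (Fin m → X → ℝ) → X → E} {κ : ℝ≥0∞}

/-- Multilinear expansion of bounds for the tuples `mix v w σ`. -/
theorem IsOscillationOperator.combine_le (hT : IsOscillationOperator μ 𝓑 star r 𝒯 κ)
    {v w : Fin m → X → ℝ} (hv : v ∈ LrTuple μ r m) (hw : w ∈ LrTuple μ r m) (p q : Fin m → ℝ)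
    {x : X} {c : ℝ≥0∞} {a a' : Fin m → ℝ≥0∞}
    (hle : ∀ σ, ‖𝒯 (mix v w σ) x‖ₑ ≤ c * ∏ i, bif σ i then a i else a' i) :
    ‖𝒯 (combine p q v w) x‖ₑ ≤ c * ∏ i, (‖p i‖ₑ * a i + ‖q i‖ₑ * a' i) := by
  classical
  -- Induction on the set of expanded slots. The choice `σ` must vary, because expanding the slot
  -- `j` uses the hypothesis for both values of `σ j`.
  have key : ∀ (s : Finset (Fin m)) (σ : Fin m → Bool),
      ‖𝒯 (s.piecewise (combine p q v w) (mix v w σ)) x‖ₑ ≤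
        c * ∏ i, s.piecewise (fun i => ‖p i‖ₑ * a i + ‖q i‖ₑ * a' i)
          (fun i => bif σ i then a i else a' i) i := by
    intro s
    induction s using Finset.induction_on with
    | empty => simpa using hle
    | insert j s hj ih =>
      intro σ
      set g : Bool → Fin m → X → ℝ := fun β =>
        s.piecewise (combine p q v w) (mix v w (Function.update σ j β)) with hg
      have hgmem : ∀ β, g β ∈ LrTuple μ r m := by
        intro β i
        by_cases hi : i ∈ s
        · simpa [hg, hi] using combine_mem hv hw p q i
        · simpa [hg, hi] using mix_mem hv hw (Function.update σ j β) i
      have hgj : ∀ β, g β j = bif β then v j else w j := by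
        intro β
        simp [hg, hj, mix]
      have hgu : ∀ β y, Function.update (g β) j y =
          Function.update (s.piecewise (combine p q v w) (mix v w σ)) j y := by
        intro β y
        funext i
        by_cases hi : i = j
        · subst hi
          simp
        · by_cases his : i ∈ s
          · simp [hg, hi, his]
          · simp [hg, hi, his, mix]
      have hpw : (insert j s).piecewise (combine p q v w) (mix v w σ) =
          Function.update (g true) j (p j • v j + q j • w j) := by
        rw [hgu, Finset.piecewise_insert]
        rfl
      set R : ℝ≥0∞ := ∏ i ∈ Finset.univ.erase j, s.piecewise
        (fun i => ‖p i‖ₑ * a i + ‖q i‖ₑ * a' i) (fun i => bif σ i then a i else a' i) i with hR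
      have hih : ∀ β, ‖𝒯 (g β) x‖ₑ ≤ c * ((bif β then a j else a' j) * R) := by
        intro β
        refine (ih (Function.update σ j β)).trans_eq ?_
        rw [← Finset.mul_prod_erase _ _ (Finset.mem_univ j)]
        congr 2
        · simp [hj]
        · refine Finset.prod_congr rfl fun i hi => ?_
          have hij : i ≠ j := Finset.ne_of_mem_erase hi
          by_cases his : i ∈ s <;> simp [his, hij]
      have hprod : ∏ i, (insert j s).piecewise (fun i => ‖p i‖ₑ * a i + ‖q i‖ₑ * a' i)
          (fun i => bif σ i then a i else a' i) i = (‖p j‖ₑ * a j + ‖q j‖ₑ * a' j) * R := by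
        rw [← Finset.mul_prod_erase _ _ (Finset.mem_univ j)]
        congr 1
        · simp
        · refine Finset.prod_congr rfl fun i hi => ?_
          have hij : i ≠ j := Finset.ne_of_mem_erase hi
          by_cases his : i ∈ s <;> simp [his, hij]
      have h1 : ‖𝒯 (Function.update (g true) j (p j • v j)) x‖ₑ ≤ ‖p j‖ₑ * ‖𝒯 (g true) x‖ₑ := by
        have := hT.smul_le (g true) (hgmem true) j (p j) x
        rwa [hgj] at this
      have h2 : ‖𝒯 (Function.update (g true) j (q j • w j)) x‖ₑ ≤
          ‖q j‖ₑ * ‖𝒯 (g false) x‖ₑ := by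
        have := hT.smul_le (g false) (hgmem false) j (q j) x
        rw [hgj] at this
        rwa [hgu, ← hgu false]
      have h3 := hT.add_le (Function.update (g true) j (p j • v j))
        (update_mem (hgmem true) j ((hv j).const_smul (p j))) j (q j • w j)
        ((hw j).const_smul (q j)) x
      rw [Function.update_self, Function.update_idem, Function.update_idem] at h3
      rw [hpw, hprod]
      calc ‖𝒯 (Function.update (g true) j (p j • v j + q j • w j)) x‖ₑ
          ≤ ‖p j‖ₑ * ‖𝒯 (g true) x‖ₑ + ‖q j‖ₑ * ‖𝒯 (g false) x‖ₑ := h3.trans (add_le_add h1 h2)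
        _ ≤ ‖p j‖ₑ * (c * (a j * R)) + ‖q j‖ₑ * (c * (a' j * R)) := by
            gcongr
            · exact hih true
            · exact hih false
        _ = c * ((‖p j‖ₑ * a j + ‖q j‖ₑ * a' j) * R) := by ring
  have := key Finset.univ fun _ => true
  simpa using this

/-- The levels `t + 1/(n+1)` are used instead of `t`, so that the level `t = 0`, where the weak
bound says nothing, is included. -/
theorem IsOscillationOperator.measure_lt_le (hT : IsOscillationOperator μ 𝓑 star r 𝒯 κ)
    (hr : 1 ≤ r) (hm : 0 < m) {f : Fin m → X → ℝ} (hf : f ∈ LrTuple μ r m) {t ε : ℝ≥0∞}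
    (ht : t ≠ ∞) (hε0 : ε ≠ 0) (hεt : ε ≠ ∞)
    (hle : κ * ∏ i, eLpNorm (f i) (ENNReal.ofReal r) μ ≤ t * ε ^ ((m : ℝ) / r)) :
    μ {x | t < ‖𝒯 f x‖ₑ} ≤ ε := by
  have hmr : 0 < (m : ℝ) / r := by positivity
  lift t to ℝ≥0 using ht
  by_contra! hlt
  have hun : {x | (t : ℝ≥0∞) < ‖𝒯 f x‖ₑ} =
      ⋃ n : ℕ, {x | ((t + 1 / (n + 1) : ℝ≥0) : ℝ≥0∞) < ‖𝒯 f x‖ₑ} := by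
    ext x
    simp only [mem_ofPred_eq, mem_iUnion]
    constructor
    · intro hx
      obtain ⟨s, hts, hsx⟩ := ENNReal.lt_iff_exists_nnreal_btwn.1 hx
      have hts' : 0 < s - t := tsub_pos_of_lt (by exact_mod_cast hts)
      obtain ⟨n, hn⟩ := exists_nat_one_div_lt hts'
      refine ⟨n, lt_of_le_of_lt ?_ hsx⟩
      have : t + 1 / ((n : ℝ≥0) + 1) ≤ s := by
        calc t + 1 / ((n : ℝ≥0) + 1) ≤ t + (s - t) := by gcongr
          _ = s := add_tsub_cancel_of_le (by exact_mod_cast hts.le)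
      exact_mod_cast this
    · rintro ⟨n, hn⟩
      refine lt_of_le_of_lt ?_ hn
      exact_mod_cast le_self_add
  have hmono : Monotone fun n : ℕ => {x | ((t + 1 / (n + 1) : ℝ≥0) : ℝ≥0∞) < ‖𝒯 f x‖ₑ} := by
    intro n k hnk x hx
    simp only [mem_ofPred_eq] at hx ⊢
    refine lt_of_le_of_lt ?_ hx
    have : t + 1 / ((k : ℝ≥0) + 1) ≤ t + 1 / ((n : ℝ≥0) + 1) := by gcongr
    exact_mod_cast this
  rw [hun, hmono.measure_iUnion] at hlt
  obtain ⟨n, hn⟩ := lt_iSup_iff.1 hlt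
  have h1 := hT.weak f hf (t + 1 / (n + 1))
  have hεr0 : ε ^ ((m : ℝ) / r) ≠ 0 := by
    rw [Ne, ENNReal.rpow_eq_zero_iff_of_pos hmr]
    exact hε0
  have hεrt : ε ^ ((m : ℝ) / r) ≠ ∞ := ENNReal.rpow_ne_top_of_nonneg hmr.le hεt
  have h2 : ((t + 1 / (n + 1) : ℝ≥0) : ℝ≥0∞) * ε ^ ((m : ℝ) / r) ≤ t * ε ^ ((m : ℝ) / r) := by
    refine le_trans ?_ (h1.trans hle)
    gcongr
  have h3 := (ENNReal.mul_le_mul_iff_left hεr0 hεrt).1 h2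
  have h4 : t + 1 / ((n : ℝ≥0) + 1) ≤ t := by exact_mod_cast h3
  have h5 : (0 : ℝ≥0) < 1 / ((n : ℝ≥0) + 1) := by positivity
  exact absurd h4 (not_le.2 (lt_add_of_pos_right t h5))

/-- Off a set of measure `θ μ(S)` the operator is bounded by averages over `S`. -/
theorem IsOscillationOperator.measure_prod_lt_le (hT : IsOscillationOperator μ 𝓑 star r 𝒯 κ)
    (hr : 1 ≤ r) (hm : 0 < m) (hκ : κ ≠ ∞) {θ Λ : ℝ≥0} (hθ : θ ≠ 0)
    (hΛ : (2 : ℝ≥0∞) ^ m ≤ Λ * (θ : ℝ≥0∞) ^ ((m : ℝ) / r)) {S : Set X} (h0 : μ S ≠ 0)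
    (hS : μ S ≠ ∞) {f : Fin m → X → ℝ} (hf : f ∈ LrTuple μ r m) {a : Fin m → ℝ≥0∞}
    (ha : ∀ i, a i ≠ ∞)
    (hle : ∀ i, eLpNorm (f i) (ENNReal.ofReal r) μ ≤ 2 * (μ S ^ (1 / r) * a i)) :
    μ {x | Λ * κ * ∏ i, a i < ‖𝒯 f x‖ₑ} ≤ θ * μ S := by
  refine hT.measure_lt_le hr hm hf ?_ (mul_ne_zero (by simpa using hθ) h0)
    (ENNReal.mul_ne_top ENNReal.coe_ne_top hS) ?_
  · exact ENNReal.mul_ne_top (by finiteness) (ENNReal.prod_ne_top fun i _ => ha i)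
  calc κ * ∏ i, eLpNorm (f i) (ENNReal.ofReal r) μ ≤ κ * ∏ i, 2 * (μ S ^ (1 / r) * a i) := by
        gcongr
        exact hle _
    _ = κ * (2 ^ m * (μ S ^ ((m : ℝ) / r) * ∏ i, a i)) := by
        rw [Finset.prod_mul_distrib, Finset.prod_mul_distrib]
        simp only [Finset.prod_const, Finset.card_univ, Fintype.card_fin]
        rw [← ENNReal.rpow_natCast (μ S ^ (1 / r)) m, ← ENNReal.rpow_mul, one_div_mul_eq_div]
    _ ≤ κ * (Λ * (θ : ℝ≥0∞) ^ ((m : ℝ) / r) * (μ S ^ ((m : ℝ) / r) * ∏ i, a i)) := by gcongr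
    _ = Λ * κ * (∏ i, a i) * (θ * μ S) ^ ((m : ℝ) / r) := by
        rw [ENNReal.mul_rpow_of_nonneg _ _ (by positivity)]
        ring

end Operator

/-! ### Exceptional sets and the cost of one change of localization. -/

section LocalEstimates

variable {X : Type u} [MeasurableSpace X] {μ : Measure X} {𝓑 : Set (Set X)}
  {star : Set X → Set X} {C₀ : ℝ≥0} {r : ℝ} {m : ℕ} {E : Type v} [NormedAddCommGroup E]
  {𝒯 : (Fin m → X → ℝ) → X → E} {κ : ℝ≥0∞} {θ Λ : ℝ≥0}

/-- `F` is exceptional for the tuples `v`, `w` localized to `Z`: off `F` the operator and the maximal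
function are controlled by averages over `S`. -/
structure IsExceptional (μ : Measure X) (𝓑 : Set (Set X)) (r : ℝ)
    (𝒯 : (Fin m → X → ℝ) → X → E) (κ : ℝ≥0∞) (Λ : ℝ≥0) (Z S : Set X) (v w : Fin m → X → ℝ)
    (F : Set X) : Prop where
  operator : ∀ x ∉ F, ∀ σ : Fin m → Bool, ‖𝒯 (cut Z (mix v w σ)) x‖ₑ ≤
    Λ * κ * ∏ i, bif σ i then avg μ r S (v i) else avg μ r S (w i)
  left : ∀ x ∉ F, ∀ i, ∀ G ∈ 𝓑, x ∈ G → avg μ r G (cut Z v i) ≤ Λ * avg μ r S (v i)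
  right : ∀ x ∉ F, ∀ i, ∀ G ∈ 𝓑, x ∈ G → avg μ r G (cut Z w i) ≤ Λ * avg μ r S (w i)

theorem avg_mix (B : Set X) (v w : Fin m → X → ℝ) (σ : Fin m → Bool) (i : Fin m) :
    avg μ r B (mix v w σ i) = bif σ i then avg μ r B (v i) else avg μ r B (w i) := by
  simp only [mix]
  cases σ i <;> rfl

theorem IsBallBasis.measure_lt_avg_le_mul (h : IsBallBasis μ 𝓑 star C₀) (hr : 1 ≤ r)
    (hΛ : (2 : ℝ≥0∞) ^ r ≤ θ * (Λ : ℝ≥0∞) ^ r) {S : Set X} (hS : S ∈ 𝓑) {f g : X → ℝ}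
    (hf : MemLp f (ENNReal.ofReal r) μ)
    (hle : eLpNorm g (ENNReal.ofReal r) μ ≤ 2 * (μ S ^ (1 / r) * avg μ r S f)) :
    μ {x | ∃ B ∈ 𝓑, x ∈ B ∧ Λ * avg μ r S f < avg μ r B g} ≤ C₀ * θ * μ S := by
  have hr0 : 0 ≤ r := by linarith
  have hS0 := (h.measure_pos S hS).ne'
  have hSt := (h.measure_lt_top S hS).ne
  have htop := avg_ne_top hr hS0 hf
  rw [mul_assoc]
  refine h.measure_lt_avg_le hr ?_ ?_
  · exact ne_top_of_le_ne_top (ENNReal.mul_ne_top ENNReal.ofNat_ne_top (ENNReal.mul_ne_top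
      (ENNReal.rpow_ne_top_of_nonneg (by positivity) hSt) htop)) hle
  · calc eLpNorm g (ENNReal.ofReal r) μ ^ r ≤ (2 * (μ S ^ (1 / r) * avg μ r S f)) ^ r := by gcongr
      _ = 2 ^ r * (μ S * avg μ r S f ^ r) := by
          rw [ENNReal.mul_rpow_of_nonneg _ _ hr0, ENNReal.mul_rpow_of_nonneg _ _ hr0,
            ← ENNReal.rpow_mul, one_div_mul_cancel (by linarith), ENNReal.rpow_one]
      _ ≤ θ * (Λ : ℝ≥0∞) ^ r * (μ S * avg μ r S f ^ r) := by gcongr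
      _ = θ * μ S * (Λ * avg μ r S f) ^ r := by
          rw [ENNReal.mul_rpow_of_nonneg _ _ hr0]
          ring

/-- Only finitely many bad sets are united: `2^m` for the mixed tuples, `m + m` for the maximal
functions. None of them refers to the coefficients of a linear combination. -/
theorem IsOscillationOperator.exists_isExceptional (hT : IsOscillationOperator μ 𝓑 star r 𝒯 κ)
    (h : IsBallBasis μ 𝓑 star C₀) (hr : 1 ≤ r) (hm : 0 < m) (hκ : κ ≠ ∞) (hθ : θ ≠ 0)
    (hΛ : (2 : ℝ≥0∞) ^ m ≤ Λ * (θ : ℝ≥0∞) ^ ((m : ℝ) / r))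
    (hΛ' : (2 : ℝ≥0∞) ^ r ≤ θ * (Λ : ℝ≥0∞) ^ r) {Z S : Set X} (hZ : MeasurableSet Z) (hS : S ∈ 𝓑)
    {v w : Fin m → X → ℝ} (hv : v ∈ LrTuple μ r m) (hw : w ∈ LrTuple μ r m)
    (hvZ : ∀ i, eLpNorm (cut Z v i) (ENNReal.ofReal r) μ ≤ 2 * (μ S ^ (1 / r) * avg μ r S (v i)))
    (hwZ : ∀ i, eLpNorm (cut Z w i) (ENNReal.ofReal r) μ ≤ 2 * (μ S ^ (1 / r) * avg μ r S (w i))) :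
    ∃ F, MeasurableSet F ∧ μ F ≤ (2 ^ m + m + m) * (C₀ * θ * μ S) ∧
      IsExceptional μ 𝓑 r 𝒯 κ Λ Z S v w F := by
  have hS0 := (h.measure_pos S hS).ne'
  have hSt := (h.measure_lt_top S hS).ne
  set F₁ : (Fin m → Bool) → Set X := fun σ => {x | Λ * κ * ∏ i, avg μ r S (mix v w σ i) <
    ‖𝒯 (cut Z (mix v w σ)) x‖ₑ} with hF₁
  set F₂ : (Fin m → X → ℝ) → Fin m → Set X := fun v i =>
    {x | ∃ B ∈ 𝓑, x ∈ B ∧ Λ * avg μ r S (v i) < avg μ r B (cut Z v i)} with hF₂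
  have h1 : ∀ σ, μ (F₁ σ) ≤ C₀ * θ * μ S := by
    intro σ
    have h1 : μ (F₁ σ) ≤ θ * μ S := by
      refine hT.measure_prod_lt_le hr hm hκ hθ hΛ hS0 hSt (cut_mem (mix_mem hv hw σ) hZ)
        (fun i => avg_ne_top hr hS0 (mix_mem hv hw σ i)) fun i => ?_
      rw [cut_mix]
      simp only [mix]
      cases σ i
      · exact hwZ i
      · exact hvZ i
    rw [mul_assoc]
    exact h1.trans (le_mul_of_one_le_left' h.one_le_ennreal)
  have h2 : ∀ i, μ (F₂ v i) ≤ C₀ * θ * μ S := fun i =>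
    h.measure_lt_avg_le_mul hr hΛ' hS (hv i) (hvZ i)
  have h3 : ∀ i, μ (F₂ w i) ≤ C₀ * θ * μ S := fun i =>
    h.measure_lt_avg_le_mul hr hΛ' hS (hw i) (hwZ i)
  set U : Set X := (⋃ σ, F₁ σ) ∪ (⋃ i, F₂ v i) ∪ (⋃ i, F₂ w i) with hU
  have hUF : U ⊆ toMeasurable μ U := subset_toMeasurable μ U
  refine ⟨toMeasurable μ U, measurableSet_toMeasurable _ _, ?_, fun x hx σ => ?_,
    fun x hx i G hG hxG => ?_, fun x hx i G hG hxG => ?_⟩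
  · rw [measure_toMeasurable]
    calc μ U ≤ ∑ σ, μ (F₁ σ) + ∑ i, μ (F₂ v i) + ∑ i, μ (F₂ w i) :=
          (measure_union_le _ _).trans (add_le_add ((measure_union_le _ _).trans
            (add_le_add (measure_iUnion_fintype_le _ _) (measure_iUnion_fintype_le _ _)))
            (measure_iUnion_fintype_le _ _))
      _ ≤ ∑ σ : Fin m → Bool, C₀ * θ * μ S + ∑ i : Fin m, C₀ * θ * μ S +
            ∑ i : Fin m, C₀ * θ * μ S := by
          gcongr with σ _ i _ i _
          · exact h1 σ
          · exact h2 i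
          · exact h3 i
      _ = (2 ^ m + m + m) * (C₀ * θ * μ S) := by
          simp
          ring
  · have hx' : x ∉ F₁ σ := fun hx' => hx (hUF (Or.inl (Or.inl (mem_iUnion.2 ⟨σ, hx'⟩))))
    simpa only [hF₁, mem_ofPred_eq, not_lt, avg_mix] using hx'
  · have hx' : x ∉ F₂ v i := fun hx' => hx (hUF (Or.inl (Or.inr (mem_iUnion.2 ⟨i, hx'⟩))))
    by_contra! hlt
    exact hx' ⟨G, hG, hxG, hlt⟩
  · have hx' : x ∉ F₂ w i := fun hx' => hx (hUF (Or.inr (mem_iUnion.2 ⟨i, hx'⟩)))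
    by_contra! hlt
    exact hx' ⟨G, hG, hxG, hlt⟩

/-- The product dominating the operator on `combine p q v w` at the ball `S`. -/
def bound (μ : Measure X) (r : ℝ) (S : Set X) (p q : Fin m → ℝ) (v w : Fin m → X → ℝ) : ℝ≥0∞ :=
  ∏ i, (‖p i‖ₑ * avg μ r S (v i) + ‖q i‖ₑ * avg μ r S (w i))

theorem IsExceptional.operator_combine_le (hT : IsOscillationOperator μ 𝓑 star r 𝒯 κ)
    {Z S F : Set X} (hZ : MeasurableSet Z) {v w : Fin m → X → ℝ} (hv : v ∈ LrTuple μ r m)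
    (hw : w ∈ LrTuple μ r m) (hF : IsExceptional μ 𝓑 r 𝒯 κ Λ Z S v w F) {x : X} (hx : x ∉ F)
    (p q : Fin m → ℝ) :
    ‖𝒯 (cut Z (combine p q v w)) x‖ₑ ≤ Λ * κ * bound μ r S p q v w := by
  rw [cut_combine]
  refine hT.combine_le (cut_mem hv hZ) (cut_mem hw hZ) p q fun σ => ?_
  rw [← cut_mix]
  exact hF.operator x hx σ

/-- Passing from the localization `Z` to that of a nearly maximal stopping ball `B`. -/
theorem IsExceptional.sub_le (hT : IsOscillationOperator μ 𝓑 star r 𝒯 κ)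
    (h : IsBallBasis μ 𝓑 star C₀) (hr : 1 ≤ r) (hm : 0 < m) (hκ : κ ≠ ∞) (hθ : θ ≠ 0)
    (hΛ : (2 : ℝ≥0∞) ^ m ≤ Λ * (θ : ℝ≥0∞) ^ ((m : ℝ) / r))
    (hθ' : 2 * (2 ^ m * ((θ : ℝ≥0∞) * C₀)) ≤ 1)
    {Z S F : Set X} (hZ : MeasurableSet Z) {v w : Fin m → X → ℝ} (hv : v ∈ LrTuple μ r m)
    (hw : w ∈ LrTuple μ r m) (hF : IsExceptional μ 𝓑 r 𝒯 κ Λ Z S v w F) {B : Set X} (hB : B ∈ 𝓑)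
    (hmax : ∀ G ∈ 𝓑, B ⊆ G → 2 * μ B < μ G → 2 * μ (G ∩ F) < μ G)
    (hBZ : star (star (star B)) ⊆ Z) {x : X} (hx : x ∈ star (star B)) (p q : Fin m → ℝ) :
    ‖𝒯 (cut Z (combine p q v w)) x - 𝒯 (cut (star (star (star B))) (combine p q v w)) x‖ₑ ≤
      (2 * (Λ : ℝ≥0∞) ^ m + Λ + Λ * (Λ : ℝ≥0∞) ^ m) * κ * bound μ r S p q v w := by
  set u := combine p q v w with hu
  have humem : u ∈ LrTuple μ r m := combine_mem hv hw p q
  have hcmem : cut Z u ∈ LrTuple μ r m := cut_mem humem hZ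
  -- Here (T1) is unavailable, but both localizations are the whole space.
  by_cases huniv : star (star (star B)) = univ
  · have hZu : Z = univ := univ_subset_iff.1 (huniv ▸ hBZ)
    rw [huniv, hZu, sub_self, enorm_zero]
    exact zero_le
  have hsB := h.star_mem B hB
  have hssB := h.star_mem _ hsB
  obtain ⟨G, hG, hBG, hsize⟩ := hT.size (cut Z u) hcmem (star (star B)) hssB huniv
  have hsG := h.star_mem G hG
  have hBsB := (h.subset_star_self hB).trans (h.subset_star_self hsB)
  -- A ball of measure at most `2 μ B` around `B` lies in the enlargement of `B`, while `G` strictly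
  -- contains the double enlargement. So `G` is large, and near maximality makes it less than half
  -- filled by `F`.
  have hGB : 2 * μ B < μ G := by
    by_contra! hle
    have hne : (G ∩ B).Nonempty :=
      (h.nonempty hB).mono fun y hy => ⟨hBG.subset (hBsB hy), hy⟩
    exact hBG.not_subset ((h.subset_star B hB G hG hne hle).trans (h.subset_star_self hsB))
  have hGF := hmax G hG (hBsB.trans hBG.subset) hGB
  have hG0 := (h.measure_pos G hG).ne'
  have hGt := (h.measure_lt_top G hG).ne
  have hsG0 := (h.measure_pos _ hsG).ne'
  have hsGt := (h.measure_lt_top _ hsG).ne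
  have hsGm := h.measurableSet _ hsG
  -- A second bad set, for the localization to the enlargement of `G`. It fills at most half of `G`,
  -- so together with `F` it leaves a good point `y ∈ G`.
  set D : (Fin m → Bool) → Set X := fun σ =>
    {y | Λ * κ * ∏ i, avg μ r (star G) (mix (cut Z v) (cut Z w) σ i) <
      ‖𝒯 (cut (star G) (mix (cut Z v) (cut Z w) σ)) y‖ₑ} with hD
  have hDle : 2 * μ (⋃ σ, D σ) ≤ μ G := by
    calc 2 * μ (⋃ σ, D σ) ≤ 2 * ∑ σ, μ (D σ) := by
          gcongr
          exact measure_iUnion_fintype_le _ _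
      _ ≤ 2 * ∑ σ : Fin m → Bool, θ * (C₀ * μ G) := by
          gcongr with σ _
          have hσ := mix_mem (cut_mem hv hZ) (cut_mem hw hZ) σ
          refine (hT.measure_prod_lt_le hr hm hκ hθ hΛ hsG0 hsGt (cut_mem hσ hsGm)
            (fun i => avg_ne_top hr hsG0 (hσ i)) fun i => ?_).trans ?_
          · simp only [cut]
            rw [eLpNorm_indicator_eq_eLpNorm_restrict hsGm, eLpNorm_restrict_eq_avg hr hsG0 hsGt]
            exact le_mul_of_one_le_left' one_le_two
          · gcongr
            exact h.measure_star_le G hG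
      _ = 2 * (2 ^ m * ((θ : ℝ≥0∞) * C₀)) * μ G := by
          simp
          ring
      _ ≤ 1 * μ G := by gcongr
      _ = μ G := one_mul _
  obtain ⟨y, hyG, hyF, hyD⟩ : ∃ y ∈ G, y ∉ F ∧ y ∉ ⋃ σ, D σ := by
    by_contra! hcon
    have hsub : G ⊆ (G ∩ F) ∪ ⋃ σ, D σ := fun y hy => by
      by_cases hyF : y ∈ F
      · exact Or.inl ⟨hy, hyF⟩
      · exact Or.inr (hcon y hy hyF)
    have h1 : 2 * μ G < 2 * μ G := by
      calc 2 * μ G ≤ 2 * (μ (G ∩ F) + μ (⋃ σ, D σ)) := by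
            gcongr
            exact (measure_mono hsub).trans (measure_union_le _ _)
        _ = 2 * μ (G ∩ F) + 2 * μ (⋃ σ, D σ) := mul_add _ _ _
        _ < μ G + μ G := ENNReal.add_lt_add_of_lt_of_le
            (ne_top_of_le_ne_top hGt hDle) hGF hDle
        _ = 2 * μ G := (two_mul _).symm
    exact lt_irrefl _ h1
  have hfactor : ∀ G' ∈ 𝓑, y ∈ G' → ∀ i, avg μ r G' (cut Z u i) ≤
      Λ * (‖p i‖ₑ * avg μ r S (v i) + ‖q i‖ₑ * avg μ r S (w i)) := by
    intro G' hG' hyG' i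
    rw [hu, cut_combine]
    refine (avg_combine_le hr G' (cut_mem hv hZ) (cut_mem hw hZ) p q i).trans ?_
    calc ‖p i‖ₑ * avg μ r G' (cut Z v i) + ‖q i‖ₑ * avg μ r G' (cut Z w i)
        ≤ ‖p i‖ₑ * (Λ * avg μ r S (v i)) + ‖q i‖ₑ * (Λ * avg μ r S (w i)) := by
          gcongr
          · exact hF.left y hyF i G' hG' hyG'
          · exact hF.right y hyF i G' hG' hyG'
      _ = Λ * (‖p i‖ₑ * avg μ r S (v i) + ‖q i‖ₑ * avg μ r S (w i)) := by ring
  have hpow : ∏ i, Λ * (‖p i‖ₑ * avg μ r S (v i) + ‖q i‖ₑ * avg μ r S (w i)) =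
      (Λ : ℝ≥0∞) ^ m * bound μ r S p q v w := by
    rw [Finset.prod_mul_distrib, bound]
    simp
  set b := bound μ r S p q v w with hb
  have hysG : y ∈ star G := h.subset_star_self hG hyG
  have e1 : ‖𝒯 (cut (star G) (cut Z u)) x - 𝒯 (cut (star (star (star B))) u) x‖ₑ ≤
      κ * ((Λ : ℝ≥0∞) ^ m * b) := by
    have := hsize x hx
    rw [cut_cut hBZ] at this
    refine this.trans ?_
    rw [← hpow]
    gcongr with i _
    exact hfactor _ hsG hysG i
  have e2 : ‖(𝒯 (cut Z u) x - 𝒯 (cut (star G) (cut Z u)) x) -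
      (𝒯 (cut Z u) y - 𝒯 (cut (star G) (cut Z u)) y)‖ₑ ≤ κ * ((Λ : ℝ≥0∞) ^ m * b) := by
    refine (hT.regularity (cut Z u) hcmem G hG x (hBG.subset hx) y hyG).trans ?_
    rw [← hpow]
    gcongr with i _
    exact iSup₂_le fun G' hG' => iSup_le fun hGG' => hfactor G' hG' (hGG' hyG) i
  have e3 : ‖𝒯 (cut Z u) y‖ₑ ≤ Λ * κ * b := hF.operator_combine_le hT hZ hv hw hyF p q
  have e4 : ‖𝒯 (cut (star G) (cut Z u)) y‖ₑ ≤ Λ * κ * ((Λ : ℝ≥0∞) ^ m * b) := by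
    have h1 := hT.combine_le (x := y) (c := Λ * κ) (a := fun i => avg μ r (star G) (cut Z v i))
      (a' := fun i => avg μ r (star G) (cut Z w i))
      (cut_mem (cut_mem hv hZ) hsGm) (cut_mem (cut_mem hw hZ) hsGm) p q (fun σ => by
        have hyσ : y ∉ D σ := fun hy => hyD (mem_iUnion.2 ⟨σ, hy⟩)
        rw [← cut_mix]
        simpa only [hD, mem_ofPred_eq, not_lt, avg_mix] using hyσ)
    rw [hu, cut_combine, cut_combine]
    refine h1.trans ?_
    rw [← hpow]
    gcongr with i _
    calc ‖p i‖ₑ * avg μ r (star G) (cut Z v i) + ‖q i‖ₑ * avg μ r (star G) (cut Z w i)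
        ≤ ‖p i‖ₑ * (Λ * avg μ r S (v i)) + ‖q i‖ₑ * (Λ * avg μ r S (w i)) := by
          gcongr
          · exact hF.left y hyF i _ hsG hysG
          · exact hF.right y hyF i _ hsG hysG
      _ = Λ * (‖p i‖ₑ * avg μ r S (v i) + ‖q i‖ₑ * avg μ r S (w i)) := by ring
  -- The first term is (T1), the second is (T2) on `G` between `x` and `y`, and the third is
  -- evaluated at the good point `y`.
  have hdecomp : 𝒯 (cut Z u) x - 𝒯 (cut (star (star (star B))) u) x =
      (𝒯 (cut (star G) (cut Z u)) x - 𝒯 (cut (star (star (star B))) u) x) +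
      ((𝒯 (cut Z u) x - 𝒯 (cut (star G) (cut Z u)) x) -
        (𝒯 (cut Z u) y - 𝒯 (cut (star G) (cut Z u)) y)) +
      (𝒯 (cut Z u) y - 𝒯 (cut (star G) (cut Z u)) y) := by abel
  rw [hdecomp]
  calc _ ≤ κ * ((Λ : ℝ≥0∞) ^ m * b) + κ * ((Λ : ℝ≥0∞) ^ m * b) +
        (Λ * κ * b + Λ * κ * ((Λ : ℝ≥0∞) ^ m * b)) :=
        (enorm_add_le _ _).trans (add_le_add ((enorm_add_le _ _).trans (add_le_add e1 e2))
          (enorm_sub_le.trans (add_le_add e3 e4)))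
    _ = _ := by ring

end LocalEstimates

/-! ### Passage from stopping balls to their triple enlargements. -/

section Multiplicity

variable {X : Type u} [MeasurableSpace X] {μ : Measure X} {𝓑 : Set (Set X)}
  {star : Set X → Set X} {C₀ : ℝ≥0}

/-- Triple enlargement of the balls of a sparse family leaves it sparse, and at most boundedly many
balls have the same triple enlargement. -/
theorem IsBallBasis.isSparse_image (h : IsBallBasis μ 𝓑 star C₀) {𝒩 : Set (Set X)} (h𝒩 : 𝒩 ⊆ 𝓑)
    {E : Set X → Set X} (hE : ∀ N ∈ 𝒩, MeasurableSet (E N) ∧ E N ⊆ N ∧ μ N ≤ 2 * μ (E N))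
    (hd : 𝒩.PairwiseDisjoint E) :
    IsSparse μ 𝓑 (1 / (2 * (C₀ : ℝ≥0∞) ^ 3)) ((fun N => star (star (star N))) '' 𝒩) ∧
      ∀ φ : Set X → ℝ≥0∞, ∑' N : 𝒩, φ (star (star (star N))) ≤
        2 * C₀ ^ 3 * ∑' S : (fun N => star (star (star N))) '' 𝒩, φ S := by
  have hC0 : (2 * (C₀ : ℝ≥0∞) ^ 3) ≠ 0 :=
    (one_le_mul one_le_two (one_le_pow₀ h.one_le_ennreal)).trans_lt' one_pos |>.ne'
  have hCt : (2 * (C₀ : ℝ≥0∞) ^ 3) ≠ ∞ := by finiteness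
  have h3 : ∀ N ∈ 𝒩, star (star (star N)) ∈ 𝓑 := fun N hN =>
    h.star_mem _ (h.star_mem _ (h.star_mem _ (h𝒩 hN)))
  have hsub : ∀ N ∈ 𝒩, N ⊆ star (star (star N)) := fun N hN =>
    (h.subset_star_self (h𝒩 hN)).trans ((h.subset_star_self (h.star_mem _ (h𝒩 hN))).trans
      (h.subset_star_self (h.star_mem _ (h.star_mem _ (h𝒩 hN)))))
  have hmeas : ∀ N ∈ 𝒩, μ (star (star (star N))) ≤ 2 * C₀ ^ 3 * μ (E N) := by
    intro N hN
    calc μ (star (star (star N))) ≤ C₀ ^ 3 * μ N := h.measure_star_star_star_le (h𝒩 hN)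
      _ ≤ C₀ ^ 3 * (2 * μ (E N)) := by
          gcongr
          exact (hE N hN).2.2
      _ = 2 * C₀ ^ 3 * μ (E N) := by ring
  constructor
  · choose! rep hrep hrepS using fun S (hS : S ∈ (fun N => star (star (star N))) '' 𝒩) => hS
    refine ⟨?_, fun S => E (rep S), fun S hS => ⟨(hE _ (hrep S hS)).1, ?_, ?_⟩, ?_⟩
    · rintro _ ⟨N, hN, rfl⟩
      exact h3 N hN
    · refine (hE _ (hrep S hS)).2.1.trans ((hsub _ (hrep S hS)).trans ?_)
      exact (hrepS S hS).subset
    · have := hmeas _ (hrep S hS)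
      rw [show star (star (star (rep S))) = S from hrepS S hS] at this
      rw [one_div, ← ENNReal.div_eq_inv_mul]
      exact ENNReal.div_le_of_le_mul' this
    · intro S hS S' hS' hne
      refine hd (hrep S hS) (hrep S' hS') fun heq => hne ?_
      rw [← hrepS S hS, ← hrepS S' hS', heq]
  · intro φ
    set g : 𝒩 → (fun N => star (star (star N))) '' 𝒩 := fun N => ⟨_, mem_image_of_mem _ N.2⟩ with hg
    rw [← ENNReal.tsum_fiberwise (fun N : 𝒩 => φ (star (star (star N)))) g,
      ← ENNReal.tsum_mul_left]
    refine ENNReal.tsum_le_tsum fun S => ?_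
    obtain ⟨N₀, hN₀, hN₀S⟩ := S.2
    have hS : (S : Set X) ∈ 𝓑 := by
      rw [← hN₀S]
      exact h3 N₀ hN₀
    have hgS : ∀ N : g ⁻¹' {S}, star (star (star (N : 𝒩))) = (S : Set X) := fun N =>
      congrArg Subtype.val N.2
    -- The balls with enlargement `S` own disjoint subsets of `S`, each of measure at least `μ S /
    -- (2 C₀^3)`.
    have hcard : ∑' _ : g ⁻¹' {S}, (1 : ℝ≥0∞) ≤ 2 * C₀ ^ 3 := by
      have h1 : (∑' _ : g ⁻¹' {S}, (1 : ℝ≥0∞)) * μ S ≤ 2 * C₀ ^ 3 * μ S := by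
        rw [← ENNReal.tsum_mul_right]
        calc ∑' _ : g ⁻¹' {S}, 1 * μ S ≤ ∑' N : g ⁻¹' {S}, 2 * C₀ ^ 3 * μ (E (N : 𝒩)) := by
              refine ENNReal.tsum_le_tsum fun N => ?_
              rw [one_mul, ← hgS N]
              exact hmeas _ (N : 𝒩).2
          _ = 2 * C₀ ^ 3 * ∑' N : g ⁻¹' {S}, μ (E (N : 𝒩)) := ENNReal.tsum_mul_left
          _ ≤ 2 * C₀ ^ 3 * μ S := by
              gcongr
              refine (tsum_meas_le_meas_iUnion_of_disjoint μ
                (As := fun N : g ⁻¹' {S} => E (N : 𝒩)) (fun N => (hE _ (N : 𝒩).2).1) ?_).trans (measure_mono (iUnion_subset fun N => ?_))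
              · intro N N' hne
                exact hd (N : 𝒩).2 (N' : 𝒩).2 fun heq => hne (Subtype.ext (Subtype.ext heq))
              · rw [← hgS N]
                exact (hE _ (N : 𝒩).2).2.1.trans (hsub _ (N : 𝒩).2)
      exact (ENNReal.mul_le_mul_iff_left (h.measure_pos _ hS).ne' (h.measure_lt_top _ hS).ne).1 h1
    calc ∑' N : g ⁻¹' {S}, φ (star (star (star (N : 𝒩)))) = ∑' _ : g ⁻¹' {S}, 1 * φ S := by
          refine tsum_congr fun N => ?_
          rw [hgS N, one_mul]
      _ = (∑' _ : g ⁻¹' {S}, (1 : ℝ≥0∞)) * φ S := ENNReal.tsum_mul_right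
      _ ≤ 2 * C₀ ^ 3 * φ S := by gcongr

end Multiplicity

/-! ### Choice of parameters and the telescoping argument. -/

section Domination

variable {X : Type u} [MeasurableSpace X] {μ : Measure X} {𝓑 : Set (Set X)}
  {star : Set X → Set X} {C₀ : ℝ≥0} {r : ℝ} {m : ℕ} {E : Type v} [NormedAddCommGroup E]
  {𝒯 : (Fin m → X → ℝ) → X → E} {κ : ℝ≥0∞} {θ Λ : ℝ≥0}

/-- The constant in the sparse domination. -/
def dominationConst (m : ℕ) (C₀ Λ : ℝ≥0) : ℝ≥0 :=
  (2 * Λ ^ m + Λ + Λ * Λ ^ m + Λ) * (2 * C₀ ^ 3)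

/-- The conditions on the auxiliary parameters of the stopping construction. -/
structure IsAdmissible (m : ℕ) (r : ℝ) (C₀ : ℝ≥0) (J : ℕ) (δ : ℝ≥0∞) (θ Λ : ℝ≥0) : Prop where
  scales : 4 * (C₀ : ℝ≥0∞) ^ 2 ≤ 2 ^ J
  ne_top : δ ≠ ∞
  nested : (C₀ : ℝ≥0∞) ^ 3 * (4 * δ) ≤ 1
  sparse : 16 * J * (C₀ : ℝ≥0∞) ^ 4 * δ ≤ 1
  theta_ne_zero : θ ≠ 0
  exceptional : (2 ^ m + m + m) * ((C₀ : ℝ≥0∞) * θ * C₀ ^ 3) ≤ δ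
  good : 2 * (2 ^ m * ((θ : ℝ≥0∞) * C₀)) ≤ 1
  operator : (2 : ℝ≥0∞) ^ m ≤ Λ * (θ : ℝ≥0∞) ^ ((m : ℝ) / r)
  maximal : (2 : ℝ≥0∞) ^ r ≤ θ * (Λ : ℝ≥0∞) ^ r

theorem exists_isAdmissible (m : ℕ) (hr : 1 ≤ r) (hC : 1 ≤ C₀) :
    ∃ J δ θ Λ, IsAdmissible m r C₀ J δ θ Λ := by
  have hr0 : 0 < r := by linarith
  obtain ⟨J, hJ⟩ := pow_unbounded_of_one_lt (4 * C₀ ^ 2) (one_lt_two (α := ℝ≥0))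
  -- The parameters are chosen successively: `J` from `C₀`, then `δ`, then `θ`, then `Λ` with one
  -- summand for each of its two lower bounds.
  set δ : ℝ≥0 := 1 / (16 * (J + 1) * C₀ ^ 4) with hδ
  set M : ℝ≥0 := 2 ^ m + m + m with hM
  set θ : ℝ≥0 := δ / (M * C₀ ^ 4) with hθ
  set Λ : ℝ≥0 := 2 ^ m / θ ^ ((m : ℝ) / r) + (2 ^ r / θ) ^ (1 / r) with hΛ
  have hC0 : 0 < C₀ := one_pos.trans_le hC
  have hM0 : 0 < M := by positivity
  have hδ0 : 0 < δ := by positivity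
  have hθ0 : 0 < θ := by positivity
  have hδden : 16 * ((J : ℝ≥0) + 1) * C₀ ^ 4 * δ = 1 := by
    rw [hδ]
    field_simp
  have hθM : M * C₀ ^ 4 * θ = δ := by
    rw [hθ]
    field_simp
  have h34 : C₀ ^ 3 ≤ C₀ ^ 4 := pow_le_pow_right₀ hC (by norm_num)
  have hnest : C₀ ^ 3 * (4 * δ) ≤ 1 := by
    calc C₀ ^ 3 * (4 * δ) ≤ C₀ ^ 4 * (16 * (J + 1) * δ) := by
          gcongr
          have : (1 : ℝ≥0) ≤ J + 1 := le_add_self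
          calc (4 : ℝ≥0) = 4 * 1 := by norm_num
            _ ≤ 16 * (J + 1) := mul_le_mul' (by norm_num) this
      _ = 16 * (J + 1) * C₀ ^ 4 * δ := by ring
      _ = 1 := hδden
  refine ⟨J, δ, θ, Λ, ?_, ENNReal.coe_ne_top, ?_, ?_, hθ0.ne', ?_, ?_, ?_, ?_⟩
  · exact_mod_cast hJ.le
  · exact_mod_cast hnest
  · have : 16 * (J : ℝ≥0) * C₀ ^ 4 * δ ≤ 1 := by
      rw [← hδden]
      gcongr
      exact le_self_add
    exact_mod_cast this
  · have : M * (C₀ * θ * C₀ ^ 3) ≤ δ := by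
      rw [← hθM]
      apply le_of_eq
      ring
    rw [hM] at this
    exact_mod_cast this
  · have h1 : (2 : ℝ≥0) ^ m ≤ M := by
      rw [hM, add_assoc]
      exact le_self_add
    have : 2 * (2 ^ m * (θ * C₀)) ≤ 1 := by
      calc 2 * (2 ^ m * (θ * C₀)) ≤ 4 * (M * (θ * C₀ ^ 4)) := by
            gcongr
            · norm_num
            · exact le_self_pow₀ hC (by norm_num)
        _ = 1 * (4 * δ) := by rw [← hθM]; ring
        _ ≤ C₀ ^ 3 * (4 * δ) := by
            gcongr
            exact one_le_pow₀ hC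
        _ ≤ 1 := hnest
    exact_mod_cast this
  · have hpow : 0 < θ ^ ((m : ℝ) / r) := NNReal.rpow_pos hθ0
    have : (2 : ℝ≥0) ^ m ≤ Λ * θ ^ ((m : ℝ) / r) := by
      calc (2 : ℝ≥0) ^ m = 2 ^ m / θ ^ ((m : ℝ) / r) * θ ^ ((m : ℝ) / r) := by field_simp
        _ ≤ Λ * θ ^ ((m : ℝ) / r) := by
            gcongr
            exact le_self_add
    rw [← ENNReal.coe_rpow_of_nonneg _ (by positivity)]
    exact_mod_cast this
  · have : (2 : ℝ≥0) ^ r ≤ θ * Λ ^ r := by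
      calc (2 : ℝ≥0) ^ r = θ * ((2 ^ r / θ) ^ (1 / r)) ^ r := by
            rw [← NNReal.rpow_mul, one_div_mul_cancel hr0.ne', NNReal.rpow_one]
            field_simp
        _ ≤ θ * Λ ^ r := by
            gcongr
            exact le_add_self
    rw [← ENNReal.coe_rpow_of_nonneg _ hr0.le]
    have h2 : (2 : ℝ≥0∞) ^ r = ((2 ^ r : ℝ≥0) : ℝ≥0∞) := by
      rw [ENNReal.coe_rpow_of_nonneg _ hr0.le]
      rfl
    rw [h2]
    exact_mod_cast this

/-- Sparse domination on a ball `A` outside of which the relevant tuples carry little mass. The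
tuples `v S`, `w S` are allowed to depend on the ball `S` over which averages are taken, and the
dominated tuples are linear combinations of these. -/
theorem IsOscillationOperator.exists_sparse_domination
    (hT : IsOscillationOperator μ 𝓑 star r 𝒯 κ) (h : IsBallBasis μ 𝓑 star C₀) (hr : 1 ≤ r)
    (hm : 0 < m) (hκ : κ ≠ ∞) {J : ℕ} {δ : ℝ≥0∞} (hadm : IsAdmissible m r C₀ J δ θ Λ)
    {A : Set X} (hA : A ∈ 𝓑) {v w : Set X → Fin m → X → ℝ} (hv : ∀ S ∈ 𝓑, v S ∈ LrTuple μ r m)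
    (hw : ∀ S ∈ 𝓑, w S ∈ LrTuple μ r m)
    (hvA : ∀ S ∈ 𝓑, A ⊆ S → ∀ i, eLpNorm (v S i) (ENNReal.ofReal r) μ ≤
      2 * eLpNorm (v S i) (ENNReal.ofReal r) (μ.restrict S))
    (hwA : ∀ S ∈ 𝓑, A ⊆ S → ∀ i, eLpNorm (w S i) (ENNReal.ofReal r) μ ≤
      2 * eLpNorm (w S i) (ENNReal.ofReal r) (μ.restrict S)) :
    ∃ 𝒮, IsSparse μ 𝓑 (1 / (2 * (C₀ : ℝ≥0∞) ^ 3)) 𝒮 ∧ ∀ᵐ x ∂μ, x ∈ A →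
      ∀ (u : Fin m → X → ℝ) (p q : Set X → Fin m → ℝ),
        (∀ S ∈ 𝓑, u = combine (p S) (q S) (v S) (w S)) →
        ‖𝒯 u x‖ₑ ≤ dominationConst m C₀ Λ * κ *
          ∑' S : 𝒮, (S : Set X).indicator (fun _ => bound μ r S (p S) (q S) (v S) (w S)) x := by
  classical
  set S : Set X → Set X := fun N => star (star (star N)) with hS
  -- The root is not truncated, so the telescoping starts from `𝒯 u` itself; this is where the mass
  -- condition on `A` is needed.
  set Z : Set X → Set X := fun N => if N = A then univ else S N with hZ
  have hS𝓑 : ∀ N ∈ 𝓑, S N ∈ 𝓑 := fun N hN => h.star_mem _ (h.star_mem _ (h.star_mem _ hN))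
  have hssS : ∀ N ∈ 𝓑, star (star N) ⊆ S N := fun N hN =>
    h.subset_star_self (h.star_mem _ (h.star_mem _ hN))
  have hsss : ∀ N ∈ 𝓑, star N ⊆ star (star N) := fun N hN => h.subset_star_self (h.star_mem _ hN)
  have hNS : ∀ N ∈ 𝓑, N ⊆ S N := fun N hN =>
    (h.subset_star_self hN).trans ((hsss N hN).trans (hssS N hN))
  have hSZ : ∀ N, S N ⊆ Z N := by
    intro N
    by_cases hN : N = A <;> simp [hZ, hN]
  have hZm : ∀ N ∈ 𝓑, MeasurableSet (Z N) := by
    intro N hN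
    by_cases hNA : N = A
    · simp [hZ, hNA]
    · simpa [hZ, hNA] using h.measurableSet _ (hS𝓑 N hN)
  have hlocal : ∀ N ∈ 𝓑, ∀ f : Set X → Fin m → X → ℝ,
      (∀ S ∈ 𝓑, A ⊆ S → ∀ i, eLpNorm (f S i) (ENNReal.ofReal r) μ ≤
        2 * eLpNorm (f S i) (ENNReal.ofReal r) (μ.restrict S)) →
      ∀ i, eLpNorm (cut (Z N) (f (S N)) i) (ENNReal.ofReal r) μ ≤
        2 * (μ (S N) ^ (1 / r) * avg μ r (S N) (f (S N) i)) := by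
    intro N hN f hf i
    have hSN := hS𝓑 N hN
    rw [← eLpNorm_restrict_eq_avg hr (h.measure_pos _ hSN).ne' (h.measure_lt_top _ hSN).ne]
    by_cases hNA : N = A
    · have : Z N = univ := by simp [hZ, hNA]
      rw [this, cut_univ]
      refine hf _ hSN ?_ i
      rw [← hNA]
      exact hNS N hN
    · have : Z N = S N := by simp [hZ, hNA]
      rw [this, cut, eLpNorm_indicator_eq_eLpNorm_restrict (h.measurableSet _ hSN)]
      exact le_mul_of_one_le_left' one_le_two
  have hexc : ∀ N ∈ 𝓑, ∃ F, MeasurableSet F ∧ μ F ≤ δ * μ N ∧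
      IsExceptional μ 𝓑 r 𝒯 κ Λ (Z N) (S N) (v (S N)) (w (S N)) F := by
    intro N hN
    have hSN := hS𝓑 N hN
    obtain ⟨F, hFm, hFle, hF⟩ := hT.exists_isExceptional h hr hm hκ hadm.theta_ne_zero
      hadm.operator hadm.maximal (hZm N hN) hSN (hv _ hSN) (hw _ hSN)
      (hlocal N hN v hvA) (hlocal N hN w hwA)
    refine ⟨F, hFm, hFle.trans ?_, hF⟩
    calc (2 ^ m + m + m) * (C₀ * θ * μ (S N))
        ≤ (2 ^ m + m + m) * (C₀ * θ * (C₀ ^ 3 * μ N)) := by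
          gcongr
          exact h.measure_star_star_star_le hN
      _ = (2 ^ m + m + m) * ((C₀ : ℝ≥0∞) * θ * C₀ ^ 3) * μ N := by ring
      _ ≤ δ * μ N := by
          gcongr
          exact hadm.exceptional
  choose! F hFm hFle hF using hexc
  have hFtop : ∀ N ∈ 𝓑, μ (F N) ≠ ∞ := fun N hN =>
    ne_top_of_le_ne_top (ENNReal.mul_ne_top hadm.ne_top (h.measure_lt_top N hN).ne) (hFle N hN)
  -- Requiring a half filled ball removes only a null set from `F N`, and makes a stopping ball
  -- available at every point of `G N`.
  set G : Set X → Set X := fun N => {x | x ∈ star N ∧ x ∈ F N ∧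
    ∃ B ∈ 𝓑, x ∈ B ∧ μ B ≤ 2 * μ (B ∩ F N)} with hG
  have hexball : ∀ N x, ∃ B, N ∈ 𝓑 → x ∈ G N → B ∈ 𝓑 ∧ x ∈ B ∧ μ B ≤ 2 * μ (B ∩ F N) ∧
      ∀ G ∈ 𝓑, B ⊆ G → 2 * μ B < μ G → 2 * μ (G ∩ F N) < μ G := by
    intro N x
    by_cases hNx : N ∈ 𝓑 ∧ x ∈ G N
    · obtain ⟨B, hB⟩ := exists_maximal_ball h (hFtop N hNx.1) hNx.2.2.2
      exact ⟨B, fun _ _ => hB⟩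
    · exact ⟨∅, fun h1 h2 => absurd ⟨h1, h2⟩ hNx⟩
  choose β hβ using hexball
  have hrule : IsStoppingRule μ 𝓑 star δ G F β :=
    ⟨fun N _ x hx => hx.1, fun N hN x hx => (hβ N x hN hx).1, fun N hN x hx => (hβ N x hN hx).2.1,
      fun N hN x hx => (hβ N x hN hx).2.2.1, hFle⟩
  obtain ⟨𝒩, h𝒩, hA𝒩, hparent, ⟨Q, hQ, hQd⟩, hcount, hae⟩ :=
    exists_sparse_stopping h hA hrule hadm.scales hadm.nested hadm.sparse hadm.ne_top
  obtain ⟨hsparse, hmult⟩ := h.isSparse_image h𝒩 hQ hQd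
  refine ⟨S '' 𝒩, hsparse, ?_⟩
  have hdense : ∀ᵐ x ∂μ, ∀ N ∈ 𝒩, x ∈ F N → ∃ B ∈ 𝓑, x ∈ B ∧ μ B ≤ 2 * μ (B ∩ F N) :=
    (ae_ball_iff hcount).2 fun N hN => h.ae_exists_ball (hFm N (h𝒩 hN)) (hFtop N (h𝒩 hN))
  -- The null set is fixed before `u`, `p`, `q` are introduced, so these may depend on `x`, as the
  -- commutator requires.
  filter_upwards [hae, hdense] with x hx hxd hxA u p q hu
  set K : ℝ≥0∞ := (2 * (Λ : ℝ≥0∞) ^ m + Λ + Λ * (Λ : ℝ≥0∞) ^ m) * κ with hK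
  set φ : Set X → ℝ≥0∞ := fun S =>
    S.indicator (fun _ => bound μ r S (p S) (q S) (v S) (w S)) x with hφ
  -- Telescoping from `N` up to the root. Scales strictly decrease towards the root, so the
  -- ancestors are distinct and their terms form a partial sum over `𝒩`.
  have hchain : ∀ n, ∀ N ∈ 𝒩, scale μ A N = n → x ∈ star (star N) → ∃ s : Finset (Set X),
      ↑s ⊆ 𝒩 ∧ (∀ M ∈ s, scale μ A M < n) ∧
      ‖𝒯 u x‖ₑ ≤ ‖𝒯 (cut (Z N) u) x‖ₑ + K * ∑ M ∈ s, φ (S M) := by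
    intro n
    induction n using Nat.strong_induction_on with
    | _ n ih =>
      intro N hN hn hxN
      by_cases hNA : N = A
      · refine ⟨∅, by simp, by simp, ?_⟩
        have : Z N = univ := by simp [hZ, hNA]
        rw [this, cut_univ]
        exact le_self_add
      · obtain ⟨P, hP, hPN, y, hy, hNβ⟩ := hparent N hN hNA
        have hP𝓑 := h𝒩 hP
        have hN𝓑 := h𝒩 hN
        have hsub := hrule.star_star_stop_subset h hadm.nested hP𝓑 hy
        have hsub3 := hrule.star_star_star_stop_subset h hadm.nested hP𝓑 hy
        rw [← hNβ] at hsub hsub3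
        have hxP := hsub hxN
        obtain ⟨s, hs𝒩, hsn, hs⟩ := ih _ (by omega) P hP rfl hxP
        have hPs : P ∉ s := fun hPs => lt_irrefl _ (hsn P hPs)
        refine ⟨insert P s, ?_, ?_, ?_⟩
        · rw [Finset.coe_insert]
          exact insert_subset hP hs𝒩
        · intro M hM
          rcases Finset.mem_insert.1 hM with rfl | hM
          · omega
          · have := hsn M hM
            omega
        have hmax := (hβ P y hP𝓑 hy).2.2.2
        rw [← hNβ] at hmax
        have hSP := hS𝓑 P hP𝓑
        have hstep := (hF P hP𝓑).sub_le hT h hr hm hκ hadm.theta_ne_zero hadm.operator hadm.good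
          (hZm P hP𝓑) (hv _ hSP) (hw _ hSP) hN𝓑 hmax
          (hsub3.trans ((hssS P hP𝓑).trans (hSZ P))) hxN (p (S P)) (q (S P))
        rw [← hu _ hSP] at hstep
        have hφP : φ (S P) = bound μ r (S P) (p (S P)) (q (S P)) (v (S P)) (w (S P)) :=
          indicator_of_mem (hssS P hP𝓑 hxP) _
        have hZN : Z N = star (star (star N)) := by simp [hZ, hS, hNA]
        rw [← hφP, ← hZN] at hstep
        have htri : ‖𝒯 (cut (Z P) u) x‖ₑ ≤ ‖𝒯 (cut (Z N) u) x‖ₑ + K * φ (S P) := by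
          calc ‖𝒯 (cut (Z P) u) x‖ₑ
              = ‖𝒯 (cut (Z N) u) x + (𝒯 (cut (Z P) u) x - 𝒯 (cut (Z N) u) x)‖ₑ := by
                rw [add_sub_cancel]
            _ ≤ _ := (enorm_add_le _ _).trans (add_le_add le_rfl hstep)
        calc ‖𝒯 u x‖ₑ ≤ ‖𝒯 (cut (Z P) u) x‖ₑ + K * ∑ M ∈ s, φ (S M) := hs
          _ ≤ ‖𝒯 (cut (Z N) u) x‖ₑ + K * φ (S P) + K * ∑ M ∈ s, φ (S M) := by gcongr
          _ = ‖𝒯 (cut (Z N) u) x‖ₑ + K * ∑ M ∈ insert P s, φ (S M) := by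
              rw [Finset.sum_insert hPs]
              ring
  obtain ⟨N, hN, hxN, hxG⟩ := hx
  have hN𝓑 := h𝒩 hN
  have hSN := hS𝓑 N hN𝓑
  have hxsN : x ∈ star N := by
    rcases hxN with hxN | rfl
    · exact hxN
    · exact h.subset_star_self hA hxA
  -- At the last ball of the chain the point is not exceptional, so the remaining localized term is
  -- bounded directly.
  have hxF : x ∉ F N := fun hxF => hxG ⟨hxsN, hxF, hxd N hN hxF⟩
  have hxssN := hsss N hN𝓑 hxsN
  obtain ⟨s, hs𝒩, -, hs⟩ := hchain _ N hN rfl hxssN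
  have hlast := (hF N hN𝓑).operator_combine_le hT (hZm N hN𝓑) (hv _ hSN) (hw _ hSN) hxF
    (p (S N)) (q (S N))
  rw [← hu _ hSN] at hlast
  have hφN : φ (S N) = bound μ r (S N) (p (S N)) (q (S N)) (v (S N)) (w (S N)) :=
    indicator_of_mem (hssS N hN𝓑 hxssN) _
  rw [← hφN] at hlast
  have hsum : ∑ M ∈ s, φ (S M) ≤ ∑' M : 𝒩, φ (S M) := by
    rw [← Finset.tsum_subtype s fun M => φ (S M)]
    exact ENNReal.tsum_mono_subtype (fun M => φ (S M)) hs𝒩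
  have hone : φ (S N) ≤ ∑' M : 𝒩, φ (S M) :=
    ENNReal.le_tsum (f := fun M : 𝒩 => φ (S M)) ⟨N, hN⟩
  calc ‖𝒯 u x‖ₑ ≤ Λ * κ * ∑' M : 𝒩, φ (S M) + K * ∑' M : 𝒩, φ (S M) := by
        refine hs.trans (add_le_add (hlast.trans ?_) ?_) <;> gcongr
    _ = (2 * (Λ : ℝ≥0∞) ^ m + Λ + Λ * (Λ : ℝ≥0∞) ^ m + Λ) * κ * ∑' M : 𝒩, φ (S M) := by
        rw [hK]
        ring
    _ ≤ (2 * (Λ : ℝ≥0∞) ^ m + Λ + Λ * (Λ : ℝ≥0∞) ^ m + Λ) * κ *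
          (2 * C₀ ^ 3 * ∑' T : S '' 𝒩, φ T) := by
        gcongr
        exact hmult φ
    _ = _ := by
        rw [dominationConst]
        push_cast
        ring

end Domination

/-! ### Uniform mass on exhausting sets. -/

section Exhaustion

variable {X : Type u} [MeasurableSpace X] {μ : Measure X} {r : ℝ}

theorem tendsto_eLpNorm_restrict_compl (hr : 1 ≤ r) {A : ℕ → Set X}
    (hA : ∀ n, MeasurableSet (A n)) (hx : ∀ x, ∀ᶠ n in Filter.atTop, x ∈ A n) {f : X → ℝ}
    (hf : MemLp f (ENNReal.ofReal r) μ) :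
    Filter.Tendsto (fun n => eLpNorm f (ENNReal.ofReal r) (μ.restrict (A n)ᶜ)) Filter.atTop
      (nhds 0) := by
  have hr0 : 0 < r := by linarith
  have hfin : ∫⁻ x, ‖f x‖ₑ ^ r ∂μ ≠ ∞ := by
    rw [← eLpNorm_rpow hr]
    exact ENNReal.rpow_ne_top_of_nonneg hr0.le hf.2.ne
  have hmeas : AEMeasurable (fun x => ‖f x‖ₑ ^ r) μ := hf.1.enorm.pow_const r
  have hlim : Filter.Tendsto (fun n => ∫⁻ x in (A n)ᶜ, ‖f x‖ₑ ^ r ∂μ) Filter.atTop (nhds 0) := by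
    have h1 := tendsto_lintegral_of_dominated_convergence' (μ := μ)
      (F := fun n => (A n)ᶜ.indicator fun x => ‖f x‖ₑ ^ r) (f := fun _ => 0)
      (fun x => ‖f x‖ₑ ^ r) (fun n => hmeas.indicator (hA n).compl)
      (fun n => Filter.Eventually.of_forall fun x => indicator_le_self _ _ x) hfin
      (Filter.Eventually.of_forall fun x => tendsto_const_nhds.congr' ?_)
    · simpa only [lintegral_indicator (hA _).compl, lintegral_zero] using h1
    · filter_upwards [hx x] with n hn
      rw [indicator_of_notMem (by simpa using hn)]
  simp only [eLpNorm_restrict_eq hr]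
  have h2 := hlim.ennrpow_const (1 / r)
  rwa [ENNReal.zero_rpow_of_pos (by positivity)] at h2

/-- On an exhausting sequence of sets the `L^r` norms of all linear combinations of two functions are
eventually at least half of the full norms. -/
theorem eventually_eLpNorm_combination_le (hr : 1 ≤ r) {A : ℕ → Set X}
    (hA : ∀ n, MeasurableSet (A n)) (hx : ∀ x, ∀ᶠ n in Filter.atTop, x ∈ A n) {f g : X → ℝ}
    (hf : MemLp f (ENNReal.ofReal r) μ) (hg : MemLp g (ENNReal.ofReal r) μ) :
    ∀ᶠ n in Filter.atTop, ∀ c d : ℝ, eLpNorm (c • f + d • g) (ENNReal.ofReal r) μ ≤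
      2 * eLpNorm (c • f + d • g) (ENNReal.ofReal r) (μ.restrict (A n)) := by
  set p := ENNReal.ofReal r with hp
  have hp1 : 1 ≤ p := ENNReal.one_le_ofReal.2 hr
  have : Fact (1 ≤ p) := ⟨hp1⟩
  -- Uniformity in `c`, `d` comes from finite dimension: restriction to the complement of `A n`
  -- tends to zero on a basis of the span, hence in operator norm.
  set V : Submodule ℝ (Lp ℝ p μ) := Submodule.span ℝ {hf.toLp f, hg.toLp g} with hV
  have hfin : FiniteDimensional ℝ V := FiniteDimensional.span_of_finite ℝ (toFinite _)
  set e := Module.finBasis ℝ V with he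
  set C : ℝ := Fintype.card (Fin (Module.finrank ℝ V)) •
    ‖e.equivFunL.toContinuousLinearMap‖ with hC
  have hC0 : 0 ≤ C := by positivity
  set T : ∀ n, V →L[ℝ] Lp ℝ p (μ.restrict (A n)ᶜ) := fun n =>
    (LpToLpRestrictCLM X ℝ ℝ μ p (A n)ᶜ).comp V.subtypeL with hT
  have hTnorm : ∀ n (y : V), ‖T n y‖ =
      (eLpNorm (y : Lp ℝ p μ) p (μ.restrict (A n)ᶜ)).toReal := by
    intro n y
    rw [Lp.norm_def]
    congr 1
    exact eLpNorm_congr_ae (LpToLpRestrictCLM_coeFn ℝ (A n)ᶜ (y : Lp ℝ p μ))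
  have hlim : ∀ᶠ n in Filter.atTop, ∀ i, ‖T n (e i)‖ ≤ 1 / (2 * (C + 1)) := by
    rw [Filter.eventually_all]
    intro i
    have h1 := tendsto_eLpNorm_restrict_compl hr hA hx (Lp.memLp (e i : Lp ℝ p μ))
    have h2 := (ENNReal.tendsto_toReal ENNReal.zero_ne_top).comp h1
    have h3 := h2.eventually_lt_const (show (0 : ℝ≥0∞).toReal < 1 / (2 * (C + 1)) by
      rw [ENNReal.toReal_zero]
      positivity)
    filter_upwards [h3] with n hn
    rw [hTnorm]
    exact hn.le
  filter_upwards [hlim] with n hn c d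
  have hopn : ‖T n‖ ≤ 1 / 2 := by
    refine (e.opNorm_le (by positivity) hn).trans ?_
    rw [← hC, mul_one_div, div_le_div_iff₀ (by positivity) two_pos]
    linarith
  set k : X → ℝ := c • f + d • g with hk
  have hkm : MemLp k p μ := (hf.const_smul c).add (hg.const_smul d)
  have hkV : hkm.toLp k ∈ V := by
    have : hkm.toLp k = c • hf.toLp f + d • hg.toLp g := rfl
    rw [this]
    exact V.add_mem (V.smul_mem _ (Submodule.subset_span (by simp)))
      (V.smul_mem _ (Submodule.subset_span (by simp)))
  have hnorm := (T n).le_of_opNorm_le hopn ⟨_, hkV⟩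
  rw [hTnorm] at hnorm
  have hnorm' : (eLpNorm k p (μ.restrict (A n)ᶜ)).toReal ≤ 1 / 2 * (eLpNorm k p μ).toReal := by
    have h1 : eLpNorm (hkm.toLp k) p (μ.restrict (A n)ᶜ) = eLpNorm k p (μ.restrict (A n)ᶜ) :=
      eLpNorm_congr_ae (ae_restrict_of_ae hkm.coeFn_toLp)
    rw [← h1]
    refine hnorm.trans_eq ?_
    congr 1
    exact Lp.norm_toLp k hkm
  have hkt := hkm.2.ne
  have hct : eLpNorm k p (μ.restrict (A n)ᶜ) ≠ ∞ := (hkm.restrict _).2.ne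
  have hle : 2 * eLpNorm k p (μ.restrict (A n)ᶜ) ≤ eLpNorm k p μ := by
    rw [← ENNReal.toReal_le_toReal (by finiteness) hkt, ENNReal.toReal_mul, ENNReal.toReal_ofNat]
    linarith
  have hsplit : eLpNorm k p μ ≤
      eLpNorm k p (μ.restrict (A n)) + eLpNorm k p (μ.restrict (A n)ᶜ) := by
    rw [← eLpNorm_indicator_eq_eLpNorm_restrict (hA n),
      ← eLpNorm_indicator_eq_eLpNorm_restrict (hA n).compl]
    conv_lhs => rw [← indicator_self_add_compl (A n) k]
    exact eLpNorm_add_le (hkm.1.indicator (hA n)) (hkm.1.indicator (hA n).compl) hp1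
  refine (ENNReal.add_le_add_iff_left hkt).1 ?_
  calc eLpNorm k p μ + eLpNorm k p μ = 2 * eLpNorm k p μ := (two_mul _).symm
    _ ≤ 2 * (eLpNorm k p (μ.restrict (A n)) + eLpNorm k p (μ.restrict (A n)ᶜ)) := by gcongr
    _ = 2 * eLpNorm k p (μ.restrict (A n)ᶜ) + 2 * eLpNorm k p (μ.restrict (A n)) := by ring
    _ ≤ eLpNorm k p μ + 2 * eLpNorm k p (μ.restrict (A n)) := by gcongr

end Exhaustion

/-! ### Splitting the commutator around means. -/

section Commutator

variable {X : Type u} [MeasurableSpace X] {μ : Measure X} {𝓑 : Set (Set X)}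
  {star : Set X → Set X} {C₀ : ℝ≥0} {r : ℝ} {m : ℕ} {E : Type v} [NormedAddCommGroup E]
  {𝒯 : (Fin m → X → ℝ) → X → E} {κ : ℝ≥0∞}

/-- The tuple with entries `(b_i - b_{i,S}) f_i` for `α i ≠ 0`, and zero otherwise. -/
def meanTuple (μ : Measure X) (b : Fin m → X → ℝ) (α : Fin m → ℕ) (f : Fin m → X → ℝ)
    (S : Set X) : Fin m → X → ℝ :=
  fun i => if α i ≠ 0 then fun y => (b i y - ⨍ z in S, b i z ∂μ) * f i y else 0

/-- All dependence on `x` sits in the scalar coefficients, and the identity holds for every `S`. So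
the means can follow the stopping ball while the dominated tuple stays fixed. -/
theorem commutator_tuple_eq (b : Fin m → X → ℝ) {α : Fin m → ℕ} (hα : ∀ i, α i ≤ 1)
    (f : Fin m → X → ℝ) (x : X) (S : Set X) :
    (fun i y => (b i x - b i y) ^ α i * f i y) =
      combine (fun i => if α i ≠ 0 then b i x - ⨍ z in S, b i z ∂μ else 1)
        (fun i => if α i ≠ 0 then -1 else 0) f (meanTuple μ b α f S) := by
  funext i y
  simp only [combine, meanTuple]
  rcases Nat.le_one_iff_eq_zero_or_eq_one.1 (hα i) with hi | hi
  · simp [hi]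
  · simp [hi]
    ring

theorem bound_left (S : Set X) (v w : Fin m → X → ℝ) :
    bound μ r S (fun _ => 1) (fun _ => 0) v w = ∏ i, avg μ r S (v i) := by
  simp [bound]

/-- Expanding the product of sums: `τ₁` collects the slots in which the term with `b_i(x) - b_{i,S}`
is chosen. -/
theorem bound_commutator (b : Fin m → X → ℝ) (α : Fin m → ℕ)
    (f : Fin m → X → ℝ) (x : X) (S : Set X) :
    bound μ r S (fun i => if α i ≠ 0 then b i x - ⨍ z in S, b i z ∂μ else 1)
        (fun i => if α i ≠ 0 then -1 else 0) f (meanTuple μ b α f S) =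
      ∑ τ₁ ∈ (Finset.univ.filter (fun i => α i ≠ 0)).powerset,
        coeff μ r b τ₁ (Finset.univ.filter (fun i => α i ≠ 0) \ τ₁) S f x := by
  set τ := Finset.univ.filter (fun i => α i ≠ 0) with hτ
  have hmem : ∀ i, i ∈ τ ↔ α i ≠ 0 := by simp [hτ]
  rw [bound, ← Finset.prod_mul_prod_compl τ]
  have h1 : ∏ i ∈ τ, (‖if α i ≠ 0 then b i x - ⨍ z in S, b i z ∂μ else 1‖ₑ * avg μ r S (f i) +
      ‖(if α i ≠ 0 then -1 else 0 : ℝ)‖ₑ * avg μ r S (meanTuple μ b α f S i)) =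
      ∏ i ∈ τ, (‖b i x - ⨍ z in S, b i z ∂μ‖ₑ * avg μ r S (f i) +
        avg μ r S (fun y => (b i y - ⨍ z in S, b i z ∂μ) * f i y)) := by
    refine Finset.prod_congr rfl fun i hi => ?_
    have hi' := (hmem i).1 hi
    simp [meanTuple, hi']
  have h2 : ∏ i ∈ τᶜ, (‖if α i ≠ 0 then b i x - ⨍ z in S, b i z ∂μ else 1‖ₑ * avg μ r S (f i) +
      ‖(if α i ≠ 0 then -1 else 0 : ℝ)‖ₑ * avg μ r S (meanTuple μ b α f S i)) =
      ∏ i ∈ τᶜ, avg μ r S (f i) := by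
    refine Finset.prod_congr rfl fun i hi => ?_
    have hi' : α i = 0 := by
      by_contra hne
      exact Finset.mem_compl.1 hi ((hmem i).2 hne)
    simp [hi']
  rw [h1, h2, Finset.prod_add, Finset.sum_mul]
  refine Finset.sum_congr rfl fun τ₁ hτ₁ => ?_
  rw [coeff, Finset.union_sdiff_of_subset (Finset.mem_powerset.1 hτ₁)]

end Commutator

/-! ### The top ball, the commutator bound and the main theorem. -/

section Main

variable {X : Type u} [MeasurableSpace X] {μ : Measure X} {𝓑 : Set (Set X)}
  {star : Set X → Set X} {C₀ : ℝ≥0} {r : ℝ} {m : ℕ} {E : Type v} [NormedAddCommGroup E]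
  {κ : ℝ≥0∞}

theorem meanTuple_mem (b : Fin m → X → ℝ) (α : Fin m → ℕ) {f : Fin m → X → ℝ}
    (hf : f ∈ LrTuple μ r m)
    (hbf : ∀ i, α i ≠ 0 → MemLp (fun y => b i y * f i y) (ENNReal.ofReal r) μ) (S : Set X) :
    meanTuple μ b α f S ∈ LrTuple μ r m := by
  intro i
  by_cases hi : α i ≠ 0
  · have : meanTuple μ b α f S i =
        (fun y => b i y * f i y) - (⨍ z in S, b i z ∂μ) • f i := by
      funext y
      simp only [meanTuple, if_pos hi, Pi.sub_apply, Pi.smul_apply, smul_eq_mul]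
      ring
    rw [this]
    exact (hbf i hi).sub ((hf i).const_smul _)
  · simp [meanTuple, hi]

/-- There is a ball containing `B` that, together with all larger balls, carries at least half of
the norms of all the tuples that occur in the domination of the commutator. -/
theorem exists_top_ball (h : IsBallBasis μ 𝓑 star C₀) (hr : 1 ≤ r) {B : Set X} (hB : B ∈ 𝓑)
    (b : Fin m → X → ℝ) (α : Fin m → ℕ) {f : Fin m → X → ℝ} (hf : f ∈ LrTuple μ r m)
    (hbf : ∀ i, α i ≠ 0 → MemLp (fun y => b i y * f i y) (ENNReal.ofReal r) μ) :
    ∃ A ∈ 𝓑, B ⊆ A ∧ ∀ S ∈ 𝓑, A ⊆ S → ∀ i,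
      eLpNorm (f i) (ENNReal.ofReal r) μ ≤
        2 * eLpNorm (f i) (ENNReal.ofReal r) (μ.restrict S) ∧
      eLpNorm (meanTuple μ b α f S i) (ENNReal.ofReal r) μ ≤
        2 * eLpNorm (meanTuple μ b α f S i) (ENNReal.ofReal r) (μ.restrict S) := by
  obtain ⟨x₀, hx₀⟩ := h.nonempty hB
  obtain ⟨G, hG, hexh⟩ := h.exists_exhaustion x₀
  have hx : ∀ x, ∀ᶠ n in Filter.atTop, x ∈ star (G n) := by
    intro x
    obtain ⟨D, hD, hxD, hx₀D⟩ := h.exists_mem x x₀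
    filter_upwards [hexh D hD hx₀D] with n hn
    exact hn hxD
  have hm : ∀ n, MeasurableSet (star (G n)) := fun n => h.measurableSet _ (h.star_mem _ (hG n))
  set g : Fin m → X → ℝ := fun i => if α i ≠ 0 then fun y => b i y * f i y else 0 with hg
  have hgm : ∀ i, MemLp (g i) (ENNReal.ofReal r) μ := by
    intro i
    by_cases hi : α i ≠ 0
    · simpa only [hg, if_pos hi] using hbf i hi
    · simp only [hg, if_neg hi]
      exact MemLp.zero
  have hev : ∀ᶠ n in Filter.atTop, ∀ i, ∀ c d : ℝ,
      eLpNorm (c • f i + d • g i) (ENNReal.ofReal r) μ ≤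
        2 * eLpNorm (c • f i + d • g i) (ENNReal.ofReal r) (μ.restrict (star (G n))) :=
    Filter.eventually_all.2 fun i => eventually_eLpNorm_combination_le hr hm hx (hf i) (hgm i)
  obtain ⟨n, hBn, hn⟩ := ((hexh B hB hx₀).and hev).exists
  refine ⟨star (G n), h.star_mem _ (hG n), hBn, fun S _ hS i => ?_⟩
  have hmono : ∀ k : X → ℝ, eLpNorm k (ENNReal.ofReal r) (μ.restrict (star (G n))) ≤
      eLpNorm k (ENNReal.ofReal r) (μ.restrict S) := fun k =>
    eLpNorm_mono_measure k (Measure.restrict_mono hS le_rfl)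
  constructor
  · have h1 := hn i 1 0
    rw [one_smul, zero_smul, add_zero] at h1
    exact h1.trans (mul_le_mul_right (hmono _) 2)
  · by_cases hi : α i ≠ 0
    -- The mean varies with `S`, but the function stays in the span of `f i` and `b i * f i`, where
    -- the estimate is uniform.
    · have h1 := hn i (-⨍ z in S, b i z ∂μ) 1
      have h2 : (-⨍ z in S, b i z ∂μ) • f i + (1 : ℝ) • g i = meanTuple μ b α f S i := by
        funext y
        simp only [hg, meanTuple, if_pos hi, Pi.add_apply, Pi.smul_apply, smul_eq_mul]
        ring
      rw [h2] at h1
      exact h1.trans (mul_le_mul_right (hmono _) 2)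
    · simp [meanTuple, hi]

theorem IsOscillationOperator.exists_sparse_commutator_bound {𝒯 : (Fin m → X → ℝ) → X → E}
    (hT : IsOscillationOperator μ 𝓑 star r 𝒯 κ) (h : IsBallBasis μ 𝓑 star C₀) (hr : 1 ≤ r)
    (hm : 0 < m) (hκ : κ ≠ ∞) {J : ℕ} {δ : ℝ≥0∞} {θ Λ : ℝ≥0} (hadm : IsAdmissible m r C₀ J δ θ Λ)
    (b : Fin m → X → ℝ) {α : Fin m → ℕ} (hα : ∀ i, α i ≤ 1) {B : Set X} (hB : B ∈ 𝓑)
    {f : Fin m → X → ℝ} (hf : f ∈ LrTuple μ r m)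
    (hbf : ∀ i, α i ≠ 0 → MemLp (fun y => b i y * f i y) (ENNReal.ofReal r) μ) :
    ∃ 𝒮, IsSparse μ 𝓑 (1 / (2 * (C₀ : ℝ≥0∞) ^ 3)) 𝒮 ∧ ∀ᵐ x ∂(μ.restrict B),
      ‖𝒯 f x‖ₑ ≤ dominationConst m C₀ Λ * κ * sparseOp μ r 𝒮 f x ∧
      ‖𝒯 (fun i y => (b i x - b i y) ^ α i * f i y) x‖ₑ ≤ dominationConst m C₀ Λ * κ *
        ∑ τ₁ ∈ (Finset.univ.filter (fun i => α i ≠ 0)).powerset,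
          sparseComm μ r 𝒮 b τ₁ (Finset.univ.filter (fun i => α i ≠ 0) \ τ₁) f x := by
  obtain ⟨A, hA, hBA, htop⟩ := exists_top_ball h hr hB b α hf hbf
  obtain ⟨𝒮, hsparse, hae⟩ := hT.exists_sparse_domination h hr hm hκ hadm hA
    (v := fun _ => f) (w := meanTuple μ b α f) (fun _ _ => hf)
    (fun S _ => meanTuple_mem b α hf hbf S) (fun S hS hAS i => (htop S hS hAS i).1)
    (fun S hS hAS i => (htop S hS hAS i).2)
  refine ⟨𝒮, hsparse, ?_⟩
  rw [ae_restrict_iff' (h.measurableSet B hB)]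
  filter_upwards [hae] with x hx hxB
  constructor
  · have h1 := hx (hBA hxB) f (fun _ _ => 1) (fun _ _ => 0) (fun S _ => by
      funext i
      simp [combine])
    simpa only [bound_left, sparseOp] using h1
  · have h1 := hx (hBA hxB) _ _ _ (fun S _ => commutator_tuple_eq b hα f x S)
    refine h1.trans_eq ?_
    congr 1
    simp only [bound_commutator, sparseComm]
    rw [← Summable.tsum_finsetSum fun _ _ => ENNReal.summable]
    refine tsum_congr fun S => ?_
    by_cases hxS : x ∈ (S : Set X)
    · simp only [indicator_of_mem hxS]
    · simp only [indicator_of_notMem hxS, Finset.sum_const_zero]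

theorem exists_mul_weakNorm_le {T : (Fin m → X → ℝ) → X → ℝ} {κ : ℝ≥0∞} (hκ : opNorm μ r T < κ)
    {f : Fin m → X → ℝ} (hf : f ∈ LrTuple μ r m) (t : ℝ≥0) :
    t * μ {x | (t : ℝ≥0∞) < ‖T f x‖ₑ} ^ ((m : ℝ) / r) ≤
      κ * ∏ i, eLpNorm (f i) (ENNReal.ofReal r) μ := by
  obtain ⟨N, hN, hNκ⟩ := sInf_lt_iff.1 hκ
  have h1 : (t : ℝ≥0∞) * μ {x | (t : ℝ≥0∞) < ‖T f x‖ₑ} ^ (1 / (r / m)) ≤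
      weakNorm μ (r / m) (T f) :=
    le_iSup (fun t : ℝ≥0 => (t : ℝ≥0∞) * μ {x | (t : ℝ≥0∞) < ‖T f x‖ₑ} ^ (1 / (r / m))) t
  rw [one_div_div] at h1
  exact h1.trans ((hN f hf).trans (by gcongr))

/-- A bounded oscillation operator is the norm of an oscillation operator, which takes values in `E`
or is real-valued. -/
theorem IsBoundedOscillation.cases {E : Type v} [NormedAddCommGroup E] [NormedSpace ℝ E]
    {T : (Fin m → X → ℝ) → X → ℝ} {C₁ C₂ : ℝ≥0}
    (hT : IsBoundedOscillation μ 𝓑 star r E T C₁ C₂) (hN : opNorm μ r T < ∞) :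
    (∃ 𝒯 : (Fin m → X → ℝ) → X → E, (∀ f ∈ LrTuple μ r m, ∀ x, ‖T f x‖ₑ = ‖𝒯 f x‖ₑ) ∧
      IsOscillationOperator μ 𝓑 star r 𝒯 (C₁ + C₂ + opNorm μ r T)) ∨
    IsOscillationOperator μ 𝓑 star r T (C₁ + C₂ + opNorm μ r T) := by
  obtain ⟨hC₁, hC₂, -, hcases⟩ := hT
  set κ : ℝ≥0∞ := C₁ + C₂ + opNorm μ r T with hκ
  have h1 : (C₁ : ℝ≥0∞) ≤ κ := le_self_add.trans le_self_add
  have h2 : (C₂ : ℝ≥0∞) ≤ κ := le_add_self.trans le_self_add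
  -- Strictness, from `C₁ + C₂ > 0`, yields an admissible bound below `κ`, since the operator norm
  -- is defined as an infimum.
  have h3 : opNorm μ r T < κ := by
    rw [hκ, add_comm]
    refine ENNReal.lt_add_right hN.ne ?_
    have : (0 : ℝ≥0) < C₁ + C₂ := by positivity
    exact_mod_cast this.ne'
  rcases hcases with ⟨𝒯, hlin, hnorm, hosc⟩ | ⟨hlin, hosc⟩
  · have heq : ∀ f ∈ LrTuple μ r m, ∀ x, ‖T f x‖ₑ = ‖𝒯 f x‖ₑ := by
      intro f hf x
      rw [hnorm f hf x, enorm_norm]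
    refine Or.inl ⟨𝒯, heq, fun f hf i c x => ?_, fun f hf i g hg x => ?_,
      fun f hf B₀ hB₀ hne => ?_, fun f hf B hB x hx x' hx' => ?_, fun f hf t => ?_⟩
    · rw [hlin.map_smul f hf i c x, enorm_smul]
    · rw [hlin.map_add f hf i g hg x]
      exact enorm_add_le _ _
    · obtain ⟨B, hB, hBB, hle⟩ := hosc.size f hf B₀ hB₀ hne
      exact ⟨B, hB, hBB, fun x hx => (hle x hx).trans (mul_le_mul_left h1 _)⟩
    · exact (hosc.regularity f hf B hB x hx x' hx').trans (mul_le_mul_left h2 _)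
    · simp only [← heq f hf]
      exact exists_mul_weakNorm_le h3 hf t
  · refine Or.inr ⟨fun f hf i c x => ?_, fun f hf i g hg x => ?_,
      fun f hf B₀ hB₀ hne => ?_, fun f hf B hB x hx x' hx' => ?_, fun f hf t => ?_⟩
    · rcases hlin with hlin | hlin
      · rw [hlin.map_smul f hf i c x, enorm_smul]
      · have := hlin.map_smul f hf i c x
        rw [← abs_mul] at this
        rw [← enorm_mul, ← Real.enorm_abs, this, Real.enorm_abs]
    · rcases hlin with hlin | hlin
      · rw [hlin.map_add f hf i g hg x]
        exact enorm_add_le _ _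
      · have := hlin.map_add f hf i g hg x
        simp only [Real.enorm_eq_ofReal_abs]
        rw [← ENNReal.ofReal_add (abs_nonneg _) (abs_nonneg _)]
        exact ENNReal.ofReal_le_ofReal this
    · obtain ⟨B, hB, hBB, hle⟩ := hosc.size f hf B₀ hB₀ hne
      exact ⟨B, hB, hBB, fun x hx => (hle x hx).trans (mul_le_mul_left h1 _)⟩
    · exact (hosc.regularity f hf B hB x hx x' hx').trans (mul_le_mul_left h2 _)
    · exact exists_mul_weakNorm_le h3 hf t

theorem commutator_tuple_mem (b : Fin m → X → ℝ) {α : Fin m → ℕ} (hα : ∀ i, α i ≤ 1)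
    {f : Fin m → X → ℝ} (hf : f ∈ LrTuple μ r m)
    (hbf : ∀ i, α i ≠ 0 → MemLp (fun y => b i y * f i y) (ENNReal.ofReal r) μ) (x : X) :
    (fun i y => (b i x - b i y) ^ α i * f i y) ∈ LrTuple μ r m := by
  rw [commutator_tuple_eq (μ := μ) b hα f x univ]
  exact combine_mem hf (meanTuple_mem b α hf hbf univ) _ _

end Main

end

end SparseBO

theorem theorem1p1 (m : ℕ) (hm : 0 < m) (r : ℝ) (hr : 1 ≤ r) (C₀ : ℝ≥0) :
    ∃ K : ℝ≥0, ∀ (X : Type*) [MeasurableSpace X] (μ : Measure X) (𝓑 : Set (Set X))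
      (star : Set X → Set X), SparseBO.IsBallBasis μ 𝓑 star C₀ →
      ∀ (E : Type*) [NormedAddCommGroup E] [NormedSpace ℝ E] [CompleteSpace E]
        (T : (Fin m → X → ℝ) → X → ℝ) (C₁ C₂ : ℝ≥0),
      SparseBO.IsBoundedOscillation μ 𝓑 star r E T C₁ C₂ →
      SparseBO.opNorm μ r T < ∞ →
      ∀ (b : Fin m → X → ℝ) (α : Fin m → ℕ), (∀ i, AEMeasurable (b i) μ) → (∀ i, α i ≤ 1) →
      (∀ i, α i ≠ 0 → ∀ B ∈ 𝓑, IntegrableOn (b i) B μ) →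
      ∀ B ∈ 𝓑, ∀ f ∈ SparseBO.LrTuple μ r m,
      (∀ i, α i ≠ 0 → MemLp (fun y => b i y * f i y) (ENNReal.ofReal r) μ) →
      (∀ i, (1 / 2) * eLpNorm (f i) (ENNReal.ofReal r) μ ^ r
        ≤ eLpNorm (f i) (ENNReal.ofReal r) (μ.restrict B) ^ r) →
      ∃ 𝒮₁ 𝒮₂ : Set (Set X),
        SparseBO.IsSparse μ 𝓑 (1 / (2 * (C₀ : ℝ≥0∞) ^ 3)) 𝒮₁ ∧
        SparseBO.IsSparse μ 𝓑 (1 / (2 * (C₀ : ℝ≥0∞) ^ 3)) 𝒮₂ ∧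
        ∀ᵐ x ∂(μ.restrict B),
          ‖T f x‖ₑ ≤ K * (C₁ + C₂ + SparseBO.opNorm μ r T) *
            (SparseBO.sparseOp μ r 𝒮₁ f x + SparseBO.sparseOp μ r 𝒮₂ f x) ∧
          ‖SparseBO.commutator b α T f x‖ₑ ≤ K * (C₁ + C₂ + SparseBO.opNorm μ r T) *
            ∑ τ₁ ∈ (Finset.univ.filter (fun i => α i ≠ 0)).powerset,
              (SparseBO.sparseComm μ r 𝒮₁ b τ₁
                  (Finset.univ.filter (fun i => α i ≠ 0) \ τ₁) f x +
                SparseBO.sparseComm μ r 𝒮₂ b τ₁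
                  (Finset.univ.filter (fun i => α i ≠ 0) \ τ₁) f x) := by
  by_cases hC : 1 ≤ C₀
  swap
  · exact ⟨0, fun X _ μ 𝓑 star h => absurd h.one_le hC⟩
  obtain ⟨J, δ, θ, Λ, hadm⟩ := SparseBO.exists_isAdmissible m hr hC
  refine ⟨SparseBO.dominationConst m C₀ Λ, ?_⟩
  intro X _ μ 𝓑 star h E _ _ _ T C₁ C₂ hT hN b α _ hα _ B hB f hf hbf _
  have hκ : C₁ + C₂ + SparseBO.opNorm μ r T ≠ ∞ := by finiteness
  have key : ∃ 𝒮, SparseBO.IsSparse μ 𝓑 (1 / (2 * (C₀ : ℝ≥0∞) ^ 3)) 𝒮 ∧ ∀ᵐ x ∂(μ.restrict B),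
      ‖T f x‖ₑ ≤ SparseBO.dominationConst m C₀ Λ * (C₁ + C₂ + SparseBO.opNorm μ r T) *
        SparseBO.sparseOp μ r 𝒮 f x ∧
      ‖T (fun i y => (b i x - b i y) ^ α i * f i y) x‖ₑ ≤
        SparseBO.dominationConst m C₀ Λ * (C₁ + C₂ + SparseBO.opNorm μ r T) *
        ∑ τ₁ ∈ (Finset.univ.filter (fun i => α i ≠ 0)).powerset, SparseBO.sparseComm μ r 𝒮 b τ₁
          (Finset.univ.filter (fun i => α i ≠ 0) \ τ₁) f x := by
    rcases hT.cases hN with ⟨𝒯, hT𝒯, hosc⟩ | hosc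
    · have htuple := SparseBO.commutator_tuple_mem (μ := μ) (r := r) b hα hf hbf
      simp only [hT𝒯 f hf, fun x => hT𝒯 _ (htuple x)]
      exact hosc.exists_sparse_commutator_bound h hr hm hκ hadm b hα hB hf hbf
    · exact hosc.exists_sparse_commutator_bound h hr hm hκ hadm b hα hB hf hbf
  obtain ⟨𝒮, hsparse, hae⟩ := key
  -- A single family suffices and is used twice.
  refine ⟨𝒮, 𝒮, hsparse, hsparse, ?_⟩
  filter_upwards [hae] with x hx
  rw [SparseBO.commutator_apply]
  refine ⟨hx.1.trans ?_, hx.2.trans ?_⟩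
  · gcongr
    exact le_self_add
  · gcongr
    exact le_self_add
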